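/- Consider the Boiti--Leon--Pempinelli (BLP) system \[ u_{ty}=(u^2-u_x)_{xy}+2v_{xxx},\qquad v_t=v_{xx}+2uv_x \] for real functions $u,v$ of $(t,x,y)$. A (local) point symmetry of the system is a $C^\infty$ diffeomorphism $\Phi$ between open subsets of the space $\mathbb R^5$ of the variables $(t,x,y,u,v)$ such that, whenever $\Phi$ maps the graph of a pair of smooth functions (defined on an open subset of $\mathbb R^3$) onto the graph of another such pair, the first pair is a solution of the system if and only if the second one is. (1) The point symmetries that are diffeomorphisms of $\mathbb R^5$ onto itself form a group $G$. The connected component $G_0$ of the identity in $G$, with respect to the $C^\infty$ compact-open topology (uniform convergence of all derivatives on compact sets), is a normal subgroup, and $G/G_0\cong\mathbb Z_2\times\mathbb Z_2$. (2) All local point symmetries form a pseudogroup $\mathcal G$, and the factor of $\mathcal G$ by its identity component is again $\mathbb Z_2\times\mathbb Z_2$, in the following sense. Say that the germ of $\Phi\in\mathcal G$ at a point $p$ lies in the identity component if, on some neighbourhood of $p$, $\Phi$ can be joined with the identity transformation by a smooth family $\Phi_s$, $s\in[0,1]$, of elements of $\mathcal G$. Then there is a map $\sigma$ assigning an element of $\mathbb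 Z_2\times\mathbb Z_2$ to each pair $(\Phi,p)$ with $\Phi\in\mathcal G$ defined at $p$, such that $\sigma(\Psi\circ\Phi,p)=\sigma(\Psi,\Phi(p))\,\sigma(\Phi,p)$ whenever the composition is defined at $p$; $\sigma(\Phi,p)$ is trivial if and only if the germ of $\Phi$ at $p$ lies in the identity component; and for all points $p,q$ and every $a\in\mathbb Z_2\times\mathbb Z_2$ there is $\Phi\in\mathcal G$ with $\Phi(p)=q$ and $\sigma(\Phi,p)=a$. -/

import Mathlib

open scoped ContDiff

/-- The space of the independent variables `(t, x, y)`. -/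
abbrev BLPBase : Type := ℝ × ℝ × ℝ

/-- The space of all variables `(t, x, y, u, v)`. -/
abbrev BLPSpace : Type := ℝ × ℝ × ℝ × ℝ × ℝ

namespace BLP

/-- Partial derivative with respect to `t`. -/
noncomputable def Dt (f : BLPBase → ℝ) : BLPBase → ℝ := fun p => fderiv ℝ f p (1, 0, 0)

/-- Partial derivative with respect to `x`. -/
noncomputable def Dx (f : BLPBase → ℝ) : BLPBase → ℝ := fun p => fderiv ℝ f p (0, 1, 0)

/-- Partial derivative with respect to `y`. -/
noncomputable def Dy (f : BLPBase → ℝ) : BLPBase → ℝ := fun p => fderiv ℝ f p (0, 0, 1)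

/-- The pair `(u, v)` satisfies the Boiti–Leon–Pempinelli system at every point of `Ω`:
`u_ty = (u² - u_x)_xy + 2 v_xxx` and `v_t = v_xx + 2 u v_x`. -/
def Solves (Ω : Set BLPBase) (u v : BLPBase → ℝ) : Prop :=
  ∀ p ∈ Ω,
    Dy (Dt u) p = Dy (Dx (fun q => u q ^ 2 - Dx u q)) p + 2 * Dx (Dx (Dx v)) p ∧
    Dt v p = Dx (Dx v) p + 2 * u p * Dx v p

/-- The graph over `Ω` of the pair of functions `(u, v)` in the space of all variables. -/
def graphOver (Ω : Set BLPBase) (u v : BLPBase → ℝ) : Set BLPSpace :=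
  (fun p : BLPBase => ((p.1, p.2.1, p.2.2, u p, v p) : BLPSpace)) '' Ω

/-- A (local) point symmetry of the system: a smooth diffeomorphism `Φ` between open subsets of the
space of all variables such that, whenever it maps the graph of a pair of smooth functions onto the
graph of another pair of smooth functions, the first pair is a solution of the system if and only
if the second one is. -/
def IsPointSymmetry (Φ : OpenPartialHomeomorph BLPSpace BLPSpace) : Prop :=
  ContDiffOn ℝ ∞ Φ Φ.source ∧ ContDiffOn ℝ ∞ Φ.symm Φ.target ∧
  ∀ (Ω Ω' : Set BLPBase) (u v u' v' : BLPBase → ℝ),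
    IsOpen Ω → IsOpen Ω' →
    ContDiffOn ℝ ∞ u Ω → ContDiffOn ℝ ∞ v Ω → ContDiffOn ℝ ∞ u' Ω' → ContDiffOn ℝ ∞ v' Ω' →
    graphOver Ω u v ⊆ Φ.source → Φ '' graphOver Ω u v = graphOver Ω' u' v' →
    (Solves Ω u v ↔ Solves Ω' u' v')

/-- The group of smooth diffeomorphisms of the space of all variables onto itself. -/
def Diffeo : Subgroup (BLPSpace ≃ₜ BLPSpace) where
  carrier := {Φ | ContDiff ℝ ∞ Φ ∧ ContDiff ℝ ∞ Φ.symm}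
  one_mem' := ⟨contDiff_id, contDiff_id⟩
  mul_mem' := fun ha hb => ⟨ha.1.comp hb.1, hb.2.comp ha.2⟩
  inv_mem' := fun ha => ⟨ha.2, ha.1⟩

/-- The `C^∞` compact-open topology on the diffeomorphism group: uniform convergence, on compact
sets, of the maps and of all their derivatives. -/
noncomputable instance : TopologicalSpace Diffeo :=
  ⨅ k : ℕ, TopologicalSpace.induced
    (fun Φ : Diffeo =>
      UniformOnFun.ofFun {K : Set BLPSpace | IsCompact K} (iteratedFDeriv ℝ k (Φ : BLPSpace ≃ₜ BLPSpace)))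
    inferInstance

/-- The transformation `Φ`, considered near the point `p`, lies in the identity component of the
pseudogroup `𝒢`: on some neighbourhood of `p` it can be joined with the identity transformation
by a smooth one-parameter family of elements of `𝒢`. -/
def InIdentityComponentAt (𝒢 : StructureGroupoid BLPSpace)
    (Φ : OpenPartialHomeomorph BLPSpace BLPSpace) (p : BLPSpace) : Prop :=
  ∃ (U : Set BLPSpace) (F : ℝ × BLPSpace → BLPSpace),
    IsOpen U ∧ p ∈ U ∧ U ⊆ Φ.source ∧
    ContDiffOn ℝ ∞ F (Set.Icc 0 1 ×ˢ U) ∧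
    (∀ q ∈ U, F (0, q) = q) ∧ (∀ q ∈ U, F (1, q) = Φ q) ∧
    ∀ s ∈ Set.Icc (0 : ℝ) 1, ∃ Ψ ∈ 𝒢, U ⊆ Ψ.source ∧ ∀ q ∈ U, F (s, q) = Ψ q

/-- The factor of the pseudogroup `𝒢` by its identity component is the group `A`. In terms of germs:
there is an assignment `σ` of elements of `A` to the germs of elements of `𝒢` that respects
composition, whose kernel is the identity component, and that attains every value on germs with
any given source and target points (so the identity component is transitive, and two germs have
the same value iff they differ by germs from the identity component). -/
def FactorByIdentityComponent (𝒢 : StructureGroupoid BLPSpace) (A : Type) [Group A] : Prop :=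
  ∃ σ : OpenPartialHomeomorph BLPSpace BLPSpace → BLPSpace → A,
    (∀ Φ ∈ 𝒢, ∀ Ψ ∈ 𝒢, ∀ p ∈ (Φ.trans Ψ).source, σ (Φ.trans Ψ) p = σ Ψ (Φ p) * σ Φ p) ∧
    (∀ Φ ∈ 𝒢, ∀ p ∈ Φ.source, σ Φ p = 1 ↔ InIdentityComponentAt 𝒢 Φ p) ∧
    (∀ (a : A) (p q : BLPSpace), ∃ Φ ∈ 𝒢, p ∈ Φ.source ∧ Φ p = q ∧ σ Φ p = a)

end BLP

/-! On a small ball every point symmetry has the form T = T(t), X = a(t)x + b(t), Y = Y(y), U = u/a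
- (a'x + b')/(2a²), V = v/Y' + d(y), where T' = a² and neither a nor Y' vanishes. All of these data
can be deformed to those of the identity, except for the signs of a and Y'. The two signs are
multiplicative under composition, locally constant, and take all four values; this is the group Z₂ ×
Z₂ in both statements.

The definition through solutions is first turned into a pointwise condition on the first
derivatives, `SymAt`. Necessity needs a large supply of solutions. When u_y = v_x, the first
equation follows from the second, and formally u = (k_t - k_xx)/(2k_x) + (log(1 + ck))_x, v = (log(1
+ ck))_y + d is such a solution for any k(t,x) with k_x ≠ 0 and any c(y), d(y). Polynomial k, c, d
realise every first-order jet with u_y = v_x ≠ 0 and leave five second-order parameters free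
(`exists_solution_jet`).

The second equation for the image (`IsPointSymmetry.second_equation`) is then compared coefficient
by coefficient. The second-order parameters give T_x = T_u = T_v = 0, the same for Y, and X_u = V_u
= 0 (`characteristicStructure`). The coefficients of v_y and v_t give Y_t = 0, T_t = X_x² and X_v =
0 (`symbolStructure`). The powers of v_x, and one differentiation in u, give V_x = V_t = 0 and the
formula for U (`jetStructure`).

The first equation reads B_y = 2v_xxx with B = u_t - 2uu_x + u_xx. Under the changes of variables
found so far, B is divided by X_x³ and shifted by a term free of u (`Change.burgers_comp`).
Solutions with u = u₀ + β(t-t₀)² + α(x-x₀)³ and constant v force T_y = X_y = 0, and a solution with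
v_xxx = 1 at the given point forces V_v Y_y = 1 (`IsPointSymmetry.symAt`). The same transformation
rules prove sufficiency (`isPointSymmetry_of_symAt`).

Being pointwise and stable under composition, `SymAt` yields the pseudogroup and the group, and
integrating it yields the explicit form (`exists_symmetryMap`). For positive signs an explicit path
leads to the identity (`Parameters.exists_path`), and germs reduce to this case because they extend
to symmetries of the whole space (`exists_parameters_eventuallyEq`). Conversely, a and Y' cannot
change sign along a continuous family. -/

namespace BLP
open Filter Topology

/-! ### Directional derivatives of second order. -/

section Calculus

variable {E F : Type*} [NormedAddCommGroup E] [NormedSpace ℝ E]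
  [NormedAddCommGroup F] [NormedSpace ℝ F]

theorem contDiffAt_fderiv_apply {f : E → F} {p : E} (hf : ContDiffAt ℝ ∞ f p) (w : E) :
    ContDiffAt ℝ ∞ (fun q => fderiv ℝ f q w) p :=
  (hf.fderiv_right (m := ∞) le_rfl).clm_apply contDiffAt_const

theorem natCast_le_infty (n : ℕ) : (n : WithTop ℕ∞) ≤ ∞ := by exact_mod_cast le_top

theorem contDiffAt_infty_eventually {f : E → F} {p : E} (hf : ContDiffAt ℝ ∞ f p) (n : ℕ) :
    ∀ᶠ q in 𝓝 p, ContDiffAt ℝ n f q :=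
  (hf.of_le (by exact_mod_cast le_top)).eventually (by simp)

theorem eventually_differentiableAt {f : E → F} {p : E} (hf : ContDiffAt ℝ ∞ f p) :
    ∀ᶠ q in 𝓝 p, DifferentiableAt ℝ f q := by
  filter_upwards [contDiffAt_infty_eventually hf 1] with q hq
  exact hq.differentiableAt (by norm_num)

theorem fderiv_apply_comm {f : E → F} {p : E} (hf : ContDiffAt ℝ ∞ f p) (v w : E) :
    fderiv ℝ (fun q => fderiv ℝ f q v) p w = fderiv ℝ (fun q => fderiv ℝ f q w) p v := by
  have hd : DifferentiableAt ℝ (fderiv ℝ f) p :=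
    (hf.fderiv_right (m := ∞) le_rfl).differentiableAt (by simp)
  have hs : IsSymmSndFDerivAt ℝ f p := hf.isSymmSndFDerivAt
    (by simpa using natCast_le_infty 2)
  have h : ∀ a b : E, fderiv ℝ (fun q => fderiv ℝ f q a) p b = fderiv ℝ (fderiv ℝ f) p b a := by
    intro a b
    rw [fderiv_clm_apply hd (differentiableAt_const a)]
    simp
  rw [h, h]
  exact hs w v

/-- Second-order chain rule along one direction. The term linear in the second derivative of the
inner map is what later carries the second-order jet of a solution into the transformed equation. -/
theorem fderiv_fderiv_comp {G : Type*} [NormedAddCommGroup G] [NormedSpace ℝ G]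
    {f : F → G} {g : E → F} {p : E} (hf : ContDiffAt ℝ ∞ f (g p)) (hg : ContDiffAt ℝ ∞ g p) (w : E) :
    fderiv ℝ (fun q => fderiv ℝ (fun r => f (g r)) q w) p w =
      fderiv ℝ (fun y => fderiv ℝ f y (fderiv ℝ g p w)) (g p) (fderiv ℝ g p w) +
        fderiv ℝ f (g p) (fderiv ℝ (fun q => fderiv ℝ g q w) p w) := by
  have hev : (fun q => fderiv ℝ (fun r => f (g r)) q w) =ᶠ[𝓝 p]
      fun q => fderiv ℝ f (g q) (fderiv ℝ g q w) := by
    filter_upwards [eventually_differentiableAt hg,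
      hg.continuousAt.eventually (eventually_differentiableAt hf)] with q h1 h2
    rw [fderiv_fun_comp q h2 h1]
    rfl
  have hgd : DifferentiableAt ℝ g p := hg.differentiableAt (by simp)
  have hd : DifferentiableAt ℝ (fderiv ℝ f) (g p) :=
    (hf.fderiv_right (m := ∞) le_rfl).differentiableAt (by simp)
  have hdw : DifferentiableAt ℝ (fun q => fderiv ℝ g q w) p :=
    (contDiffAt_fderiv_apply hg w).differentiableAt (by simp)
  rw [hev.fderiv_eq]
  have hc : DifferentiableAt ℝ (fun q => fderiv ℝ f (g q)) p := hd.comp p hgd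
  rw [fderiv_clm_apply hc hdw, fderiv_clm_apply hd (differentiableAt_const _)]
  rw [fderiv_fun_comp p hd hgd]
  simp [add_comm]

end Calculus

/-! ### Graphs and their images under a point symmetry. -/

/-- The graph map of the pair `(u, v)`. -/
def lift (u v : BLPBase → ℝ) (q : BLPBase) : BLPSpace := (q.1, q.2.1, q.2.2, u q, v q)

/-- The projection to the space of independent variables. -/
noncomputable def baseProj : BLPSpace →L[ℝ] BLPBase :=
  (ContinuousLinearMap.fst ℝ ℝ _).prod
    (((ContinuousLinearMap.fst ℝ ℝ _).comp (ContinuousLinearMap.snd ℝ ℝ _)).prod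
      ((ContinuousLinearMap.fst ℝ ℝ _).comp
        ((ContinuousLinearMap.snd ℝ ℝ _).comp (ContinuousLinearMap.snd ℝ ℝ _))))

@[simp] theorem baseProj_apply (q : BLPSpace) : baseProj q = (q.1, q.2.1, q.2.2.1) := rfl

theorem contDiffAt_lift {u v : BLPBase → ℝ} {p : BLPBase} (hu : ContDiffAt ℝ ∞ u p)
    (hv : ContDiffAt ℝ ∞ v p) : ContDiffAt ℝ ∞ (lift u v) p := by
  unfold lift
  fun_prop

/-- A point symmetry maps the graph of a solution, near a point where the image is transversal to
the fibres, to the graph of a solution. -/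
theorem IsPointSymmetry.exists_image {Φ : OpenPartialHomeomorph BLPSpace BLPSpace}
    (hΦ : IsPointSymmetry Φ) {Ω : Set BLPBase} {u v : BLPBase → ℝ} {p : BLPBase}
    (hΩ : IsOpen Ω) (hp : p ∈ Ω) (hu : ContDiffOn ℝ ∞ u Ω) (hv : ContDiffOn ℝ ∞ v Ω)
    (hs : Solves Ω u v) (hsrc : lift u v p ∈ Φ.source) (B : BLPBase ≃L[ℝ] BLPBase)
    (hB : fderiv ℝ (fun q => baseProj (Φ (lift u v q))) p = B) :
    ∃ u' v' : BLPBase → ℝ, ∃ Ω' : Set BLPBase, IsOpen Ω' ∧ baseProj (Φ (lift u v p)) ∈ Ω' ∧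
      ContDiffOn ℝ ∞ u' Ω' ∧ ContDiffOn ℝ ∞ v' Ω' ∧ Solves Ω' u' v' ∧
      ∀ᶠ q in 𝓝 p, Φ (lift u v q) = lift u' v' (baseProj (Φ (lift u v q))) := by
  set τ : BLPBase → BLPBase := fun q => baseProj (Φ (lift u v q)) with hτ
  set S : Set BLPBase := Ω ∩ lift u v ⁻¹' Φ.source with hS
  have hliftOn : ContDiffOn ℝ ∞ (lift u v) Ω := fun q hq =>
    (contDiffAt_lift (hu.contDiffAt (hΩ.mem_nhds hq))
      (hv.contDiffAt (hΩ.mem_nhds hq))).contDiffWithinAt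
  have hSo : IsOpen S := hliftOn.continuousOn.isOpen_inter_preimage hΩ Φ.open_source
  have hΦl : ∀ q ∈ S, ContDiffAt ℝ ∞ (fun q => Φ (lift u v q)) q := fun q hq =>
    (hΦ.1.contDiffAt (Φ.open_source.mem_nhds hq.2)).comp q
      (hliftOn.contDiffAt (hΩ.mem_nhds hq.1))
  have hτS : ∀ q ∈ S, ContDiffAt ℝ ∞ τ q := fun q hq =>
    baseProj.contDiff.contDiffAt.comp q (hΦl q hq)
  have hpS : p ∈ S := ⟨hp, hsrc⟩
  have hfd : HasFDerivAt τ (B : BLPBase →L[ℝ] BLPBase) p := by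
    rw [← hB]; exact ((hτS p hpS).differentiableAt (by simp)).hasFDerivAt
  set e := (hτS p hpS).toOpenPartialHomeomorph τ hfd (by simp) with he
  have hecoe : (e : BLPBase → BLPBase) = τ := rfl
  have hpe : p ∈ e.source := (hτS p hpS).mem_toOpenPartialHomeomorph_source hfd (by simp)
  have hcont : ContinuousAt (fderiv ℝ τ) p :=
    ((hτS p hpS).fderiv_right (m := ∞) le_rfl).continuousAt
  -- Invertibility of the derivative is an open condition. It is needed at every point near `p`,
  -- since the inverse function theorem gives smoothness of the local inverse only where the
  -- derivative is known to be invertible.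
  have hinv : {q | ∃ B' : BLPBase ≃L[ℝ] BLPBase, fderiv ℝ τ q = B'} ∈ 𝓝 p := by
    have h1 : Set.range ((↑) : (BLPBase ≃L[ℝ] BLPBase) → (BLPBase →L[ℝ] BLPBase)) ∈
        𝓝 (fderiv ℝ τ p) := by
      rw [hB]; exact ContinuousLinearEquiv.nhds B
    filter_upwards [hcont h1] with q hq
    obtain ⟨B', h⟩ := hq
    exact ⟨B', h.symm⟩
  obtain ⟨W, hWsub, hWo, hpW⟩ := mem_nhds_iff.1
    (inter_mem hinv (inter_mem (hSo.mem_nhds hpS) (e.open_source.mem_nhds hpe)))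
  have hWe : W ⊆ e.source := fun q hq => (hWsub hq).2.2
  have hWS : W ⊆ S := fun q hq => (hWsub hq).2.1
  have hinvS : ∀ q ∈ W, e.symm (τ q) = q := fun q hq => e.left_inv (hWe hq)
  have hΩ'o : IsOpen (τ '' W) := e.isOpen_image_of_subset_source hWo hWe
  have hsymm : ∀ q ∈ W, ContDiffAt ℝ ∞ e.symm (τ q) := by
    intro q hq
    obtain ⟨B', hB'⟩ := (hWsub hq).1
    have hd : HasFDerivAt τ (B' : BLPBase →L[ℝ] BLPBase) q := by
      rw [← hB']; exact ((hτS q (hWS hq)).differentiableAt (by simp)).hasFDerivAt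
    apply e.contDiffAt_symm (f₀' := B') (e.map_source (hWe hq))
    · rw [e.left_inv (hWe hq)]; exact hd
    · rw [e.left_inv (hWe hq)]; exact hτS q (hWS hq)
  have hcomp : ∀ q ∈ W, ContDiffAt ℝ ∞ (fun r => Φ (lift u v (e.symm r))) (τ q) := by
    intro q hq
    have h1 : ContDiffAt ℝ ∞ (fun q => Φ (lift u v q)) (e.symm (τ q)) := by
      rw [hinvS q hq]; exact hΦl q (hWS hq)
    exact h1.comp (τ q) (hsymm q hq)
  have hid : ∀ q ∈ W, Φ (lift u v q) = lift (fun r => (Φ (lift u v (e.symm r))).2.2.2.1)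
      (fun r => (Φ (lift u v (e.symm r))).2.2.2.2) (τ q) := by
    intro q hq
    simp only [lift]
    rw [hinvS q hq]
    simp only [hτ, baseProj_apply, lift]
  refine ⟨fun r => (Φ (lift u v (e.symm r))).2.2.2.1, fun r => (Φ (lift u v (e.symm r))).2.2.2.2,
    τ '' W, hΩ'o, ⟨p, hpW, rfl⟩, ?_, ?_, ?_, ?_⟩
  · rintro _ ⟨q, hq, rfl⟩
    exact (hcomp q hq).snd.snd.snd.fst.contDiffWithinAt
  · rintro _ ⟨q, hq, rfl⟩
    exact (hcomp q hq).snd.snd.snd.snd.contDiffWithinAt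
  · refine (hΦ.2.2 W (τ '' W) u v _ _ hWo hΩ'o (hu.mono fun q hq => (hWS hq).1)
      (hv.mono fun q hq => (hWS hq).1) ?_ ?_ ?_ ?_).1 fun q hq => hs q (hWS hq).1
    · rintro _ ⟨q, hq, rfl⟩
      exact (hcomp q hq).snd.snd.snd.fst.contDiffWithinAt
    · rintro _ ⟨q, hq, rfl⟩
      exact (hcomp q hq).snd.snd.snd.snd.contDiffWithinAt
    · rintro _ ⟨q, hq, rfl⟩
      exact (hWS hq).2
    · ext r
      constructor
      · rintro ⟨_, ⟨q, hq, rfl⟩, rfl⟩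
        exact ⟨τ q, ⟨q, hq, rfl⟩, (hid q hq).symm⟩
      · rintro ⟨_, ⟨q, hq, rfl⟩, rfl⟩
        exact ⟨lift u v q, ⟨q, hq, rfl⟩, hid q hq⟩
  · filter_upwards [hWo.mem_nhds hpW] with q hq using hid q hq

end BLP

/-! ### The second equation carried over by a point symmetry. -/

namespace BLP
open Filter Topology

/-- The tangent map of the graph of a pair of functions with the given first derivatives. -/
def tangent (ut ux uy vt vx vy : ℝ) (ξ : BLPBase) : BLPSpace :=
  (ξ.1, ξ.2.1, ξ.2.2, ut * ξ.1 + ux * ξ.2.1 + uy * ξ.2.2, vt * ξ.1 + vx * ξ.2.1 + vy * ξ.2.2)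

theorem fderiv_apply_eq (f : BLPBase → ℝ) (p ξ : BLPBase) :
    fderiv ℝ f p ξ = Dt f p * ξ.1 + Dx f p * ξ.2.1 + Dy f p * ξ.2.2 := by
  have h : ξ = ξ.1 • ((1, 0, 0) : BLPBase) + ξ.2.1 • ((0, 1, 0) : BLPBase) +
      ξ.2.2 • ((0, 0, 1) : BLPBase) := by
    ext <;> simp
  conv_lhs => rw [h]
  simp only [map_add, map_smul, Dt, Dx, Dy, smul_eq_mul]
  ring

theorem hasFDerivAt_lift {u v : BLPBase → ℝ} {p : BLPBase} (hu : DifferentiableAt ℝ u p)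
    (hv : DifferentiableAt ℝ v p) (ξ : BLPBase) :
    fderiv ℝ (lift u v) p ξ = (ξ.1, ξ.2.1, ξ.2.2, fderiv ℝ u p ξ, fderiv ℝ v p ξ) := by
  have h : HasFDerivAt (lift u v)
      ((ContinuousLinearMap.fst ℝ ℝ (ℝ × ℝ)).prod
        (((ContinuousLinearMap.fst ℝ ℝ ℝ).comp (ContinuousLinearMap.snd ℝ ℝ (ℝ × ℝ))).prod
        (((ContinuousLinearMap.snd ℝ ℝ ℝ).comp (ContinuousLinearMap.snd ℝ ℝ (ℝ × ℝ))).prod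
        ((fderiv ℝ u p).prod (fderiv ℝ v p))))) p :=
    hasFDerivAt_fst.prodMk ((hasFDerivAt_fst.comp p hasFDerivAt_snd).prodMk
      ((hasFDerivAt_snd.comp p hasFDerivAt_snd).prodMk
        (hu.hasFDerivAt.prodMk hv.hasFDerivAt)))
  rw [h.fderiv]
  rfl

theorem fderiv_fderiv_lift {u v : BLPBase → ℝ} {p : BLPBase} (hu : ContDiffAt ℝ ∞ u p)
    (hv : ContDiffAt ℝ ∞ v p) (w : BLPBase) :
    fderiv ℝ (fun q => fderiv ℝ (lift u v) q w) p w =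
      (0, 0, 0, fderiv ℝ (fun q => fderiv ℝ u q w) p w,
        fderiv ℝ (fun q => fderiv ℝ v q w) p w) := by
  have hev : (fun q => fderiv ℝ (lift u v) q w) =ᶠ[𝓝 p]
      fun q => (w.1, w.2.1, w.2.2, fderiv ℝ u q w, fderiv ℝ v q w) := by
    filter_upwards [eventually_differentiableAt hu, eventually_differentiableAt hv] with q h1 h2
    exact hasFDerivAt_lift h1 h2 w
  have h1 := ((contDiffAt_fderiv_apply hu w).differentiableAt (by simp)).hasFDerivAt
  have h2 := ((contDiffAt_fderiv_apply hv w).differentiableAt (by simp)).hasFDerivAt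
  rw [hev.fderiv_eq, ((hasFDerivAt_const w.1 p).prodMk ((hasFDerivAt_const w.2.1 p).prodMk
    ((hasFDerivAt_const w.2.2 p).prodMk (h1.prodMk h2)))).fderiv]
  rfl

/-- An injective endomorphism of the base space as a continuous linear equivalence. -/
theorem exists_equiv_of_injective (B : BLPBase →L[ℝ] BLPBase) (h : ∀ ξ, B ξ = 0 → ξ = 0) :
    ∃ B' : BLPBase ≃L[ℝ] BLPBase, (B' : BLPBase →L[ℝ] BLPBase) = B := by
  have hinj : Function.Injective (B : BLPBase →ₗ[ℝ] BLPBase) :=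
    (injective_iff_map_eq_zero _).2 h
  refine ⟨(LinearEquiv.ofInjectiveEndo (B : BLPBase →ₗ[ℝ] BLPBase)
    hinj).toContinuousLinearEquiv, ContinuousLinearMap.ext fun ξ => rfl⟩

/-- The equation `v_t = v_xx + 2 u v_x` for the image of a solution, in terms of the derivatives of
the point symmetry and of the second-order jet of the solution. -/
theorem IsPointSymmetry.second_equation {Φ : OpenPartialHomeomorph BLPSpace BLPSpace}
    (hΦ : IsPointSymmetry Φ) {Ω : Set BLPBase} {u v : BLPBase → ℝ} {p : BLPBase}
    (hΩ : IsOpen Ω) (hp : p ∈ Ω) (hu : ContDiffOn ℝ ∞ u Ω) (hv : ContDiffOn ℝ ∞ v Ω)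
    (hs : Solves Ω u v) {P : BLPSpace} (hP : lift u v p = P) (hsrc : P ∈ Φ.source)
    {L : BLPBase → BLPSpace} (hL : ∀ ξ, fderiv ℝ (lift u v) p ξ = L ξ)
    (hinj : ∀ ξ, baseProj (fderiv ℝ Φ P (L ξ)) = 0 → ξ = 0)
    {w : BLPBase} (hw : baseProj (fderiv ℝ Φ P (L w)) = (0, 1, 0)) {ℓt ℓx ℓy : ℝ}
    (hℓ : ∀ ξ, ℓt * (fderiv ℝ Φ P (L ξ)).1 + ℓx * (fderiv ℝ Φ P (L ξ)).2.1 +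
      ℓy * (fderiv ℝ Φ P (L ξ)).2.2.1 = (fderiv ℝ Φ P (L ξ)).2.2.2.2)
    {W : BLPSpace}
    (hW : W = fderiv ℝ (fun Q => fderiv ℝ Φ Q (L w)) P (L w) +
      fderiv ℝ Φ P (0, 0, 0, fderiv ℝ (fun q => fderiv ℝ u q w) p w,
        fderiv ℝ (fun q => fderiv ℝ v q w) p w)) :
    ℓt = W.2.2.2.2 - (ℓt * W.1 + ℓx * W.2.1 + ℓy * W.2.2.1) + 2 * (Φ P).2.2.2.1 * ℓx := by
  have hu' := hu.contDiffAt (hΩ.mem_nhds hp)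
  have hv' := hv.contDiffAt (hΩ.mem_nhds hp)
  have hl := contDiffAt_lift hu' hv'
  have hΦP : ContDiffAt ℝ ∞ Φ (lift u v p) := by
    rw [hP]; exact hΦ.1.contDiffAt (Φ.open_source.mem_nhds hsrc)
  have hd1 : fderiv ℝ (fun q => Φ (lift u v q)) p = (fderiv ℝ Φ P).comp (fderiv ℝ (lift u v) p) := by
    rw [← hP]
    exact fderiv_fun_comp p (hΦP.differentiableAt (by simp)) (hl.differentiableAt (by simp))
  have hΦl : ContDiffAt ℝ ∞ (fun q => Φ (lift u v q)) p := hΦP.comp p hl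
  have hlin : ∀ {E : Type} [NormedAddCommGroup E] [NormedSpace ℝ E] (A : BLPSpace →L[ℝ] E),
      ∀ᶠ q in 𝓝 p, fderiv ℝ (fun q => A (Φ (lift u v q))) q =
        A.comp (fderiv ℝ (fun q => Φ (lift u v q)) q) := by
    intro E _ _ A
    filter_upwards [eventually_differentiableAt hΦl] with q hq
    exact (A.hasFDerivAt.comp q hq.hasFDerivAt).fderiv
  have hB0 : fderiv ℝ (fun q => baseProj (Φ (lift u v q))) p =
      baseProj.comp ((fderiv ℝ Φ P).comp (fderiv ℝ (lift u v) p)) := by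
    rw [(hlin baseProj).self_of_nhds, hd1]
  have hBapp : ∀ ξ, fderiv ℝ (fun q => baseProj (Φ (lift u v q))) p ξ =
      baseProj (fderiv ℝ Φ P (L ξ)) := by
    intro ξ
    rw [hB0, ← hL]; rfl
  obtain ⟨B, hB⟩ := exists_equiv_of_injective
    (fderiv ℝ (fun q => baseProj (Φ (lift u v q))) p) (fun ξ h => hinj ξ (by rw [← hBapp, h]))
  obtain ⟨u', v', Ω', hΩ', hpΩ', hu'', hv'', hs', hgr⟩ :=
    hΦ.exists_image hΩ hp hu hv hs (by rw [hP]; exact hsrc) B hB.symm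
  have hv'p := hv''.contDiffAt (hΩ'.mem_nhds hpΩ')
  set τ : BLPBase → BLPBase := fun q => baseProj (Φ (lift u v q)) with hτ
  have hτp : ContDiffAt ℝ ∞ τ p := baseProj.contDiff.contDiffAt.comp p hΦl
  set c5 : BLPSpace →L[ℝ] ℝ := (ContinuousLinearMap.snd ℝ ℝ ℝ).comp
    ((ContinuousLinearMap.snd ℝ ℝ _).comp ((ContinuousLinearMap.snd ℝ ℝ _).comp
      (ContinuousLinearMap.snd ℝ ℝ _))) with hc5
  have hc5a : ∀ Q : BLPSpace, c5 Q = Q.2.2.2.2 := fun Q => rfl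
  have hcomp : (fun q => c5 (Φ (lift u v q))) =ᶠ[𝓝 p] fun q => v' (τ q) := by
    filter_upwards [hgr] with q hq
    rw [hq]; rfl
  -- first derivatives of `v'`
  have h1 : ∀ ξ, fderiv ℝ v' (τ p) (B ξ) = (fderiv ℝ Φ P (L ξ)).2.2.2.2 := by
    intro ξ
    have e1 := (hlin c5).self_of_nhds
    rw [hcomp.fderiv_eq, fderiv_fun_comp p (hv'p.differentiableAt (by simp))
      (hτp.differentiableAt (by simp)), ← hB, hd1] at e1
    have e2 := congrArg (fun A : BLPBase →L[ℝ] ℝ => A ξ) e1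
    rw [← hL]
    exact e2
  have hBL : ∀ ξ, B ξ = baseProj (fderiv ℝ Φ P (L ξ)) := by
    intro ξ
    rw [← hBapp, ← hB]; rfl
  have h2 : ∀ η : BLPBase, fderiv ℝ v' (τ p) η = ℓt * η.1 + ℓx * η.2.1 + ℓy * η.2.2 := by
    intro η
    obtain ⟨ξ, rfl⟩ := B.surjective η
    rw [h1, ← hℓ, hBL]
    rfl
  have hDt : Dt v' (τ p) = ℓt := by simp [Dt, h2]
  have hDx : Dx v' (τ p) = ℓx := by simp [Dx, h2]
  -- second derivatives
  set W' := fderiv ℝ (fun q => fderiv ℝ (fun q => Φ (lift u v q)) q w) p w with hW'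
  have hWW : W' = W := by
    rw [hW', fderiv_fderiv_comp hΦP hl, fderiv_fderiv_lift hu' hv', hL, hP, hW]
  have hlin2 : ∀ {E : Type} [NormedAddCommGroup E] [NormedSpace ℝ E] (A : BLPSpace →L[ℝ] E),
      fderiv ℝ (fun q => fderiv ℝ (fun q => A (Φ (lift u v q))) q w) p w = A W' := by
    intro E _ _ A
    have : (fun q => fderiv ℝ (fun q => A (Φ (lift u v q))) q w) =ᶠ[𝓝 p]
        fun q => A (fderiv ℝ (fun q => Φ (lift u v q)) q w) := by
      filter_upwards [hlin A] with q hq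
      rw [hq]; rfl
    have hd := (contDiffAt_fderiv_apply hΦl w).differentiableAt (by simp)
    rw [this.fderiv_eq]
    exact congrArg (fun T : BLPBase →L[ℝ] E => T w) (A.hasFDerivAt.comp p hd.hasFDerivAt).fderiv
  have h5 := hlin2 c5
  have hev : (fun q => fderiv ℝ (fun q => c5 (Φ (lift u v q))) q w) =ᶠ[𝓝 p]
      fun q => fderiv ℝ (fun q => v' (τ q)) q w := by
    filter_upwards [hcomp.eventuallyEq_nhds] with q hq
    rw [hq.fderiv_eq]
  -- With B the derivative of τ, D²(v' ∘ τ)(w,w) = D²v'(Bw,Bw) + Dv'(D²τ(w,w)). As Bw is the X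
  -- direction, the first term is v'_XX, which therefore equals the V component of `W` minus ℓ
  -- applied to its base components.
  rw [hev.fderiv_eq, fderiv_fderiv_comp (g := τ) hv'p hτp, hlin2 baseProj, ← hB, hWW] at h5
  have hBw : B w = ((0, 1, 0) : BLPBase) := by rw [hBL, hw]
  simp only [ContinuousLinearEquiv.coe_coe, hBw, h2, hc5a, baseProj_apply] at h5
  have hfin := (hs' (τ p) hpΩ').2
  have hU : u' (τ p) = (Φ P).2.2.2.1 := by
    rw [← hP]
    exact (congrArg (fun Q : BLPSpace => Q.2.2.2.1) hgr.self_of_nhds).symm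
  rw [hDt, hDx, hU] at hfin
  have hxx : Dx (Dx v') (τ p) =
      fderiv ℝ (fun y => fderiv ℝ v' y ((0, 1, 0) : BLPBase)) (τ p) (0, 1, 0) := rfl
  rw [hxx] at hfin
  linarith

end BLP

/-! ### Leibniz rules and explicit solutions with u_y = v_x. -/

namespace BLP
open Filter Topology

section Leibniz

variable {E : Type*} [NormedAddCommGroup E] [NormedSpace ℝ E] {f g : E → ℝ} {p : E}

theorem fderiv_mul_apply (hf : DifferentiableAt ℝ f p) (hg : DifferentiableAt ℝ g p) (w : E) :
    fderiv ℝ (fun q => f q * g q) p w = f p * fderiv ℝ g p w + fderiv ℝ f p w * g p := by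
  rw [fderiv_fun_mul hf hg]
  simp [mul_comm]

theorem fderiv_add_apply (hf : DifferentiableAt ℝ f p) (hg : DifferentiableAt ℝ g p) (w : E) :
    fderiv ℝ (fun q => f q + g q) p w = fderiv ℝ f p w + fderiv ℝ g p w := by
  rw [fderiv_fun_add hf hg]
  rfl

theorem fderiv_sub_apply (hf : DifferentiableAt ℝ f p) (hg : DifferentiableAt ℝ g p) (w : E) :
    fderiv ℝ (fun q => f q - g q) p w = fderiv ℝ f p w - fderiv ℝ g p w := by
  rw [fderiv_fun_sub hf hg]
  rfl

theorem differentiableAt_div (hf : DifferentiableAt ℝ f p) (hg : DifferentiableAt ℝ g p)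
    (h0 : g p ≠ 0) : DifferentiableAt ℝ (fun q => f q / g q) p := by
  simp only [div_eq_mul_inv]
  exact hf.fun_mul (hg.fun_inv h0)

theorem fderiv_div_apply (hf : DifferentiableAt ℝ f p) (hg : DifferentiableAt ℝ g p)
    (h0 : g p ≠ 0) (w : E) :
    fderiv ℝ (fun q => f q / g q) p w =
      (fderiv ℝ f p w * g p - f p * fderiv ℝ g p w) / g p ^ 2 := by
  have h : DifferentiableAt ℝ (fun q => f q / g q) p := differentiableAt_div hf hg h0
  have h1 := fderiv_mul_apply h hg w
  have hev : (fun q => f q / g q * g q) =ᶠ[𝓝 p] f := by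
    filter_upwards [hg.continuousAt.eventually_ne h0] with q hq
    exact div_mul_cancel₀ _ hq
  rw [hev.fderiv_eq] at h1
  rw [h1]
  field_simp
  ring

theorem fderiv_fderiv_mul (hf : ContDiffAt ℝ ∞ f p) (hg : ContDiffAt ℝ ∞ g p) (w : E) :
    fderiv ℝ (fun q => fderiv ℝ (fun r => f r * g r) q w) p w =
      f p * fderiv ℝ (fun q => fderiv ℝ g q w) p w + 2 * fderiv ℝ f p w * fderiv ℝ g p w +
        fderiv ℝ (fun q => fderiv ℝ f q w) p w * g p := by
  have hev : (fun q => fderiv ℝ (fun r => f r * g r) q w) =ᶠ[𝓝 p]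
      fun q => f q * fderiv ℝ g q w + fderiv ℝ f q w * g q := by
    filter_upwards [eventually_differentiableAt hf, eventually_differentiableAt hg] with q h1 h2
    exact fderiv_mul_apply h1 h2 w
  have hf1 := hf.differentiableAt (by simp : (∞ : WithTop ℕ∞) ≠ 0)
  have hg1 := hg.differentiableAt (by simp : (∞ : WithTop ℕ∞) ≠ 0)
  have hf2 := (contDiffAt_fderiv_apply hf w).differentiableAt (by simp)
  have hg2 := (contDiffAt_fderiv_apply hg w).differentiableAt (by simp)
  rw [hev.fderiv_eq, fderiv_add_apply (hf1.fun_mul hg2) (hf2.fun_mul hg1), fderiv_mul_apply hf1 hg2,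
    fderiv_mul_apply hf2 hg1]
  ring

theorem fderiv_fderiv_add (hf : ContDiffAt ℝ ∞ f p) (hg : ContDiffAt ℝ ∞ g p) (w : E) :
    fderiv ℝ (fun q => fderiv ℝ (fun r => f r + g r) q w) p w =
      fderiv ℝ (fun q => fderiv ℝ f q w) p w + fderiv ℝ (fun q => fderiv ℝ g q w) p w := by
  have hev : (fun q => fderiv ℝ (fun r => f r + g r) q w) =ᶠ[𝓝 p]
      fun q => fderiv ℝ f q w + fderiv ℝ g q w := by
    filter_upwards [eventually_differentiableAt hf, eventually_differentiableAt hg] with q h1 h2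
    exact fderiv_add_apply h1 h2 w
  rw [hev.fderiv_eq, fderiv_add_apply ((contDiffAt_fderiv_apply hf w).differentiableAt (by simp))
    ((contDiffAt_fderiv_apply hg w).differentiableAt (by simp))]

end Leibniz

/-- Pairs `(ψ_x, ψ_y)` satisfying the second equation of the system satisfy the first one. -/
theorem solves_of_potential {Ω : Set BLPBase} {u v : BLPBase → ℝ} (hΩ : IsOpen Ω)
    (hu : ContDiffOn ℝ ∞ u Ω) (hv : ContDiffOn ℝ ∞ v Ω) (h1 : ∀ q ∈ Ω, Dy u q = Dx v q)
    (h2 : ∀ q ∈ Ω, Dt v q = Dx (Dx v) q + 2 * u q * Dx v q) : Solves Ω u v := by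
  intro p hp
  refine ⟨?_, h2 p hp⟩
  have hn := hΩ.mem_nhds hp
  have hu' := hu.contDiffAt hn
  have hv' := hv.contDiffAt hn
  have hne : (∞ : WithTop ℕ∞) ≠ 0 := by simp
  have hvx : ContDiffAt ℝ ∞ (Dx v) p := contDiffAt_fderiv_apply hv' _
  have hvxx : ContDiffAt ℝ ∞ (Dx (Dx v)) p := contDiffAt_fderiv_apply hvx _
  have hux : ContDiffAt ℝ ∞ (Dx u) p := contDiffAt_fderiv_apply hu' _
  have huvx : ContDiffAt ℝ ∞ (fun q => 2 * u q * Dx v q) p := (contDiffAt_const.mul hu').mul hvx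
  have e1 : Dy u =ᶠ[𝓝 p] Dx v := by filter_upwards [hn] with q hq using h1 q hq
  have e2 : Dt v =ᶠ[𝓝 p] fun q => Dx (Dx v) q + 2 * u q * Dx v q := by
    filter_upwards [hn] with q hq using h2 q hq
  -- The first equation is the x-derivative of the second one: u_ty = v_tx = v_xxx + (2uv_x)_x,
  -- while (u² - u_x)_xy = (2uv_x)_x - v_xxx.
  have a1 : Dy (Dt u) p = Dt (Dy u) p := fderiv_apply_comm hu' _ _
  have a2 : Dt (Dy u) p = Dt (Dx v) p := by
    show fderiv ℝ (Dy u) p _ = fderiv ℝ (Dx v) p _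
    rw [e1.fderiv_eq]
  have a3 : Dt (Dx v) p = Dx (Dt v) p := fderiv_apply_comm hv' _ _
  have a4 : Dx (Dt v) p = Dx (Dx (Dx v)) p + Dx (fun q => 2 * u q * Dx v q) p := by
    show fderiv ℝ (Dt v) p _ = _
    rw [e2.fderiv_eq, fderiv_add_apply (hvxx.differentiableAt hne) (huvx.differentiableAt hne)]
    rfl
  have b1 : Dy (Dx (fun q => u q ^ 2 - Dx u q)) p = Dx (Dy (fun q => u q ^ 2 - Dx u q)) p :=
    fderiv_apply_comm ((hu'.pow 2).sub hux) _ _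
  have b2 : Dy (fun q => u q ^ 2 - Dx u q) =ᶠ[𝓝 p] fun q => 2 * u q * Dx v q - Dx (Dx v) q := by
    filter_upwards [hn, e1.eventuallyEq_nhds] with q hq hq1
    have huq := hu.contDiffAt (hΩ.mem_nhds hq)
    have huxq : ContDiffAt ℝ ∞ (Dx u) q := contDiffAt_fderiv_apply huq _
    have hud := huq.differentiableAt hne
    have c1 : Dy (fun q => u q ^ 2 - Dx u q) q =
        Dy (fun q => u q * u q) q - Dy (Dx u) q := by
      simp only [pow_two]
      exact fderiv_sub_apply (hud.fun_mul hud) (huxq.differentiableAt hne) _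
    have c2 : Dy (fun q => u q * u q) q = u q * Dy u q + Dy u q * u q := fderiv_mul_apply hud hud _
    have c3 : Dy (Dx u) q = Dx (Dy u) q := fderiv_apply_comm huq _ _
    have c4 : Dx (Dy u) q = Dx (Dx v) q := by
      show fderiv ℝ (Dy u) q _ = fderiv ℝ (Dx v) q _
      rw [hq1.fderiv_eq]
    rw [c1, c2, c3, c4, h1 q hq]
    ring
  have b3 : Dx (Dy (fun q => u q ^ 2 - Dx u q)) p =
      Dx (fun q => 2 * u q * Dx v q) p - Dx (Dx (Dx v)) p := by
    show fderiv ℝ (Dy (fun q => u q ^ 2 - Dx u q)) p _ = _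
    rw [b2.fderiv_eq, fderiv_sub_apply (huvx.differentiableAt hne) (hvxx.differentiableAt hne)]
    rfl
  rw [a1, a2, a3, a4, b1, b3]
  ring

/-- Data for a family of explicit solutions: a function `k` of `(t, x)` and functions `c`, `d`
of `y`, together with their derivatives. -/
structure SolutionData where
  (k kt kx kxt kxx n nt nx c c' c'' d d' : BLPBase → ℝ)
  smooth_k : ContDiff ℝ ∞ k
  smooth_kx : ContDiff ℝ ∞ kx
  smooth_n : ContDiff ℝ ∞ n
  smooth_kxx : ContDiff ℝ ∞ kxx
  smooth_c : ContDiff ℝ ∞ c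
  smooth_c' : ContDiff ℝ ∞ c'
  smooth_d : ContDiff ℝ ∞ d
  fderiv_k : ∀ q w, fderiv ℝ k q w = kt q * w.1 + kx q * w.2.1
  fderiv_kx : ∀ q w, fderiv ℝ kx q w = kxt q * w.1 + kxx q * w.2.1
  n_eq : ∀ q, n q = kt q - kxx q
  fderiv_n : ∀ q w, fderiv ℝ n q w = nt q * w.1 + nx q * w.2.1
  fderiv_c : ∀ q w, fderiv ℝ c q w = c' q * w.2.2
  fderiv_c' : ∀ q w, fderiv ℝ c' q w = c'' q * w.2.2
  fderiv_d : ∀ q w, fderiv ℝ d q w = d' q * w.2.2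

namespace SolutionData

variable (S : SolutionData)

/-- The component `u` of the solution. -/
noncomputable def u (q : BLPBase) : ℝ :=
  S.n q / (2 * S.kx q) + S.c q * S.kx q / (1 + S.c q * S.k q)

/-- The component `v` of the solution. -/
noncomputable def v (q : BLPBase) : ℝ := S.c' q * S.k q / (1 + S.c q * S.k q) + S.d q

/-- The domain of the solution. -/
def dom : Set BLPBase := {q | S.kx q ≠ 0} ∩ {q | 1 + S.c q * S.k q ≠ 0}

theorem isOpen_dom : IsOpen S.dom :=
  (isOpen_ne_fun S.smooth_kx.continuous continuous_const).inter
    (isOpen_ne_fun (continuous_const.add (S.smooth_c.continuous.mul S.smooth_k.continuous))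
      continuous_const)

theorem contDiffOn_u : ContDiffOn ℝ ∞ S.u S.dom := by
  intro q hq
  refine ContDiffAt.contDiffWithinAt ?_
  refine (S.smooth_n.contDiffAt.div (contDiffAt_const.mul S.smooth_kx.contDiffAt)
    (mul_ne_zero two_ne_zero hq.1)).add
    ((S.smooth_c.contDiffAt.mul S.smooth_kx.contDiffAt).div
      (contDiffAt_const.add (S.smooth_c.contDiffAt.mul S.smooth_k.contDiffAt)) hq.2)

theorem contDiffOn_v : ContDiffOn ℝ ∞ S.v S.dom := by
  intro q hq
  refine ContDiffAt.contDiffWithinAt ?_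
  exact ((S.smooth_c'.contDiffAt.mul S.smooth_k.contDiffAt).div
      (contDiffAt_const.add (S.smooth_c.contDiffAt.mul S.smooth_k.contDiffAt)) hq.2).add
      S.smooth_d.contDiffAt

theorem differentiable_all : Differentiable ℝ S.k ∧ Differentiable ℝ S.kx ∧ Differentiable ℝ S.n ∧
    Differentiable ℝ S.c ∧ Differentiable ℝ S.c' ∧ Differentiable ℝ S.d ∧
    Differentiable ℝ S.kxx :=
  ⟨S.smooth_k.differentiable (by simp), S.smooth_kx.differentiable (by simp),
    S.smooth_n.differentiable (by simp), S.smooth_c.differentiable (by simp),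
    S.smooth_c'.differentiable (by simp), S.smooth_d.differentiable (by simp),
    S.smooth_kxx.differentiable (by simp)⟩

theorem fderiv_denom (q w : BLPBase) : fderiv ℝ (fun q => 1 + S.c q * S.k q) q w =
    S.c q * (S.kt q * w.1 + S.kx q * w.2.1) + S.c' q * w.2.2 * S.k q := by
  obtain ⟨hk, hkx, hn, hc, hc', hd, -⟩ := S.differentiable_all
  rw [fderiv_add_apply (differentiableAt_const 1) ((hc q).fun_mul (hk q)),
    fderiv_mul_apply (hc q) (hk q), S.fderiv_k, S.fderiv_c]
  simp

theorem fderiv_u {q : BLPBase} (hq : q ∈ S.dom) (w : BLPBase) : fderiv ℝ S.u q w =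
    ((S.nt q * w.1 + S.nx q * w.2.1) * S.kx q - S.n q * (S.kxt q * w.1 + S.kxx q * w.2.1)) /
      (2 * S.kx q ^ 2) +
    ((S.c q * (S.kxt q * w.1 + S.kxx q * w.2.1) + S.c' q * w.2.2 * S.kx q) *
        (1 + S.c q * S.k q) - S.c q * S.kx q *
        (S.c q * (S.kt q * w.1 + S.kx q * w.2.1) + S.c' q * w.2.2 * S.k q)) /
      (1 + S.c q * S.k q) ^ 2 := by
  obtain ⟨hk, hkx, hn, hc, hc', hd, -⟩ := S.differentiable_all
  have h1 : S.kx q ≠ 0 := hq.1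
  have h2 : 1 + S.c q * S.k q ≠ 0 := hq.2
  have hden : Differentiable ℝ (fun q => 1 + S.c q * S.k q) := by fun_prop
  have h2k : Differentiable ℝ (fun q => 2 * S.kx q) := by fun_prop
  have hck : Differentiable ℝ (fun q => S.c q * S.kx q) := by fun_prop
  unfold u
  rw [fderiv_add_apply (differentiableAt_div (hn q) (h2k q) (mul_ne_zero two_ne_zero h1))
    (differentiableAt_div (hck q) (hden q) h2), fderiv_div_apply (hn q) (h2k q) (mul_ne_zero two_ne_zero h1),
    fderiv_div_apply (hck q) (hden q) h2, S.fderiv_denom,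
    fderiv_mul_apply (differentiableAt_const 2) (hkx q), fderiv_mul_apply (hc q) (hkx q),
    S.fderiv_n, S.fderiv_kx, S.fderiv_c]
  simp
  field_simp

theorem fderiv_v {q : BLPBase} (hq : q ∈ S.dom) (w : BLPBase) : fderiv ℝ S.v q w =
    ((S.c' q * (S.kt q * w.1 + S.kx q * w.2.1) + S.c'' q * w.2.2 * S.k q) *
        (1 + S.c q * S.k q) - S.c' q * S.k q *
        (S.c q * (S.kt q * w.1 + S.kx q * w.2.1) + S.c' q * w.2.2 * S.k q)) /
      (1 + S.c q * S.k q) ^ 2 + S.d' q * w.2.2 := by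
  obtain ⟨hk, hkx, hn, hc, hc', hd, -⟩ := S.differentiable_all
  have h2 : 1 + S.c q * S.k q ≠ 0 := hq.2
  have hden : Differentiable ℝ (fun q => 1 + S.c q * S.k q) := by fun_prop
  have hck : Differentiable ℝ (fun q => S.c' q * S.k q) := by fun_prop
  unfold v
  rw [fderiv_add_apply (differentiableAt_div (hck q) (hden q) h2) (hd q),
    fderiv_div_apply (hck q) (hden q) h2, S.fderiv_denom, fderiv_mul_apply (hc' q) (hk q),
    S.fderiv_c', S.fderiv_k, S.fderiv_d]

theorem Dx_v {q : BLPBase} (hq : q ∈ S.dom) :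
    Dx S.v q = S.c' q * S.kx q / (1 + S.c q * S.k q) ^ 2 := by
  have h2 : 1 + S.c q * S.k q ≠ 0 := hq.2
  rw [Dx, S.fderiv_v hq]
  field_simp
  ring

theorem Dx_Dx_v {q : BLPBase} (hq : q ∈ S.dom) :
    Dx (Dx S.v) q = S.c' q * S.kxx q / (1 + S.c q * S.k q) ^ 2 -
      2 * S.c q * S.c' q * S.kx q ^ 2 / (1 + S.c q * S.k q) ^ 3 := by
  obtain ⟨hk, hkx, hn, hc, hc', hd, -⟩ := S.differentiable_all
  have h2 : 1 + S.c q * S.k q ≠ 0 := hq.2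
  have hden : Differentiable ℝ (fun q => 1 + S.c q * S.k q) := by fun_prop
  have hev : Dx S.v =ᶠ[𝓝 q] fun q => S.c' q * S.kx q /
      ((1 + S.c q * S.k q) * (1 + S.c q * S.k q)) := by
    filter_upwards [S.isOpen_dom.mem_nhds hq] with r hr
    rw [S.Dx_v hr, pow_two]
  rw [Dx, hev.fderiv_eq, fderiv_div_apply ((hc' q).fun_mul (hkx q)) ((hden q).fun_mul (hden q))
    (mul_ne_zero h2 h2), fderiv_mul_apply (hc' q) (hkx q), fderiv_mul_apply (hden q) (hden q),
    S.fderiv_denom, S.fderiv_kx, S.fderiv_c']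
  simp
  field_simp
  ring

/-- Formally v - d and u - n/(2k_x) are the y- and x-derivatives of log(1 + ck), and n/(2k_x) does
not depend on y, so u_y = v_x. The summand n/(2k_x) with n = k_t - k_xx compensates exactly for k
not solving the heat equation. -/
theorem solves : Solves S.dom S.u S.v := by
  refine solves_of_potential S.isOpen_dom S.contDiffOn_u S.contDiffOn_v ?_ ?_
  · intro q hq
    have h1 : S.kx q ≠ 0 := hq.1
    have h2 : 1 + S.c q * S.k q ≠ 0 := hq.2
    rw [S.Dx_v hq, Dy, S.fderiv_u hq]
    field_simp
    ring
  · intro q hq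
    have h1 : S.kx q ≠ 0 := hq.1
    have h2 : 1 + S.c q * S.k q ≠ 0 := hq.2
    rw [S.Dx_v hq, S.Dx_Dx_v hq, Dt, S.fderiv_v hq, u, S.n_eq]
    generalize hD : 1 + S.c q * S.k q = D at h2 ⊢
    field_simp
    rw [← hD]
    ring

/-- The second derivatives of `u` where `c` and `k` vanish. -/
theorem fderiv_fderiv_u {q : BLPBase} (hq : q ∈ S.dom) (hc0 : S.c q = 0) (hk0 : S.k q = 0)
    (w : BLPBase) :
    2 * S.kx q * fderiv ℝ (fun q => fderiv ℝ S.u q w) q w =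
      fderiv ℝ (fun q => fderiv ℝ S.n q w) q w -
      2 * S.u q * fderiv ℝ (fun q => fderiv ℝ S.kx q w) q w -
      4 * fderiv ℝ S.kx q w * (fderiv ℝ S.u q w - S.c' q * S.kx q * w.2.2) +
      2 * S.kx q * (S.c'' q * S.kx q * w.2.2 ^ 2 +
        2 * S.c' q * w.2.2 * fderiv ℝ S.kx q w) := by
  obtain ⟨hk, hkx, hn, hc, hc', hd, -⟩ := S.differentiable_all
  have h1 : S.kx q ≠ 0 := hq.1
  have h2 : 1 + S.c q * S.k q ≠ 0 := hq.2
  have hF : ContDiffAt ℝ ∞ (fun q => S.n q / (2 * S.kx q)) q :=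
    S.smooth_n.contDiffAt.div (contDiffAt_const.mul S.smooth_kx.contDiffAt)
      (mul_ne_zero two_ne_zero h1)
  have hden : ContDiffAt ℝ ∞ (fun q => 1 + S.c q * S.k q) q :=
    contDiffAt_const.add (S.smooth_c.contDiffAt.mul S.smooth_k.contDiffAt)
  have hH : ContDiffAt ℝ ∞ (fun q => S.c q * S.kx q / (1 + S.c q * S.k q)) q :=
    (S.smooth_c.contDiffAt.mul S.smooth_kx.contDiffAt).div hden h2
  -- Quotients are not differentiated twice: each summand of u is multiplied by its denominator, and
  -- the second-order product rule is applied to the resulting polynomial identity.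
  have hev1 : (fun q => S.n q / (2 * S.kx q) * (2 * S.kx q)) =ᶠ[𝓝 q] S.n := by
    filter_upwards [S.isOpen_dom.mem_nhds hq] with r hr
    have := hr.1
    exact div_mul_cancel₀ _ (mul_ne_zero two_ne_zero hr.1)
  have hev2 : (fun q => S.c q * S.kx q / (1 + S.c q * S.k q) * (1 + S.c q * S.k q)) =ᶠ[𝓝 q]
      fun q => S.c q * S.kx q := by
    filter_upwards [S.isOpen_dom.mem_nhds hq] with r hr
    exact div_mul_cancel₀ _ hr.2
  have hdd : ∀ {f g : BLPBase → ℝ}, f =ᶠ[𝓝 q] g →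
      fderiv ℝ (fun q => fderiv ℝ f q w) q w = fderiv ℝ (fun q => fderiv ℝ g q w) q w := by
    intro f g h
    have : (fun q => fderiv ℝ f q w) =ᶠ[𝓝 q] fun q => fderiv ℝ g q w := by
      filter_upwards [h.eventuallyEq_nhds] with r hr
      rw [hr.fderiv_eq]
    rw [this.fderiv_eq]
  have e1 := hdd hev1
  have e2 := hdd hev2
  have e1' := congrArg (fun A : BLPBase →L[ℝ] ℝ => A w) hev1.fderiv_eq
  have e2' := congrArg (fun A : BLPBase →L[ℝ] ℝ => A w) hev2.fderiv_eq
  have hk2 : ContDiffAt ℝ ∞ (fun q => 2 * S.kx q) q := contDiffAt_const.mul S.smooth_kx.contDiffAt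
  have hdd2 : fderiv ℝ (fun q => fderiv ℝ (fun q => 2 * S.kx q) q w) q w =
      2 * fderiv ℝ (fun q => fderiv ℝ S.kx q w) q w := by
    rw [fderiv_fderiv_mul contDiffAt_const S.smooth_kx.contDiffAt]
    simp
  have hd2 : fderiv ℝ (fun q => 2 * S.kx q) q w = 2 * fderiv ℝ S.kx q w := by
    rw [fderiv_mul_apply (differentiableAt_const 2) (hkx q)]; simp
  have hcdd : fderiv ℝ (fun q => fderiv ℝ S.c q w) q w = S.c'' q * w.2.2 ^ 2 := by
    simp only [S.fderiv_c]
    rw [fderiv_mul_apply (hc' q) (differentiableAt_const _), S.fderiv_c']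
    simp; ring
  rw [fderiv_fderiv_mul hF hk2, hdd2, hd2] at e1
  rw [fderiv_fderiv_mul hH hden, fderiv_fderiv_mul S.smooth_c.contDiffAt S.smooth_kx.contDiffAt,
    S.fderiv_denom, S.fderiv_c, hcdd, hc0, hk0] at e2
  rw [fderiv_mul_apply (hF.differentiableAt (by simp)) (hk2.differentiableAt (by simp)), hd2] at e1'
  rw [fderiv_mul_apply (hH.differentiableAt (by simp)) (hden.differentiableAt (by simp)),
    S.fderiv_denom, fderiv_mul_apply (hc q) (hkx q), S.fderiv_c, hc0, hk0] at e2'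
  have hu2 : fderiv ℝ (fun q => fderiv ℝ S.u q w) q w = _ := fderiv_fderiv_add hF hH w
  have hu1 : fderiv ℝ S.u q w = _ :=
    fderiv_add_apply (hF.differentiableAt (by simp)) (hH.differentiableAt (by simp)) w
  have hu0 : S.u q = S.n q / (2 * S.kx q) := by simp [u, hc0]
  simp only [zero_mul, mul_zero, add_zero, zero_add, mul_one, zero_div] at e1 e2 e1' e2'
  rw [hu2, hu1, hu0, e2, e2']
  linear_combination e1

/-- The second derivatives of `v` where `c` and `k` vanish. -/
theorem fderiv_fderiv_v {q : BLPBase} (hq : q ∈ S.dom) (hc0 : S.c q = 0) (hk0 : S.k q = 0)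
    (w : BLPBase) :
    fderiv ℝ (fun q => fderiv ℝ S.v q w) q w =
      S.c' q * fderiv ℝ (fun q => fderiv ℝ S.k q w) q w +
      2 * (S.c'' q * w.2.2) * fderiv ℝ S.k q w + fderiv ℝ (fun q => fderiv ℝ S.d q w) q w := by
  obtain ⟨hk, hkx, hn, hc, hc', hd, -⟩ := S.differentiable_all
  have h2 : 1 + S.c q * S.k q ≠ 0 := hq.2
  have hden : ContDiffAt ℝ ∞ (fun q => 1 + S.c q * S.k q) q :=
    contDiffAt_const.add (S.smooth_c.contDiffAt.mul S.smooth_k.contDiffAt)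
  have hH : ContDiffAt ℝ ∞ (fun q => S.c' q * S.k q / (1 + S.c q * S.k q)) q :=
    (S.smooth_c'.contDiffAt.mul S.smooth_k.contDiffAt).div hden h2
  have hev2 : (fun q => S.c' q * S.k q / (1 + S.c q * S.k q) * (1 + S.c q * S.k q)) =ᶠ[𝓝 q]
      fun q => S.c' q * S.k q := by
    filter_upwards [S.isOpen_dom.mem_nhds hq] with r hr
    exact div_mul_cancel₀ _ hr.2
  have e2 : fderiv ℝ (fun q => fderiv ℝ (fun q => S.c' q * S.k q / (1 + S.c q * S.k q) *
      (1 + S.c q * S.k q)) q w) q w = fderiv ℝ (fun q => fderiv ℝ (fun q => S.c' q * S.k q) q w) q w := by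
    have : (fun q => fderiv ℝ (fun q => S.c' q * S.k q / (1 + S.c q * S.k q) *
      (1 + S.c q * S.k q)) q w) =ᶠ[𝓝 q] fun q => fderiv ℝ (fun q => S.c' q * S.k q) q w := by
      filter_upwards [hev2.eventuallyEq_nhds] with r hr
      rw [hr.fderiv_eq]
    rw [this.fderiv_eq]
  rw [fderiv_fderiv_mul hH hden, fderiv_fderiv_mul S.smooth_c'.contDiffAt S.smooth_k.contDiffAt,
    S.fderiv_denom, S.fderiv_c', hc0, hk0] at e2
  have hv2 : fderiv ℝ (fun q => fderiv ℝ S.v q w) q w = _ :=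
    fderiv_fderiv_add hH S.smooth_d.contDiffAt w
  simp only [zero_mul, mul_zero, add_zero, zero_add, mul_one, zero_div] at e2
  rw [hv2, e2]

/-- The third `x`-derivative of `v` where `c` vanishes. -/
theorem Dx_Dx_Dx_v {q : BLPBase} (hq : q ∈ S.dom) (hc0 : S.c q = 0) :
    Dx (Dx (Dx S.v)) q = S.c' q * Dx S.kxx q := by
  obtain ⟨hk, hkx, hn, hc, hc', hd, hkxx⟩ := S.differentiable_all
  have h2 : 1 + S.c q * S.k q ≠ 0 := hq.2
  have hden : Differentiable ℝ (fun q => 1 + S.c q * S.k q) := by fun_prop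
  have hG : ContDiffAt ℝ ∞ (fun q => S.c' q * S.kxx q / (1 + S.c q * S.k q) ^ 2) q :=
    (S.smooth_c'.contDiffAt.mul S.smooth_kxx.contDiffAt).div
      ((contDiffAt_const.add (S.smooth_c.contDiffAt.mul S.smooth_k.contDiffAt)).pow 2)
      (pow_ne_zero 2 h2)
  have hH : ContDiffAt ℝ ∞ (fun q => 2 * S.c' q * S.kx q ^ 2 / (1 + S.c q * S.k q) ^ 3) q :=
    ((contDiffAt_const.mul S.smooth_c'.contDiffAt).mul (S.smooth_kx.contDiffAt.pow 2)).div
      ((contDiffAt_const.add (S.smooth_c.contDiffAt.mul S.smooth_k.contDiffAt)).pow 3)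
      (pow_ne_zero 3 h2)
  have hev : Dx (Dx S.v) =ᶠ[𝓝 q] fun q => S.c' q * S.kxx q / (1 + S.c q * S.k q) ^ 2 -
      S.c q * (2 * S.c' q * S.kx q ^ 2 / (1 + S.c q * S.k q) ^ 3) := by
    filter_upwards [S.isOpen_dom.mem_nhds hq] with r hr
    rw [S.Dx_Dx_v hr]
    ring
  have hden2 : fderiv ℝ (fun q => (1 + S.c q * S.k q) ^ 2) q ((0, 1, 0) : BLPBase) = 0 := by
    simp only [pow_two]
    rw [fderiv_mul_apply (hden q) (hden q), S.fderiv_denom]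
    simp [hc0]
  rw [Dx, hev.fderiv_eq, fderiv_sub_apply (hG.differentiableAt (by simp))
    ((hc q).fun_mul (hH.differentiableAt (by simp))),
    fderiv_mul_apply (hc q) (hH.differentiableAt (by simp)),
    fderiv_div_apply ((hc' q).fun_mul (hkxx q)) ((hden q).fun_pow 2) (pow_ne_zero 2 h2), hden2,
    fderiv_mul_apply (hc' q) (hkxx q), S.fderiv_c', S.fderiv_c, hc0, Dx]
  simp

end SolutionData

end BLP

/-! ### Polynomial solutions with prescribed jets. -/

namespace BLP
open Filter Topology

theorem fderiv_coord (t0 x0 y0 : ℝ) (q w : BLPBase) :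
    fderiv ℝ (fun q : BLPBase => q.1 - t0) q w = w.1 ∧
    fderiv ℝ (fun q : BLPBase => q.2.1 - x0) q w = w.2.1 ∧
    fderiv ℝ (fun q : BLPBase => q.2.2 - y0) q w = w.2.2 := by
  refine ⟨?_, ?_, ?_⟩
  · rw [(hasFDerivAt_fst.sub_const t0).fderiv]; rfl
  · exact congrArg (fun A : BLPBase →L[ℝ] ℝ => A w)
      (((ContinuousLinearMap.fst ℝ ℝ ℝ).comp
        (ContinuousLinearMap.snd ℝ ℝ (ℝ × ℝ))).hasFDerivAt.sub_const x0 (x := q)).fderiv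
  · exact congrArg (fun A : BLPBase →L[ℝ] ℝ => A w)
      (((ContinuousLinearMap.snd ℝ ℝ ℝ).comp
        (ContinuousLinearMap.snd ℝ ℝ (ℝ × ℝ))).hasFDerivAt.sub_const y0 (x := q)).fderiv

theorem fderiv_monomial (t0 x0 y0 a : ℝ) (i j l : ℕ) (q w : BLPBase) :
    fderiv ℝ (fun q : BLPBase => a * (q.1 - t0) ^ i * (q.2.1 - x0) ^ j * (q.2.2 - y0) ^ l) q w =
      a * (i * (q.1 - t0) ^ (i - 1) * (q.2.1 - x0) ^ j * (q.2.2 - y0) ^ l * w.1 +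
        j * (q.1 - t0) ^ i * (q.2.1 - x0) ^ (j - 1) * (q.2.2 - y0) ^ l * w.2.1 +
        l * (q.1 - t0) ^ i * (q.2.1 - x0) ^ j * (q.2.2 - y0) ^ (l - 1) * w.2.2) := by
  obtain ⟨h1, h2, h3⟩ := fderiv_coord t0 x0 y0 q w
  have d1 : DifferentiableAt ℝ (fun q : BLPBase => q.1 - t0) q := by fun_prop
  have d2 : DifferentiableAt ℝ (fun q : BLPBase => q.2.1 - x0) q := by fun_prop
  have d3 : DifferentiableAt ℝ (fun q : BLPBase => q.2.2 - y0) q := by fun_prop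
  have p1 : fderiv ℝ (fun q : BLPBase => (q.1 - t0) ^ i) q w = i * (q.1 - t0) ^ (i - 1) * w.1 := by
    rw [fderiv_fun_pow i d1]; simp [h1]
  have p2 : fderiv ℝ (fun q : BLPBase => (q.2.1 - x0) ^ j) q w =
      j * (q.2.1 - x0) ^ (j - 1) * w.2.1 := by
    rw [fderiv_fun_pow j d2]; simp [h2]
  have p3 : fderiv ℝ (fun q : BLPBase => (q.2.2 - y0) ^ l) q w =
      l * (q.2.2 - y0) ^ (l - 1) * w.2.2 := by
    rw [fderiv_fun_pow l d3]; simp [h3]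
  have c1 := fderiv_mul_apply (differentiableAt_const (c := a)) (d1.fun_pow i) w
  have e1 : DifferentiableAt ℝ (fun q : BLPBase => a * (q.1 - t0) ^ i) q := by fun_prop
  have e2 : DifferentiableAt ℝ (fun q : BLPBase => a * (q.1 - t0) ^ i * (q.2.1 - x0) ^ j) q := by
    fun_prop
  rw [fderiv_mul_apply e2 (d3.fun_pow l), fderiv_mul_apply e1 (d2.fun_pow j), c1, p1, p2, p3]
  simp
  ring

/-- A polynomial in `(t, x)` with given coefficients, centered at `(t0, x0)`. -/
def quartic (t0 x0 a00 a01 a10 a02 a20 a03 a12 a30 a04 : ℝ) (q : BLPBase) : ℝ :=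
  a00 + a01 * (q.2.1 - x0) + a10 * (q.1 - t0) + a02 * (q.2.1 - x0) ^ 2 + a20 * (q.1 - t0) ^ 2 +
    a03 * (q.2.1 - x0) ^ 3 + a12 * ((q.1 - t0) * (q.2.1 - x0) ^ 2) + a30 * (q.1 - t0) ^ 3 +
    a04 * (q.2.1 - x0) ^ 4

theorem contDiff_quartic (t0 x0 a00 a01 a10 a02 a20 a03 a12 a30 a04 : ℝ) :
    ContDiff ℝ ∞ (quartic t0 x0 a00 a01 a10 a02 a20 a03 a12 a30 a04) := by
  unfold quartic
  fun_prop

theorem fderiv_quartic (t0 x0 a00 a01 a10 a02 a20 a03 a12 a30 a04 : ℝ) (q w : BLPBase) :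
    fderiv ℝ (quartic t0 x0 a00 a01 a10 a02 a20 a03 a12 a30 a04) q w =
      (a10 + 2 * a20 * (q.1 - t0) + a12 * (q.2.1 - x0) ^ 2 + 3 * a30 * (q.1 - t0) ^ 2) * w.1 +
      (a01 + 2 * a02 * (q.2.1 - x0) + 3 * a03 * (q.2.1 - x0) ^ 2 +
        2 * a12 * ((q.1 - t0) * (q.2.1 - x0)) + 4 * a04 * (q.2.1 - x0) ^ 3) * w.2.1 := by
  have hm := fderiv_monomial t0 x0 0
  have e : quartic t0 x0 a00 a01 a10 a02 a20 a03 a12 a30 a04 = fun q : BLPBase =>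
      a00 * (q.1 - t0) ^ 0 * (q.2.1 - x0) ^ 0 * (q.2.2 - 0) ^ 0 +
      a01 * (q.1 - t0) ^ 0 * (q.2.1 - x0) ^ 1 * (q.2.2 - 0) ^ 0 +
      a10 * (q.1 - t0) ^ 1 * (q.2.1 - x0) ^ 0 * (q.2.2 - 0) ^ 0 +
      a02 * (q.1 - t0) ^ 0 * (q.2.1 - x0) ^ 2 * (q.2.2 - 0) ^ 0 +
      a20 * (q.1 - t0) ^ 2 * (q.2.1 - x0) ^ 0 * (q.2.2 - 0) ^ 0 +
      a03 * (q.1 - t0) ^ 0 * (q.2.1 - x0) ^ 3 * (q.2.2 - 0) ^ 0 +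
      a12 * (q.1 - t0) ^ 1 * (q.2.1 - x0) ^ 2 * (q.2.2 - 0) ^ 0 +
      a30 * (q.1 - t0) ^ 3 * (q.2.1 - x0) ^ 0 * (q.2.2 - 0) ^ 0 +
      a04 * (q.1 - t0) ^ 0 * (q.2.1 - x0) ^ 4 * (q.2.2 - 0) ^ 0 := by
    funext q; simp only [quartic]; ring
  rw [e]
  repeat rw [fderiv_add_apply (by fun_prop) (by fun_prop)]
  simp only [hm]
  push_cast
  ring

/-- A quadratic polynomial in `y` centered at `y0`. -/
def quadraticY (y0 a0 a1 a2 : ℝ) (q : BLPBase) : ℝ :=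
  a0 + a1 * (q.2.2 - y0) + a2 * (q.2.2 - y0) ^ 2

theorem contDiff_quadraticY (y0 a0 a1 a2 : ℝ) : ContDiff ℝ ∞ (quadraticY y0 a0 a1 a2) := by
  unfold quadraticY
  fun_prop

theorem fderiv_quadraticY (y0 a0 a1 a2 : ℝ) (q w : BLPBase) :
    fderiv ℝ (quadraticY y0 a0 a1 a2) q w = (a1 + 2 * a2 * (q.2.2 - y0)) * w.2.2 := by
  have hm := fderiv_monomial 0 0 y0
  have e : quadraticY y0 a0 a1 a2 = fun q : BLPBase =>
      a0 * (q.1 - 0) ^ 0 * (q.2.1 - 0) ^ 0 * (q.2.2 - y0) ^ 0 +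
      a1 * (q.1 - 0) ^ 0 * (q.2.1 - 0) ^ 0 * (q.2.2 - y0) ^ 1 +
      a2 * (q.1 - 0) ^ 0 * (q.2.1 - 0) ^ 0 * (q.2.2 - y0) ^ 2 := by
    funext q; simp only [quadraticY]; ring
  rw [e]
  repeat rw [fderiv_add_apply (by fun_prop) (by fun_prop)]
  simp only [hm]
  push_cast
  ring

/-- The solution data with polynomial coefficients. -/
noncomputable def polySolution (t0 x0 y0 s r g α γ κ1 κ2 κ3 v0 e κ4 κ5 : ℝ) : SolutionData where
  -- At the base point k = 0, and the parameters are the derivatives k_x = s, k_t = r, k_xx = g,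
  -- k_tt = κ5, k_xxx = α, k_txx = γ, k_ttt = κ1, k_xxxx = κ2. The mixed derivative k_tx is zero
  -- because `quartic` has no such monomial.
  k := quartic t0 x0 0 s r (g / 2) (κ5 / 2) (α / 6) (γ / 2) (κ1 / 6) (κ2 / 24)
  kt := quartic t0 x0 r 0 κ5 (γ / 2) (κ1 / 2) 0 0 0 0
  kx := fun q => quartic t0 x0 s g 0 (α / 2) 0 (κ2 / 6) 0 0 0 q + γ * (q.1 - t0) * (q.2.1 - x0)
  kxt := quartic t0 x0 0 γ 0 0 0 0 0 0 0
  kxx := quartic t0 x0 g α γ (κ2 / 2) 0 0 0 0 0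
  n := quartic t0 x0 (r - g) (-α) (κ5 - γ) (γ / 2 - κ2 / 2) (κ1 / 2) 0 0 0 0
  nt := quartic t0 x0 (κ5 - γ) 0 κ1 0 0 0 0 0 0
  nx := quartic t0 x0 (-α) (γ - κ2) 0 0 0 0 0 0 0
  c := quadraticY y0 0 1 (κ3 / 2)
  c' := quadraticY y0 1 κ3 0
  c'' := fun _ => κ3
  d := quadraticY y0 v0 e (κ4 / 2)
  d' := quadraticY y0 e κ4 0
  smooth_k := contDiff_quartic ..
  smooth_kx := (contDiff_quartic ..).add (by fun_prop)
  smooth_n := contDiff_quartic ..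
  smooth_kxx := contDiff_quartic ..
  smooth_c := contDiff_quadraticY ..
  smooth_c' := contDiff_quadraticY ..
  smooth_d := contDiff_quadraticY ..
  fderiv_k := by
    intro q w; rw [fderiv_quartic]; simp only [quartic]; ring
  fderiv_kx := by
    intro q w
    have h : fderiv ℝ (fun q : BLPBase => γ * (q.1 - t0) * (q.2.1 - x0)) q w =
        γ * (q.2.1 - x0) * w.1 + γ * (q.1 - t0) * w.2.1 := by
      have := fderiv_monomial t0 x0 0 γ 1 1 0 q w
      simp at this
      rw [this]; ring
    rw [fderiv_add_apply (((contDiff_quartic ..).differentiable (by simp)).differentiableAt)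
      (by fun_prop), h, fderiv_quartic]
    simp only [quartic]; ring
  n_eq := by
    intro q; simp only [quartic]; ring
  fderiv_n := by
    intro q w; rw [fderiv_quartic]; simp only [quartic]; ring
  fderiv_c := by
    intro q w; rw [fderiv_quadraticY]; simp only [quadraticY]; ring
  fderiv_c' := by
    intro q w; rw [fderiv_quadraticY]; ring
  fderiv_d := by
    intro q w; rw [fderiv_quadraticY]; simp only [quadraticY]; ring

/-- Through every point there are solutions with prescribed first-order jets subject to
`u_y = v_x ≠ 0`, and with a sufficient freedom in the second-order jets. -/
theorem exists_solution_jet (t0 x0 y0 u0 v0 p q s r e : ℝ) (hs : s ≠ 0) :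
    ∃ Q : ℝ → BLPBase → ℝ, ∀ κ1 κ2 κ3 κ4 κ5 : ℝ, ∃ (Ω : Set BLPBase) (u v : BLPBase → ℝ),
      IsOpen Ω ∧ (t0, x0, y0) ∈ Ω ∧ ContDiffOn ℝ ∞ u Ω ∧ ContDiffOn ℝ ∞ v Ω ∧ Solves Ω u v ∧
      lift u v (t0, x0, y0) = (t0, x0, y0, u0, v0) ∧
      (∀ ξ, fderiv ℝ (lift u v) (t0, x0, y0) ξ = tangent p q s r s e ξ) ∧
      (∀ w, fderiv ℝ (fun z => fderiv ℝ u z w) (t0, x0, y0) w =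
        Q κ5 w + κ1 * w.1 ^ 2 + κ2 * w.2.1 ^ 2 + κ3 * s * w.2.2 ^ 2) ∧
      (∀ w, fderiv ℝ (fun z => fderiv ℝ v z w) (t0, x0, y0) w =
        (r - 2 * u0 * s) * w.2.1 ^ 2 + κ5 * w.1 ^ 2 + κ4 * w.2.2 ^ 2 +
          2 * κ3 * w.2.2 * (s * w.2.1 + r * w.1)) ∧
      Dx (Dx (Dx v)) (t0, x0, y0) = -(2 * s * q + 2 * u0 * (r - 2 * u0 * s)) := by
  -- Where c = k = 0, u is (k_t - k_xx)/(2k_x), so u = u₀, u_x = q, u_t = p determine k_xx = g,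
  -- k_xxx = α and k_txx = γ (below) in this order. Since γ involves κ5, the remainder `Q` must
  -- depend on κ5.
  set g := r - 2 * u0 * s with hg
  set α := -(2 * s * q + 2 * u0 * g) with hα
  refine ⟨fun κ5 w => 1 / (2 * s) * ((κ5 - 2 * s * p) * w.2.1 ^ 2 -
    2 * u0 * (α * w.2.1 ^ 2 + 2 * (κ5 - 2 * s * p) * w.1 * w.2.1) -
    4 * (g * w.2.1) * (p * w.1 + q * w.2.1)) + 2 * w.2.2 * (g * w.2.1), ?_⟩
  intro κ1 κ2 κ3 κ4 κ5
  set γ := κ5 - 2 * s * p with hγ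
  -- The factors 2s undo the division by 2k_x in u; the minus sign is there because k_xxxx enters
  -- n_xx negatively.
  set S := polySolution t0 x0 y0 s r g α γ (2 * s * κ1) (-(2 * s * κ2)) κ3 v0 e κ4 κ5 with hS
  set o : BLPBase := (t0, x0, y0) with ho
  have hc0 : S.c o = 0 := by simp [hS, polySolution, quadraticY, ho]
  have hk0 : S.k o = 0 := by simp [hS, polySolution, quartic, ho]
  have hkx : S.kx o = s := by simp [hS, polySolution, quartic, ho]
  have hkt : S.kt o = r := by simp [hS, polySolution, quartic, ho]
  have hkxx : S.kxx o = g := by simp [hS, polySolution, quartic, ho]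
  have hkxt : S.kxt o = 0 := by simp [hS, polySolution, quartic, ho]
  have hn : S.n o = 2 * u0 * s := by simp [hS, polySolution, quartic, ho, hg]
  have hnt : S.nt o = κ5 - γ := by simp [hS, polySolution, quartic, ho]
  have hnx : S.nx o = -α := by simp [hS, polySolution, quartic, ho]
  have hc' : S.c' o = 1 := by simp [hS, polySolution, quadraticY, ho]
  have hc'' : S.c'' o = κ3 := by simp [hS, polySolution]
  have hd : S.d o = v0 := by simp [hS, polySolution, quadraticY, ho]
  have hd' : S.d' o = e := by simp [hS, polySolution, quadraticY, ho]
  have hdom : o ∈ S.dom := by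
    refine ⟨?_, ?_⟩
    · show S.kx o ≠ 0
      rw [hkx]; exact hs
    · show 1 + S.c o * S.k o ≠ 0
      rw [hc0]; simp
  have hu0 : S.u o = u0 := by
    simp only [SolutionData.u, hc0, hk0, hn, hkx]
    field_simp; ring
  have hv0 : S.v o = v0 := by
    simp [SolutionData.v, hk0, hd]
  have hfu : ∀ w, fderiv ℝ S.u o w = p * w.1 + q * w.2.1 + s * w.2.2 := by
    intro w
    rw [S.fderiv_u hdom, hnt, hnx, hkx, hn, hkxt, hkxx, hc0, hk0, hc', hkt, hγ, hα]
    field_simp; ring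
  have hfv : ∀ w, fderiv ℝ S.v o w = r * w.1 + s * w.2.1 + e * w.2.2 := by
    intro w
    rw [S.fderiv_v hdom, hkt, hkx, hc0, hk0, hc', hd', hc'']
    ring
  have hfk : ∀ w, fderiv ℝ (fun z => fderiv ℝ S.k z w) o w = κ5 * w.1 ^ 2 + g * w.2.1 ^ 2 := by
    intro w
    have h1 : (fun z => fderiv ℝ S.k z w) = fun z => S.kt z * w.1 + S.kx z * w.2.1 :=
      funext fun z => S.fderiv_k z w
    have hkt' : Differentiable ℝ S.kt := (contDiff_quartic ..).differentiable (by simp)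
    have hkx' := S.differentiable_all.2.1
    have h2 : fderiv ℝ S.kt o w = κ5 * w.1 :=
      (fderiv_quartic ..).trans (by simp [ho])
    rw [h1, fderiv_add_apply ((hkt' o).fun_mul (differentiableAt_const _))
      ((hkx' o).fun_mul (differentiableAt_const _)),
      fderiv_mul_apply (hkt' o) (differentiableAt_const _),
      fderiv_mul_apply (hkx' o) (differentiableAt_const _), h2, S.fderiv_kx, hkxt, hkxx]
    simp; ring
  have hfn : ∀ w, fderiv ℝ (fun z => fderiv ℝ S.n z w) o w =
      2 * s * κ1 * w.1 ^ 2 + (γ + 2 * s * κ2) * w.2.1 ^ 2 := by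
    intro w
    have h1 : (fun z => fderiv ℝ S.n z w) = fun z => S.nt z * w.1 + S.nx z * w.2.1 :=
      funext fun z => S.fderiv_n z w
    have hkt' : Differentiable ℝ S.nt := (contDiff_quartic ..).differentiable (by simp)
    have hkx' : Differentiable ℝ S.nx := (contDiff_quartic ..).differentiable (by simp)
    have h2 : fderiv ℝ S.nt o w = 2 * s * κ1 * w.1 :=
      (fderiv_quartic ..).trans (by simp [ho])
    have h3 : fderiv ℝ S.nx o w = (γ + 2 * s * κ2) * w.2.1 :=
      (fderiv_quartic ..).trans (by simp [ho])
    rw [h1, fderiv_add_apply ((hkt' o).fun_mul (differentiableAt_const _))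
      ((hkx' o).fun_mul (differentiableAt_const _)),
      fderiv_mul_apply (hkt' o) (differentiableAt_const _),
      fderiv_mul_apply (hkx' o) (differentiableAt_const _), h2, h3]
    simp; ring
  have hfkx : ∀ w, fderiv ℝ (fun z => fderiv ℝ S.kx z w) o w =
      α * w.2.1 ^ 2 + 2 * γ * w.1 * w.2.1 := by
    intro w
    have h1 : (fun z => fderiv ℝ S.kx z w) = fun z => S.kxt z * w.1 + S.kxx z * w.2.1 :=
      funext fun z => S.fderiv_kx z w
    have hkt' : Differentiable ℝ S.kxt := (contDiff_quartic ..).differentiable (by simp)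
    have hkx' : Differentiable ℝ S.kxx := (contDiff_quartic ..).differentiable (by simp)
    have h2 : fderiv ℝ S.kxt o w = γ * w.2.1 :=
      (fderiv_quartic ..).trans (by simp [ho])
    have h3 : fderiv ℝ S.kxx o w = γ * w.1 + α * w.2.1 :=
      (fderiv_quartic ..).trans (by simp [ho])
    rw [h1, fderiv_add_apply ((hkt' o).fun_mul (differentiableAt_const _))
      ((hkx' o).fun_mul (differentiableAt_const _)),
      fderiv_mul_apply (hkt' o) (differentiableAt_const _),
      fderiv_mul_apply (hkx' o) (differentiableAt_const _), h2, h3]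
    simp; ring
  have hfd : ∀ w, fderiv ℝ (fun z => fderiv ℝ S.d z w) o w = κ4 * w.2.2 ^ 2 := by
    intro w
    have h1 : (fun z => fderiv ℝ S.d z w) = fun z => S.d' z * w.2.2 :=
      funext fun z => S.fderiv_d z w
    have hd1 : Differentiable ℝ S.d' := (contDiff_quadraticY ..).differentiable (by simp)
    have h2 : fderiv ℝ S.d' o w = κ4 * w.2.2 :=
      (fderiv_quadraticY ..).trans (by simp)
    rw [h1, fderiv_mul_apply (hd1 o) (differentiableAt_const _), h2]
    simp; ring
  have hn' := S.isOpen_dom.mem_nhds hdom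
  refine ⟨S.dom, S.u, S.v, S.isOpen_dom, hdom, S.contDiffOn_u, S.contDiffOn_v, S.solves, ?_, ?_,
    ?_, ?_, ?_⟩
  · simp only [lift, hu0, hv0]; rfl
  · intro ξ
    rw [hasFDerivAt_lift ((S.contDiffOn_u.contDiffAt hn').differentiableAt (by simp))
      ((S.contDiffOn_v.contDiffAt hn').differentiableAt (by simp)), hfu, hfv]
    rfl
  · intro w
    have h := S.fderiv_fderiv_u hdom hc0 hk0 w
    rw [hkx, hfn, hu0, hfkx, hfu, hc', hc'', S.fderiv_kx, hkxt, hkxx] at h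
    apply mul_left_cancel₀ (mul_ne_zero two_ne_zero hs)
    rw [h]
    field_simp
    ring
  · intro w
    rw [S.fderiv_fderiv_v hdom hc0 hk0, hfk, hfd, hc', hc'', S.fderiv_k, hkt, hkx]
    ring
  · rw [S.Dx_Dx_Dx_v hdom hc0, hc']
    have : Dx S.kxx o = α :=
      (fderiv_quartic ..).trans (by simp [ho])
    rw [this, one_mul]

end BLP

/-! ### Transversality for generic jets and the highest derivatives in the second equation. -/

namespace BLP
open Filter Topology

/-- The determinant of three vectors of the base space. -/
def det3 (a b c : BLPBase) : ℝ :=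
  a.1 * (b.2.1 * c.2.2 - b.2.2 * c.2.1) - b.1 * (a.2.1 * c.2.2 - a.2.2 * c.2.1) +
    c.1 * (a.2.1 * b.2.2 - a.2.2 * b.2.1)

theorem eq_zero_of_det3_ne_zero {a b c : BLPBase} (h : det3 a b c ≠ 0) {x y z : ℝ}
    (h0 : x • a + y • b + z • c = 0) : x = 0 ∧ y = 0 ∧ z = 0 := by
  have h1 := congrArg Prod.fst h0
  have h2 := congrArg (fun q : BLPBase => q.2.1) h0
  have h3 := congrArg (fun q : BLPBase => q.2.2) h0
  simp at h1 h2 h3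
  unfold det3 at h
  refine ⟨?_, ?_, ?_⟩ <;> apply (mul_eq_zero.1 _).resolve_left h
  · linear_combination (b.2.1 * c.2.2 - b.2.2 * c.2.1) * h1 - (b.1 * c.2.2 - b.2.2 * c.1) * h2 +
      (b.1 * c.2.1 - b.2.1 * c.1) * h3
  · linear_combination -(a.2.1 * c.2.2 - a.2.2 * c.2.1) * h1 + (a.1 * c.2.2 - a.2.2 * c.1) * h2 -
      (a.1 * c.2.1 - a.2.1 * c.1) * h3
  · linear_combination (a.2.1 * b.2.2 - a.2.2 * b.2.1) * h1 - (a.1 * b.2.2 - a.2.2 * b.1) * h2 +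
      (a.1 * b.2.1 - a.2.1 * b.1) * h3

/-- Five vectors spanning the base space are transversal to the tangent space of the graph of some
pair with `u_y = v_x`. -/
theorem exists_det3_ne_zero (a b c d f : BLPBase)
    (hspan : ∀ η : BLPBase, ∃ x1 x2 x3 x4 x5 : ℝ,
      x1 • a + x2 • b + x3 • c + x4 • d + x5 • f = η) :
    ∃ p q s r e : ℝ, det3 (a + p • d + r • f) (b + q • d + s • f) (c + s • d + e • f) ≠ 0 := by
  by_contra! H
  have habc : det3 a b c = 0 := by simpa using H 0 0 0 0 0
  have hdbc : det3 d b c = 0 := by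
    have := H 1 0 0 0 0
    simp [det3] at this habc ⊢; linarith
  have hadc : det3 a d c = 0 := by
    have := H 0 1 0 0 0
    simp [det3] at this habc ⊢; linarith
  have hfbc : det3 f b c = 0 := by
    have := H 0 0 0 1 0
    simp [det3] at this habc ⊢; linarith
  have habf : det3 a b f = 0 := by
    have := H 0 0 0 0 1
    simp [det3] at this habc ⊢; linarith
  -- The same parameter s = u_y = v_x multiplies `d` and `f`, so its linear coefficient only yields
  -- a sum of two minors.
  have hsum : det3 a f c + det3 a b d = 0 := by
    have h1 := H 0 0 1 0 0
    have h2 := H 0 0 (-1) 0 0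
    simp [det3] at h1 h2 ⊢; linarith
  have hafd : det3 a f d = 0 := by
    have h1 := H 0 0 1 0 0
    have h2 := H 0 0 (-1) 0 0
    simp [det3] at h1 h2 habc ⊢; linarith
  have hdfc : det3 d f c = 0 := by
    have h1 := H 1 0 1 0 0
    simp [det3] at h1 hsum habc hafd hdbc ⊢; linarith
  have hdbf : det3 d b f = 0 := by
    have h1 := H 1 0 0 0 1
    simp [det3] at h1 habf habc hdbc ⊢; linarith
  -- A Plücker relation separates the two minors: their product vanishes as well as their sum, hence
  -- so does each of them.
  have hpl : det3 a b d * det3 a f c = 0 := by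
    have : det3 a b d * det3 a f c =
        det3 a b c * det3 a f d + det3 a b f * det3 a d c := by
      simp only [det3]; ring
    rw [this, habc, habf]; ring
  have habd : det3 a b d = 0 := by
    have : det3 a f c = -det3 a b d := by linarith
    rw [this] at hpl
    have h2 : det3 a b d * det3 a b d = 0 := by linarith
    exact mul_self_eq_zero.1 h2
  have hafc : det3 a f c = 0 := by linarith
  obtain ⟨x1, x2, x3, x4, x5, hx⟩ := hspan (1, 0, 0)
  obtain ⟨y1, y2, y3, y4, y5, hy⟩ := hspan (0, 1, 0)
  obtain ⟨z1, z2, z3, z4, z5, hz⟩ := hspan (0, 0, 1)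
  have hone : det3 (1, 0, 0) (0, 1, 0) (0, 0, 1) = 1 := by simp [det3]
  have m3 : ∀ u1 u2 u3 v1 v2 v3 w1 w2 w3 : ℝ, det3 (u1, u2, u3) (v1, v2, v3) (w1, w2, w3) =
      u1 * (v2 * w3 - v3 * w2) - v1 * (u2 * w3 - u3 * w2) + w1 * (u2 * v3 - u3 * v2) := by
    intros; rfl
  rw [← hx, ← hy, ← hz] at hone
  -- Cauchy–Binet: the determinant of the standard basis expands in the ten minors of the five
  -- vectors. All of them vanish, although this determinant is 1.
  have key : det3 (x1 • a + x2 • b + x3 • c + x4 • d + x5 • f)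
      (y1 • a + y2 • b + y3 • c + y4 • d + y5 • f)
      (z1 • a + z2 • b + z3 • c + z4 • d + z5 • f) =
      det3 (x1, x2, x3) (y1, y2, y3) (z1, z2, z3) * det3 a b c +
      det3 (x1, x2, x4) (y1, y2, y4) (z1, z2, z4) * det3 a b d +
      det3 (x1, x2, x5) (y1, y2, y5) (z1, z2, z5) * det3 a b f -
      det3 (x1, x3, x4) (y1, y3, y4) (z1, z3, z4) * det3 a d c -
      det3 (x1, x3, x5) (y1, y3, y5) (z1, z3, z5) * det3 a f c -
      det3 (x1, x4, x5) (y1, y4, y5) (z1, z4, z5) * det3 a f d +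
      det3 (x2, x3, x4) (y2, y3, y4) (z2, z3, z4) * det3 d b c +
      det3 (x2, x3, x5) (y2, y3, y5) (z2, z3, z5) * det3 f b c -
      det3 (x2, x4, x5) (y2, y4, y5) (z2, z4, z5) * det3 d b f +
      det3 (x3, x4, x5) (y3, y4, y5) (z3, z4, z5) * det3 d f c := by
    simp only [det3, Prod.fst_add, Prod.snd_add, Prod.smul_fst, Prod.smul_snd, smul_eq_mul]
    ring
  rw [key, habc, habd, habf, hadc, hafc, hafd, hdbc, hfbc, hdbf, hdfc] at hone
  simp at hone

/-- The tangent map as a continuous linear map. -/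
noncomputable def tangentL (ut ux uy vt vx vy : ℝ) : BLPBase →L[ℝ] BLPSpace :=
  LinearMap.toContinuousLinearMap
    { toFun := tangent ut ux uy vt vx vy
      map_add' := by intro a b; simp [tangent]; constructor <;> ring
      map_smul' := by intro a b; simp [tangent]; constructor <;> ring }

@[simp] theorem tangentL_apply (ut ux uy vt vx vy : ℝ) (ξ : BLPBase) :
    tangentL ut ux uy vt vx vy ξ = tangent ut ux uy vt vx vy ξ := rfl

theorem space_decomp (z : BLPSpace) : z = z.1 • ((1, 0, 0, 0, 0) : BLPSpace) +
    z.2.1 • ((0, 1, 0, 0, 0) : BLPSpace) + z.2.2.1 • ((0, 0, 1, 0, 0) : BLPSpace) +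
    z.2.2.2.1 • ((0, 0, 0, 1, 0) : BLPSpace) + z.2.2.2.2 • ((0, 0, 0, 0, 1) : BLPSpace) := by
  ext <;> simp

theorem map_space (M : BLPSpace →L[ℝ] BLPSpace) (z : BLPSpace) :
    M z = z.1 • M (1, 0, 0, 0, 0) + z.2.1 • M (0, 1, 0, 0, 0) + z.2.2.1 • M (0, 0, 1, 0, 0) +
      z.2.2.2.1 • M (0, 0, 0, 1, 0) + z.2.2.2.2 • M (0, 0, 0, 0, 1) := by
  conv_lhs => rw [space_decomp z]
  simp only [map_add, map_smul]

/-- The Jacobian of the restriction of the base components to the tangent space of a graph. -/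
noncomputable def jac (M : BLPSpace →L[ℝ] BLPSpace) (p q s r e : ℝ) : ℝ :=
  det3 (baseProj (M (1, 0, 0, p, r))) (baseProj (M (0, 1, 0, q, s))) (baseProj (M (0, 0, 1, s, e)))

theorem jac_eq (M : BLPSpace →L[ℝ] BLPSpace) (p q s r e : ℝ) : jac M p q s r e =
    det3 (baseProj (M (1, 0, 0, 0, 0)) + p • baseProj (M (0, 0, 0, 1, 0)) +
        r • baseProj (M (0, 0, 0, 0, 1)))
      (baseProj (M (0, 1, 0, 0, 0)) + q • baseProj (M (0, 0, 0, 1, 0)) +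
        s • baseProj (M (0, 0, 0, 0, 1)))
      (baseProj (M (0, 0, 1, 0, 0)) + s • baseProj (M (0, 0, 0, 1, 0)) +
        e • baseProj (M (0, 0, 0, 0, 1))) := by
  unfold jac
  rw [map_space M (1, 0, 0, p, r), map_space M (0, 1, 0, q, s), map_space M (0, 0, 1, s, e)]
  simp only [zero_smul, add_zero, one_smul, map_add, map_smul, zero_add]

theorem tangent_decomp (p q s r e : ℝ) (ξ : BLPBase) : tangent p q s r s e ξ =
    ξ.1 • ((1, 0, 0, p, r) : BLPSpace) + ξ.2.1 • ((0, 1, 0, q, s) : BLPSpace) +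
      ξ.2.2 • ((0, 0, 1, s, e) : BLPSpace) := by
  simp [tangent]
  constructor <;> ring

/-- A nonzero `jac` makes the base components of the image tangent space coordinates on it. Then `w`
is the direction mapped to the X axis, and the numbers ℓ are the first derivatives of the new v,
exactly the data that `second_equation` asks for. -/
theorem transversal_of_jac {M : BLPSpace →L[ℝ] BLPSpace} {p q s r e : ℝ}
    (h : jac M p q s r e ≠ 0) :
    (∀ ξ, baseProj (M (tangent p q s r s e ξ)) = 0 → ξ = 0) ∧
    ∃ (w : BLPBase) (ℓt ℓx ℓy : ℝ), baseProj (M (tangent p q s r s e w)) = (0, 1, 0) ∧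
      ∀ ξ, ℓt * (M (tangent p q s r s e ξ)).1 + ℓx * (M (tangent p q s r s e ξ)).2.1 +
        ℓy * (M (tangent p q s r s e ξ)).2.2.1 = (M (tangent p q s r s e ξ)).2.2.2.2 := by
  have hinj : ∀ ξ, baseProj (M (tangent p q s r s e ξ)) = 0 → ξ = 0 := by
    intro ξ hξ
    rw [tangent_decomp] at hξ
    simp only [map_add, map_smul] at hξ
    obtain ⟨h1, h2, h3⟩ := eq_zero_of_det3_ne_zero h hξ
    ext
    · exact h1
    · exact h2
    · exact h3
  refine ⟨hinj, ?_⟩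
  obtain ⟨B, hB⟩ := exists_equiv_of_injective
    (baseProj.comp (M.comp (tangentL p q s r s e))) (fun ξ h => hinj ξ h)
  have hBa : ∀ ξ, B ξ = baseProj (M (tangent p q s r s e ξ)) := fun ξ =>
    congrArg (fun A : BLPBase →L[ℝ] BLPBase => A ξ) hB
  set ℓ : BLPBase → ℝ := fun η => (M (tangentL p q s r s e (B.symm η))).2.2.2.2 with hℓ
  refine ⟨B.symm (0, 1, 0), ℓ (1, 0, 0), ℓ (0, 1, 0), ℓ (0, 0, 1), ?_, ?_⟩
  · rw [← hBa, B.apply_symm_apply]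
  · intro ξ
    have h1 : ξ = (B ξ).1 • B.symm ((1, 0, 0) : BLPBase) +
        (B ξ).2.1 • B.symm ((0, 1, 0) : BLPBase) + (B ξ).2.2 • B.symm ((0, 0, 1) : BLPBase) := by
      rw [← map_smul, ← map_smul, ← map_smul, ← map_add, ← map_add, ← B.symm_apply_apply ξ,
        B.symm_apply_apply]
      ext <;> simp
    have h2 : (M (tangentL p q s r s e ξ)).2.2.2.2 =
        (B ξ).1 * ℓ (1, 0, 0) + (B ξ).2.1 * ℓ (0, 1, 0) + (B ξ).2.2 * ℓ (0, 0, 1) := by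
      conv_lhs => rw [h1]
      simp only [map_add, map_smul, Prod.snd_add, Prod.smul_snd, smul_eq_mul, hℓ]
    rw [tangentL_apply] at h2
    rw [h2, hBa]
    simp only [baseProj_apply]
    ring

/-- The derivative of a diffeomorphism at a point of its domain is invertible. -/
theorem exists_inverse_fderiv {Φ : OpenPartialHomeomorph BLPSpace BLPSpace}
    (h1 : ContDiffOn ℝ ∞ Φ Φ.source) (h2 : ContDiffOn ℝ ∞ Φ.symm Φ.target) {P : BLPSpace}
    (hP : P ∈ Φ.source) : ∃ N : BLPSpace →L[ℝ] BLPSpace, (∀ z, N (fderiv ℝ Φ P z) = z) ∧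
      ∀ z, fderiv ℝ Φ P (N z) = z := by
  have d1 : DifferentiableAt ℝ Φ P :=
    (h1.contDiffAt (Φ.open_source.mem_nhds hP)).differentiableAt (by simp)
  have d2 : DifferentiableAt ℝ Φ.symm (Φ P) :=
    (h2.contDiffAt (Φ.open_target.mem_nhds (Φ.map_source hP))).differentiableAt (by simp)
  have d1' : DifferentiableAt ℝ Φ (Φ.symm (Φ P)) := by rwa [Φ.left_inv hP]
  have e1 : (fun Q => Φ.symm (Φ Q)) =ᶠ[𝓝 P] id := by
    filter_upwards [Φ.open_source.mem_nhds hP] with Q hQ using Φ.left_inv hQ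
  have e2 : (fun Q => Φ (Φ.symm Q)) =ᶠ[𝓝 (Φ P)] id := by
    filter_upwards [Φ.open_target.mem_nhds (Φ.map_source hP)] with Q hQ using Φ.right_inv hQ
  refine ⟨fderiv ℝ Φ.symm (Φ P), fun z => ?_, fun z => ?_⟩
  · have := e1.fderiv_eq (𝕜 := ℝ)
    rw [fderiv_fun_comp P d2 d1, fderiv_id] at this
    exact congrArg (fun A : BLPSpace →L[ℝ] BLPSpace => A z) this
  · have := e2.fderiv_eq (𝕜 := ℝ)
    rw [fderiv_fun_comp (Φ P) d1' d2, fderiv_id, Φ.left_inv hP] at this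
    exact congrArg (fun A : BLPSpace →L[ℝ] BLPSpace => A z) this

/-- The restrictions on the derivative of a point symmetry that arise from the highest derivatives
in the second equation, for a given first-order jet. -/
theorem IsPointSymmetry.jet_relations {Φ : OpenPartialHomeomorph BLPSpace BLPSpace}
    (hΦ : IsPointSymmetry Φ) {P : BLPSpace} (hP : P ∈ Φ.source) {M : BLPSpace →L[ℝ] BLPSpace}
    (hM : fderiv ℝ Φ P = M) {p q s r e : ℝ} (hs : s ≠ 0)
    (hj : jac M p q s r e ≠ 0) :
    (M (0, 1, 0, q, s)).1 = 0 ∧ (M (0, 1, 0, q, s)).2.2.1 = 0 ∧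
    ∃ ℓt ℓx ℓy : ℝ, ℓx * (M (0, 1, 0, q, s)).2.1 = (M (0, 1, 0, q, s)).2.2.2.2 ∧
      (M (0, 0, 0, 1, 0)).2.2.2.2 = ℓt * (M (0, 0, 0, 1, 0)).1 + ℓx * (M (0, 0, 0, 1, 0)).2.1 +
        ℓy * (M (0, 0, 0, 1, 0)).2.2.1 := by
  obtain ⟨t0, x0, y0, u0, v0⟩ := P
  obtain ⟨hinj, w, ℓt, ℓx, ℓy, hw, hℓ⟩ := transversal_of_jac hj
  obtain ⟨Q, hQ⟩ := exists_solution_jet t0 x0 y0 u0 v0 p q s r e hs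
  obtain ⟨N, hN1, hN2⟩ := exists_inverse_fderiv hΦ.1 hΦ.2.1 hP
  rw [hM] at hN1 hN2
  -- `Au` and `Av` are the coefficients with which the second derivatives of u and v along `w` enter
  -- the transformed equation. Everything else there depends on the first-order jet only, whence the
  -- constant `K`.
  set Au := (M (0, 0, 0, 1, 0)).2.2.2.2 - (ℓt * (M (0, 0, 0, 1, 0)).1 +
    ℓx * (M (0, 0, 0, 1, 0)).2.1 + ℓy * (M (0, 0, 0, 1, 0)).2.2.1) with hAu
  set Av := (M (0, 0, 0, 0, 1)).2.2.2.2 - (ℓt * (M (0, 0, 0, 0, 1)).1 +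
    ℓx * (M (0, 0, 0, 0, 1)).2.1 + ℓy * (M (0, 0, 0, 0, 1)).2.2.1) with hAv
  obtain ⟨K, hK⟩ : ∃ K : ℝ, ∀ κ1 κ2 κ3 κ4 κ5 : ℝ,
      Au * (Q κ5 w + κ1 * w.1 ^ 2 + κ2 * w.2.1 ^ 2 + κ3 * s * w.2.2 ^ 2) +
      Av * ((r - 2 * u0 * s) * w.2.1 ^ 2 + κ5 * w.1 ^ 2 + κ4 * w.2.2 ^ 2 +
          2 * κ3 * w.2.2 * (s * w.2.1 + r * w.1)) = K := by
    set W0 := fderiv ℝ (fun R => fderiv ℝ Φ R (tangent p q s r s e w)) (t0, x0, y0, u0, v0)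
      (tangent p q s r s e w) with hW0
    refine ⟨ℓt - 2 * (Φ (t0, x0, y0, u0, v0)).2.2.2.1 * ℓx - (W0.2.2.2.2 -
      (ℓt * W0.1 + ℓx * W0.2.1 + ℓy * W0.2.2.1)), ?_⟩
    intro κ1 κ2 κ3 κ4 κ5
    obtain ⟨Ω, u, v, hΩ, hp, hu, hv, hsol, hl, hL, huw, hvw, -⟩ := hQ κ1 κ2 κ3 κ4 κ5
    have h := hΦ.second_equation hΩ hp hu hv hsol hl hP hL
      (by rw [hM]; exact hinj) (by rw [hM]; exact hw) (by rw [hM]; exact hℓ) rfl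
    rw [← hW0, hM, huw, hvw, map_space M (0, 0, 0, _, _)] at h
    simp only [zero_smul, zero_add, Prod.fst_add, Prod.snd_add, Prod.smul_fst, Prod.smul_snd,
      smul_eq_mul] at h
    rw [hAu, hAv]
    linear_combination -h
  -- Otherwise the functional V - ℓ(T,X,Y) would kill the whole image of `M`, which is surjective.
  have hA0 : ¬ (Au = 0 ∧ Av = 0) := by
    rintro ⟨h1, h2⟩
    set z := N (0, 0, 0, 0, 1) with hz
    have hMz : M z = (0, 0, 0, 0, 1) := hN2 _
    have hdec : z = tangent p q s r s e (z.1, z.2.1, z.2.2.1) +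
        (z.2.2.2.1 - (p * z.1 + q * z.2.1 + s * z.2.2.1)) • ((0, 0, 0, 1, 0) : BLPSpace) +
        (z.2.2.2.2 - (r * z.1 + s * z.2.1 + e * z.2.2.1)) • ((0, 0, 0, 0, 1) : BLPSpace) := by
      ext <;> simp [tangent]
    have hl := hℓ (z.1, z.2.1, z.2.2.1)
    have hMz' := hMz
    rw [hdec] at hMz'
    simp only [map_add, map_smul] at hMz'
    have c1 := congrArg (fun y : BLPSpace => y.1) hMz'
    have c2 := congrArg (fun y : BLPSpace => y.2.1) hMz'
    have c3 := congrArg (fun y : BLPSpace => y.2.2.1) hMz'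
    have c5 := congrArg (fun y : BLPSpace => y.2.2.2.2) hMz'
    simp only [Prod.fst_add, Prod.snd_add, Prod.smul_fst, Prod.smul_snd, smul_eq_mul]
      at c1 c2 c3 c5
    rw [hAu] at h1
    rw [hAv] at h2
    have : (1 : ℝ) = 0 := by
      linear_combination -c5 + ℓt * c1 + ℓx * c2 + ℓy * c3 - hl +
        (z.2.2.2.1 - (p * z.1 + q * z.2.1 + s * z.2.2.1)) * h1 +
        (z.2.2.2.2 - (r * z.1 + s * z.2.1 + e * z.2.2.1)) * h2
    exact one_ne_zero this
  have hw0 : ¬ (w.1 = 0 ∧ w.2.1 = 0 ∧ w.2.2 = 0) := by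
    rintro ⟨h1, h2, h3⟩
    have : w = 0 := by ext <;> assumption
    rw [this, tangent_decomp] at hw
    simp at hw
  have k0 := hK 0 0 0 0 0
  have k1 : Au * w.1 ^ 2 = 0 := by linear_combination hK 1 0 0 0 0 - k0
  have k2 : Au * w.2.1 ^ 2 = 0 := by linear_combination hK 0 1 0 0 0 - k0
  have k3 : Au * (s * w.2.2 ^ 2) + Av * (2 * w.2.2 * (s * w.2.1 + r * w.1)) = 0 := by
    linear_combination hK 0 0 1 0 0 - k0
  have k4 : Av * w.2.2 ^ 2 = 0 := by linear_combination hK 0 0 0 1 0 - k0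
  -- If `Au` were nonzero, κ1 and κ2 would leave only the y-component of `w`; then κ4 gives `Av` =
  -- 0, and κ3 gives a contradiction with s ≠ 0.
  have hAu0 : Au = 0 := by
    by_contra hne
    have h1 : w.1 = 0 := by simpa [hne] using k1
    have h2 : w.2.1 = 0 := by simpa [hne] using k2
    have h3 : w.2.2 ≠ 0 := fun h3 => hw0 ⟨h1, h2, h3⟩
    have h4 : Av = 0 := by simpa [h3] using k4
    rw [h4] at k3
    simp [hne, hs, h3] at k3
  have hAv0 : Av ≠ 0 := fun h => hA0 ⟨hAu0, h⟩
  have hw3 : w.2.2 = 0 := by simpa [hAv0] using k4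
  -- The parameter κ5 also moves `Q`, so it is informative only now that `Au` = 0 removes `Q`.
  have k5 := hK 0 0 0 0 1
  rw [hAu0] at k5 k0
  have hw1 : w.1 = 0 := by
    have : Av * w.1 ^ 2 = 0 := by linear_combination k5 - k0
    simpa [hAv0] using this
  -- The new X direction is thus a multiple of the total x-derivative, so the total x-derivatives of
  -- T and Y vanish.
  have hwt : tangent p q s r s e w = w.2.1 • ((0, 1, 0, q, s) : BLPSpace) := by
    rw [tangent_decomp, hw1, hw3]; simp
  have hw2 : w.2.1 ≠ 0 := fun h => hw0 ⟨hw1, h, hw3⟩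
  have hlw := hℓ w
  rw [hwt, map_smul] at hw hlw
  simp only [Prod.smul_fst, Prod.smul_snd, smul_eq_mul] at hlw
  have g1 : w.2.1 * (M (0, 1, 0, q, s)).1 = 0 := congrArg Prod.fst hw
  have g3 : w.2.1 * (M (0, 1, 0, q, s)).2.2.1 = 0 := congrArg (fun y : BLPBase => y.2.2) hw
  refine ⟨by simpa [hw2] using g1, by simpa [hw2] using g3, ℓt, ℓx, ℓy, ?_, ?_⟩
  · apply mul_left_cancel₀ hw2
    linear_combination hlw - ℓt * g1 - ℓy * g3
  · linarith [hAu0]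

end BLP

/-! ### Independence of T and Y from x, u, v, and of X and V from u. -/

namespace BLP
open Filter Topology

/-- Genericity device: one entry of a jet can be moved by a nonzero amount without losing
transversality or the condition s ≠ 0. -/
theorem exists_ne_zero_of_continuous {f : ℝ → ℝ} (hf : Continuous f) (h0 : f 0 ≠ 0) (c : ℝ) :
    ∃ ε, ε ≠ 0 ∧ f ε ≠ 0 ∧ c + ε ≠ 0 := by
  have h1 : ∀ᶠ ε in 𝓝[≠] (0 : ℝ), f ε ≠ 0 :=
    (hf.continuousAt.eventually_ne h0).filter_mono nhdsWithin_le_nhds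
  have h2 : ∀ᶠ ε in 𝓝[≠] (0 : ℝ), ε ≠ 0 := eventually_mem_nhdsWithin
  have h3 : ∀ᶠ ε in 𝓝[≠] (0 : ℝ), c + ε ≠ 0 := by
    by_cases hc : c = 0
    · filter_upwards [h2] with ε hε
      simpa [hc] using hε
    · have : ContinuousAt (fun ε : ℝ => c + ε) 0 := by fun_prop
      exact (this.eventually_ne (by simpa using hc)).filter_mono nhdsWithin_le_nhds
  obtain ⟨ε, a, b, d⟩ := (h2.and (h1.and h3)).exists
  exact ⟨ε, a, b, d⟩

/-- The first restrictions on the derivative of a point symmetry. -/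
structure CharacteristicStructure (M : BLPSpace →L[ℝ] BLPSpace) : Prop where
  Tx : (M (0, 1, 0, 0, 0)).1 = 0
  Tu : (M (0, 0, 0, 1, 0)).1 = 0
  Tv : (M (0, 0, 0, 0, 1)).1 = 0
  Xu : (M (0, 0, 0, 1, 0)).2.1 = 0
  Yx : (M (0, 1, 0, 0, 0)).2.2.1 = 0
  Yu : (M (0, 0, 0, 1, 0)).2.2.1 = 0
  Yv : (M (0, 0, 0, 0, 1)).2.2.1 = 0
  Vu : (M (0, 0, 0, 1, 0)).2.2.2.2 = 0

theorem map_ex (M : BLPSpace →L[ℝ] BLPSpace) (q s : ℝ) : M (0, 1, 0, q, s) =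
    M (0, 1, 0, 0, 0) + q • M (0, 0, 0, 1, 0) + s • M (0, 0, 0, 0, 1) := by
  rw [map_space M (0, 1, 0, q, s)]; simp

/-- Only the t and y directions contribute to T and Y, so surjectivity of `M` forces this 2 × 2
block to be invertible. -/
theorem base_det_ne_zero {M N : BLPSpace →L[ℝ] BLPSpace} (hN : ∀ z, M (N z) = z)
    (Tx : (M (0, 1, 0, 0, 0)).1 = 0) (Tu : (M (0, 0, 0, 1, 0)).1 = 0)
    (Tv : (M (0, 0, 0, 0, 1)).1 = 0) (Yx : (M (0, 1, 0, 0, 0)).2.2.1 = 0)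
    (Yu : (M (0, 0, 0, 1, 0)).2.2.1 = 0) (Yv : (M (0, 0, 0, 0, 1)).2.2.1 = 0) :
    (M (1, 0, 0, 0, 0)).1 * (M (0, 0, 1, 0, 0)).2.2.1 -
      (M (0, 0, 1, 0, 0)).1 * (M (1, 0, 0, 0, 0)).2.2.1 ≠ 0 := by
  have hT : ∀ z, z.1 * (M (1, 0, 0, 0, 0)).1 + z.2.2.1 * (M (0, 0, 1, 0, 0)).1 = (M z).1 := by
    intro z; rw [map_space M z]; simp [Tx, Tu, Tv]
  have hY : ∀ z, z.1 * (M (1, 0, 0, 0, 0)).2.2.1 + z.2.2.1 * (M (0, 0, 1, 0, 0)).2.2.1 =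
      (M z).2.2.1 := by
    intro z; rw [map_space M z]; simp [Yx, Yu, Yv]
  have a1 := hT (N (1, 0, 0, 0, 0))
  have a2 := hY (N (1, 0, 0, 0, 0))
  have a3 := hT (N (0, 0, 1, 0, 0))
  have a4 := hY (N (0, 0, 1, 0, 0))
  rw [hN] at a1 a2 a3 a4
  simp only at a1 a2 a3 a4
  intro h
  have e := congrArg₂ (· - ·) (congrArg₂ (· * ·) a1 a4) (congrArg₂ (· * ·) a2 a3)
  have : (1 : ℝ) = 0 := by
    linear_combination -e + ((N (1, 0, 0, 0, 0)).1 * (N (0, 0, 1, 0, 0)).2.2.1 -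
      (N (1, 0, 0, 0, 0)).2.2.1 * (N (0, 0, 1, 0, 0)).1) * h
  exact one_ne_zero this

/-- The vectors mapped by `M` to the `X` and `V` directions have no `t` and `y` components. -/
theorem fiber_preimages {M N : BLPSpace →L[ℝ] BLPSpace} (hN : ∀ z, M (N z) = z)
    (Tx : (M (0, 1, 0, 0, 0)).1 = 0) (Tu : (M (0, 0, 0, 1, 0)).1 = 0)
    (Tv : (M (0, 0, 0, 0, 1)).1 = 0) (Yx : (M (0, 1, 0, 0, 0)).2.2.1 = 0)
    (Yu : (M (0, 0, 0, 1, 0)).2.2.1 = 0) (Yv : (M (0, 0, 0, 0, 1)).2.2.1 = 0) :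
    ∃ n m : BLPSpace, n.1 = 0 ∧ n.2.2.1 = 0 ∧ m.1 = 0 ∧ m.2.2.1 = 0 ∧
      M n = (0, 1, 0, 0, 0) ∧ M m = (0, 0, 0, 0, 1) := by
  have hdet := base_det_ne_zero hN Tx Tu Tv Yx Yu Yv
  have key : ∀ z : BLPSpace, (M z).1 = 0 → (M z).2.2.1 = 0 → z.1 = 0 ∧ z.2.2.1 = 0 := by
    intro z h1 h2
    rw [map_space M z] at h1 h2
    simp [Tx, Tu, Tv, Yx, Yu, Yv] at h1 h2
    constructor <;> apply (mul_eq_zero.1 _).resolve_left hdet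
    · linear_combination (M (0, 0, 1, 0, 0)).2.2.1 * h1 - (M (0, 0, 1, 0, 0)).1 * h2
    · linear_combination -(M (1, 0, 0, 0, 0)).2.2.1 * h1 + (M (1, 0, 0, 0, 0)).1 * h2
  obtain ⟨a, b⟩ := key (N (0, 1, 0, 0, 0)) (by rw [hN]) (by rw [hN])
  obtain ⟨c, d⟩ := key (N (0, 0, 0, 0, 1)) (by rw [hN]) (by rw [hN])
  exact ⟨_, _, a, b, c, d, hN _, hN _⟩

/-- The relations T_x + qT_u + sT_v = 0 and their analogues for Y hold at a transversal jet and at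
its perturbations in q and in s, so every coefficient vanishes separately. Eliminating ℓx from the
remaining two relations leaves a statement about the parallelism of columns that contradicts
invertibility unless X_u = V_u = 0. -/
theorem IsPointSymmetry.characteristicStructure {Φ : OpenPartialHomeomorph BLPSpace BLPSpace}
    (hΦ : IsPointSymmetry Φ) {P : BLPSpace} (hP : P ∈ Φ.source) :
    CharacteristicStructure (fderiv ℝ Φ P) := by
  obtain ⟨N, -, hN⟩ := exists_inverse_fderiv hΦ.1 hΦ.2.1 hP
  have hrel := fun p q s r e => hΦ.jet_relations hP rfl (p := p) (q := q) (s := s) (r := r) (e := e)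
  generalize hM : fderiv ℝ Φ P = M at hN hrel
  obtain ⟨p, q, s, r, e, hj⟩ : ∃ p q s r e : ℝ, jac M p q s r e ≠ 0 := by
    obtain ⟨p, q, s, r, e, h⟩ := exists_det3_ne_zero (baseProj (M (1, 0, 0, 0, 0)))
      (baseProj (M (0, 1, 0, 0, 0))) (baseProj (M (0, 0, 1, 0, 0)))
      (baseProj (M (0, 0, 0, 1, 0))) (baseProj (M (0, 0, 0, 0, 1))) (by
        intro η
        set z := N (η.1, η.2.1, η.2.2, 0, 0) with hz
        refine ⟨z.1, z.2.1, z.2.2.1, z.2.2.2.1, z.2.2.2.2, ?_⟩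
        simp only [← map_smul, ← map_add]
        rw [← space_decomp z, hz, hN]
        rfl)
    exact ⟨p, q, s, r, e, by rw [jac_eq]; exact h⟩
  have hcq : ∀ p q s r e, Continuous fun ε => jac M p (q + ε) s r e := by
    intro p q s r e; unfold jac det3; fun_prop
  have hcs : ∀ p q s r e, Continuous fun ε => jac M p q (s + ε) r e := by
    intro p q s r e; unfold jac det3; fun_prop
  obtain ⟨ε0, -, hε0, hs⟩ := exists_ne_zero_of_continuous (hcs p q s r e) (by simpa using hj) s
  obtain ⟨s', hs'⟩ : ∃ s', s' = s + ε0 := ⟨_, rfl⟩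
  simp only [← hs'] at hε0 hs
  obtain ⟨ε, hεn, hεj, -⟩ := exists_ne_zero_of_continuous (hcq p q s' r e) (by simpa using hε0) 0
  obtain ⟨δ, hδn, hδj, hδs⟩ := exists_ne_zero_of_continuous (hcs p q s' r e) (by simpa using hε0) s'
  obtain ⟨T0, Y0, ℓt, ℓx, ℓy, hℓ, hVu⟩ := hrel p q s' r e hs hε0
  obtain ⟨T1, Y1, -⟩ := hrel p (q + ε) s' r e hs hεj
  obtain ⟨T2, Y2, ℓt', ℓx', ℓy', hℓ', hVu'⟩ := hrel p q (s' + δ) r e hδs hδj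
  rw [map_ex] at T0 Y0 T1 Y1 T2 Y2 hℓ hℓ'
  simp only [Prod.fst_add, Prod.snd_add, Prod.smul_fst, Prod.smul_snd, smul_eq_mul]
    at T0 Y0 T1 Y1 T2 Y2 hℓ hℓ'
  have Tu : (M (0, 0, 0, 1, 0)).1 = 0 := by
    apply (mul_eq_zero.1 _).resolve_left hεn; linear_combination T1 - T0
  have Tv : (M (0, 0, 0, 0, 1)).1 = 0 := by
    apply (mul_eq_zero.1 _).resolve_left hδn; linear_combination T2 - T0
  have Tx : (M (0, 1, 0, 0, 0)).1 = 0 := by linear_combination T0 - q * Tu - s' * Tv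
  have Yu : (M (0, 0, 0, 1, 0)).2.2.1 = 0 := by
    apply (mul_eq_zero.1 _).resolve_left hεn; linear_combination Y1 - Y0
  have Yv : (M (0, 0, 0, 0, 1)).2.2.1 = 0 := by
    apply (mul_eq_zero.1 _).resolve_left hδn; linear_combination Y2 - Y0
  have Yx : (M (0, 1, 0, 0, 0)).2.2.1 = 0 := by linear_combination Y0 - q * Yu - s' * Yv
  rw [Tu, Yu] at hVu hVu'
  -- With ℓx eliminated, V_u(X_x + sX_v) = X_u(V_x + sV_v); the terms with q cancel. The second
  -- value of s splits this identity.
  have c1 : (M (0, 0, 0, 1, 0)).2.2.2.2 *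
      ((M (0, 1, 0, 0, 0)).2.1 + s' * (M (0, 0, 0, 0, 1)).2.1) = (M (0, 0, 0, 1, 0)).2.1 *
      ((M (0, 1, 0, 0, 0)).2.2.2.2 + s' * (M (0, 0, 0, 0, 1)).2.2.2.2) := by
    linear_combination (M (0, 0, 0, 1, 0)).2.1 * hℓ + hVu * ((M (0, 1, 0, 0, 0)).2.1 +
      q * (M (0, 0, 0, 1, 0)).2.1 + s' * (M (0, 0, 0, 0, 1)).2.1)
  have c2 : (M (0, 0, 0, 1, 0)).2.2.2.2 *
      ((M (0, 1, 0, 0, 0)).2.1 + (s' + δ) * (M (0, 0, 0, 0, 1)).2.1) = (M (0, 0, 0, 1, 0)).2.1 *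
      ((M (0, 1, 0, 0, 0)).2.2.2.2 + (s' + δ) * (M (0, 0, 0, 0, 1)).2.2.2.2) := by
    linear_combination (M (0, 0, 0, 1, 0)).2.1 * hℓ' + hVu' * ((M (0, 1, 0, 0, 0)).2.1 +
      q * (M (0, 0, 0, 1, 0)).2.1 + (s' + δ) * (M (0, 0, 0, 0, 1)).2.1)
  have d1 : (M (0, 0, 0, 1, 0)).2.2.2.2 * (M (0, 0, 0, 0, 1)).2.1 =
      (M (0, 0, 0, 1, 0)).2.1 * (M (0, 0, 0, 0, 1)).2.2.2.2 := by
    apply mul_left_cancel₀ hδn; linear_combination c2 - c1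
  have d2 : (M (0, 0, 0, 1, 0)).2.2.2.2 * (M (0, 1, 0, 0, 0)).2.1 =
      (M (0, 0, 0, 1, 0)).2.1 * (M (0, 1, 0, 0, 0)).2.2.2.2 := by
    linear_combination c1 - s' * d1
  -- By `d1` and `d2` the columns (X_x, V_x) and (X_v, V_v) are parallel to (X_u, V_u). The vectors
  -- `n` and `m` show that the three columns span the plane, so the last one has to be zero.
  obtain ⟨n, m, n1, n3, m1, m3, hn, hm⟩ := fiber_preimages hN Tx Tu Tv Yx Yu Yv
  rw [map_space M n, n1, n3] at hn
  rw [map_space M m, m1, m3] at hm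
  have n2 := congrArg (fun y : BLPSpace => y.2.1) hn
  have n5 := congrArg (fun y : BLPSpace => y.2.2.2.2) hn
  have m2 := congrArg (fun y : BLPSpace => y.2.1) hm
  have m5 := congrArg (fun y : BLPSpace => y.2.2.2.2) hm
  simp only [zero_smul, zero_add, add_zero, Prod.fst_add, Prod.snd_add, Prod.smul_fst,
    Prod.smul_snd, smul_eq_mul] at n2 n5 m2 m5
  refine ⟨Tx, Tu, Tv, ?_, Yx, Yu, Yv, ?_⟩
  · linear_combination -(M (0, 0, 0, 1, 0)).2.1 * m5 + (M (0, 0, 0, 1, 0)).2.2.2.2 * m2 -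
      m.2.2.2.2 * d1 - m.2.1 * d2
  · linear_combination -(M (0, 0, 0, 1, 0)).2.2.2.2 * n2 + (M (0, 0, 0, 1, 0)).2.1 * n5 +
      n.2.2.2.2 * d1 + n.2.1 * d2

end BLP

/-! ### The coefficients of v_t and v_y in the second equation. -/

namespace BLP
open Filter Topology

section

variable {E : Type*} [NormedAddCommGroup E] [NormedSpace ℝ E]

theorem clm_fderiv {F G : Type*} [NormedAddCommGroup F] [NormedSpace ℝ F]
    [NormedAddCommGroup G] [NormedSpace ℝ G] (A : F →L[ℝ] G) {f : E → F} {p : E}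
    (hf : DifferentiableAt ℝ f p) (w : E) :
    fderiv ℝ (fun q => A (f q)) p w = A (fderiv ℝ f p w) :=
  congrArg (fun B : E →L[ℝ] G => B w) (A.hasFDerivAt.comp p hf.hasFDerivAt).fderiv

end

/-- The projection to the first coordinate. -/
noncomputable def prT : BLPSpace →L[ℝ] ℝ := ContinuousLinearMap.fst ℝ ℝ _

/-- The projection to the second coordinate. -/
noncomputable def prX : BLPSpace →L[ℝ] ℝ :=
  (ContinuousLinearMap.fst ℝ ℝ _).comp (ContinuousLinearMap.snd ℝ ℝ _)

/-- The projection to the third coordinate. -/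
noncomputable def prY : BLPSpace →L[ℝ] ℝ := (ContinuousLinearMap.fst ℝ ℝ _).comp
  ((ContinuousLinearMap.snd ℝ ℝ _).comp (ContinuousLinearMap.snd ℝ ℝ _))

/-- The projection to the fourth coordinate. -/
noncomputable def prU : BLPSpace →L[ℝ] ℝ := (ContinuousLinearMap.fst ℝ ℝ ℝ).comp
  ((ContinuousLinearMap.snd ℝ ℝ _).comp
    ((ContinuousLinearMap.snd ℝ ℝ _).comp (ContinuousLinearMap.snd ℝ ℝ _)))

/-- The projection to the fifth coordinate. -/
noncomputable def prV : BLPSpace →L[ℝ] ℝ := (ContinuousLinearMap.snd ℝ ℝ ℝ).comp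
  ((ContinuousLinearMap.snd ℝ ℝ _).comp
    ((ContinuousLinearMap.snd ℝ ℝ _).comp (ContinuousLinearMap.snd ℝ ℝ _)))

theorem prT_apply (z : BLPSpace) : prT z = z.1 := rfl
theorem prX_apply (z : BLPSpace) : prX z = z.2.1 := rfl
theorem prY_apply (z : BLPSpace) : prY z = z.2.2.1 := rfl
theorem prU_apply (z : BLPSpace) : prU z = z.2.2.2.1 := rfl
theorem prV_apply (z : BLPSpace) : prV z = z.2.2.2.2 := rfl

variable {Φ : OpenPartialHomeomorph BLPSpace BLPSpace}

theorem IsPointSymmetry.contDiffAt (hΦ : IsPointSymmetry Φ) {P : BLPSpace} (hP : P ∈ Φ.source) :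
    ContDiffAt ℝ ∞ Φ P := hΦ.1.contDiffAt (Φ.open_source.mem_nhds hP)

theorem fderiv_eq_zero_of_eqOn {g : BLPSpace → ℝ} {S : Set BLPSpace} (hS : IsOpen S)
    (h : ∀ Q ∈ S, g Q = 0) {P : BLPSpace} (hP : P ∈ S) (w : BLPSpace) : fderiv ℝ g P w = 0 := by
  have : g =ᶠ[𝓝 P] fun _ => 0 := by
    filter_upwards [hS.mem_nhds hP] with Q hQ using h Q hQ
  rw [this.fderiv_eq]
  simp

/-- A component of the second derivative vanishes when this component of the first derivative
vanishes identically. -/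
theorem IsPointSymmetry.fderiv_fderiv_zero (hΦ : IsPointSymmetry Φ) {P : BLPSpace}
    (hP : P ∈ Φ.source) (A : BLPSpace →L[ℝ] ℝ) (a b : BLPSpace)
    (h : ∀ Q ∈ Φ.source, A (fderiv ℝ Φ Q a) = 0) :
    A (fderiv ℝ (fun Q => fderiv ℝ Φ Q a) P b) = 0 := by
  rw [← clm_fderiv A ((contDiffAt_fderiv_apply (hΦ.contDiffAt hP) a).differentiableAt (by simp))]
  exact fderiv_eq_zero_of_eqOn Φ.open_source h hP b

/-- The second equation for the image of a solution with a given jet of the form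
`(u_t, u_x, u_y, v_t, v_x, v_y) = (0, 0, s, r, s, e)`. -/
theorem IsPointSymmetry.second_equation_jet (hΦ : IsPointSymmetry Φ) {P : BLPSpace}
    (hP : P ∈ Φ.source) {M : BLPSpace →L[ℝ] BLPSpace} (hM : fderiv ℝ Φ P = M) {s lam : ℝ}
    (hs : s ≠ 0) (hlam : lam * ((M (0, 1, 0, 0, 0)).2.1 + s * (M (0, 0, 0, 0, 1)).2.1) = 1)
    {H : BLPSpace} (hH : H = fderiv ℝ (fun R => fderiv ℝ Φ R (0, 1, 0, 0, s)) P (0, 1, 0, 0, s))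
    {ℓx k Δ : ℝ}
    (hℓx : ℓx = lam * ((M (0, 1, 0, 0, 0)).2.2.2.2 + s * (M (0, 0, 0, 0, 1)).2.2.2.2))
    (hk : k = (M (0, 0, 0, 0, 1)).2.2.2.2 - ℓx * (M (0, 0, 0, 0, 1)).2.1)
    (hΔ : Δ = (M (1, 0, 0, 0, 0)).1 * (M (0, 0, 1, 0, 0)).2.2.1 -
      (M (0, 0, 1, 0, 0)).1 * (M (1, 0, 0, 0, 0)).2.2.1) (r e : ℝ) :
    (M (0, 0, 1, 0, 0)).2.2.1 *
        ((M (1, 0, 0, 0, 0)).2.2.2.2 - ℓx * (M (1, 0, 0, 0, 0)).2.1 + r * k) -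
      (M (1, 0, 0, 0, 0)).2.2.1 *
        ((M (0, 0, 1, 0, 0)).2.2.2.2 - ℓx * (M (0, 0, 1, 0, 0)).2.1 + e * k) =
    Δ * (lam ^ 2 * (H.2.2.2.2 - ℓx * H.2.1) + (r - 2 * P.2.2.2.1 * s) * lam ^ 2 * k +
      2 * (Φ P).2.2.2.1 * ℓx) := by
  obtain ⟨Tx, Tu, Tv, Xu, Yx, Yu, Yv, Vu⟩ := hM ▸ hΦ.characteristicStructure hP
  obtain ⟨N, -, hN⟩ := hM ▸ exists_inverse_fderiv hΦ.1 hΦ.2.1 hP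
  have hΔ0 : Δ ≠ 0 := hΔ ▸ base_det_ne_zero hN Tx Tu Tv Yx Yu Yv
  have hDX : (M (0, 1, 0, 0, 0)).2.1 + s * (M (0, 0, 0, 0, 1)).2.1 ≠ 0 := right_ne_zero_of_mul_eq_one hlam
  have hj : jac M 0 0 s r e ≠ 0 := by
    have : jac M 0 0 s r e =
        Δ * ((M (0, 1, 0, 0, 0)).2.1 + s * (M (0, 0, 0, 0, 1)).2.1) := by
      rw [jac_eq]
      simp [det3, Tx, Tu, Tv, Xu, Yx, Yu, Yv, hΔ]
      ring
    rw [this]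
    exact mul_ne_zero hΔ0 hDX
  obtain ⟨hinj, w, ℓt, ℓx', ℓy, hw, hℓ⟩ := transversal_of_jac hj
  have hMt : ∀ ξ, M (tangent 0 0 s r s e ξ) = ξ.1 • (M (1, 0, 0, 0, 0) + r • M (0, 0, 0, 0, 1)) +
      ξ.2.1 • (M (0, 1, 0, 0, 0) + s • M (0, 0, 0, 0, 1)) +
      ξ.2.2 • (M (0, 0, 1, 0, 0) + s • M (0, 0, 0, 1, 0) + e • M (0, 0, 0, 0, 1)) := by
    intro ξ
    rw [tangent_decomp]
    simp only [map_add, map_smul]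
    rw [map_space M (1, 0, 0, 0, r), map_space M (0, 1, 0, 0, s), map_space M (0, 0, 1, s, e)]
    simp
  -- T and Y have vanishing total x-derivatives, so the X direction pulls back to the x direction
  -- divided by X_x + sX_v.
  have hw' : w = (0, lam, 0) := by
    rw [← sub_eq_zero]
    apply hinj
    rw [← tangentL_apply, map_sub, map_sub, map_sub, tangentL_apply, tangentL_apply, hw, hMt]
    simp [Tx, Tv, Yx, Yv]
    linear_combination -hlam
  have ht := hℓ (1, 0, 0)
  have hx := hℓ (0, 1, 0)
  have hy := hℓ (0, 0, 1)
  rw [hMt] at ht hx hy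
  simp [Tx, Tu, Tv, Xu, Yx, Yu, Yv, Vu] at ht hx hy
  have hℓℓ : ℓx' = ℓx := by
    rw [hℓx]
    linear_combination -ℓx' * hlam + lam * hx
  subst hℓℓ
  obtain ⟨t0, x0, y0, u0, v0⟩ := P
  obtain ⟨Q, hQ⟩ := exists_solution_jet t0 x0 y0 u0 v0 0 0 s r e hs
  obtain ⟨Ω, u, v, hΩ, hp, hu, hv, hsol, hl, hL, huw, hvw, -⟩ := hQ 0 0 0 0 0
  have h := hΦ.second_equation hΩ hp hu hv hsol hl hP hL
      (by rw [hM]; exact hinj) (by rw [hM]; exact hw) (by rw [hM]; exact hℓ) rfl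
  have hLw : tangent 0 0 s r s e w = lam • ((0, 1, 0, 0, s) : BLPSpace) := by
    rw [hw']; simp [tangent, mul_comm]
  have hH1 : H.1 = 0 := by
    rw [hH]
    refine hΦ.fderiv_fderiv_zero hP prT _ _ fun R hR => ?_
    have := hΦ.characteristicStructure hR
    rw [map_ex]; simp [prT_apply, this.Tx, this.Tv]
  have hH3 : H.2.2.1 = 0 := by
    rw [hH]
    refine hΦ.fderiv_fderiv_zero hP prY _ _ fun R hR => ?_
    have := hΦ.characteristicStructure hR
    rw [map_ex]; simp [prY_apply, this.Yx, this.Yv]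
  have hHH : fderiv ℝ (fun R => fderiv ℝ Φ R (lam • ((0, 1, 0, 0, s) : BLPSpace)))
      (t0, x0, y0, u0, v0) (lam • ((0, 1, 0, 0, s) : BLPSpace)) = lam ^ 2 • H := by
    simp only [map_smul]
    rw [fderiv_fun_const_smul
      ((contDiffAt_fderiv_apply (hΦ.contDiffAt hP) _).differentiableAt (by simp)), hH]
    simp [smul_smul, pow_two]
  rw [hLw, hHH, hM, huw, hvw, map_space M (0, 0, 0, _, _), hw'] at h
  simp [hH1, hH3, Tu, Tv, Xu, Yu, Yv, Vu] at h
  rw [hk]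
  subst hΔ
  -- The combination Y_y·`ht` - Y_t·`hy` eliminates ℓy and leaves Δℓt, as in Cramer's rule; the
  -- transformed equation times Δ then removes ℓt.
  linear_combination ((M (1, 0, 0, 0, 0)).1 * (M (0, 0, 1, 0, 0)).2.2.1 -
      (M (0, 0, 1, 0, 0)).1 * (M (1, 0, 0, 0, 0)).2.2.1) * h - (M (0, 0, 1, 0, 0)).2.2.1 * ht +
      (M (1, 0, 0, 0, 0)).2.2.1 * hy

/-- The restrictions on the derivative of a point symmetry that follow from the terms with second
derivatives and `v_y` in the second equation. -/
structure SymbolStructure (M : BLPSpace →L[ℝ] BLPSpace) : Prop extends CharacteristicStructure M where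
  Xv : (M (0, 0, 0, 0, 1)).2.1 = 0
  Yt : (M (1, 0, 0, 0, 0)).2.2.1 = 0
  Tt : (M (1, 0, 0, 0, 0)).1 = (M (0, 1, 0, 0, 0)).2.1 ^ 2
  Xx_ne : (M (0, 1, 0, 0, 0)).2.1 ≠ 0
  Yy_ne : (M (0, 0, 1, 0, 0)).2.2.1 ≠ 0
  Vv_ne : (M (0, 0, 0, 0, 1)).2.2.2.2 ≠ 0

/-- The identity of `second_equation_jet` is affine in r = v_t and e = v_y, which are arbitrary. The
coefficient of e gives Y_t = 0, that of r gives T_t = (X_x + sX_v)², and since T_t does not know s,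
also X_v = 0. -/
theorem IsPointSymmetry.symbolStructure (hΦ : IsPointSymmetry Φ) {P : BLPSpace}
    (hP : P ∈ Φ.source) : SymbolStructure (fderiv ℝ Φ P) := by
  have hfirst := hΦ.characteristicStructure hP
  obtain ⟨N, -, hN⟩ := exists_inverse_fderiv hΦ.1 hΦ.2.1 hP
  have heq := fun s lam hs hlam => hΦ.second_equation_jet hP rfl (s := s) (lam := lam) hs hlam
    rfl rfl rfl rfl
  generalize hM : fderiv ℝ Φ P = M at hfirst hN heq
  obtain ⟨Tx, Tu, Tv, Xu, Yx, Yu, Yv, Vu⟩ := id hfirst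
  have hΔ0 := base_det_ne_zero hN Tx Tu Tv Yx Yu Yv
  obtain ⟨n, m, n1, n3, m1, m3, hn, hm⟩ := fiber_preimages hN Tx Tu Tv Yx Yu Yv
  rw [map_space M n, n1, n3] at hn
  rw [map_space M m, m1, m3] at hm
  have n2 := congrArg (fun y : BLPSpace => y.2.1) hn
  have n5 := congrArg (fun y : BLPSpace => y.2.2.2.2) hn
  have m2 := congrArg (fun y : BLPSpace => y.2.1) hm
  have m5 := congrArg (fun y : BLPSpace => y.2.2.2.2) hm
  simp [Xu, Vu] at n2 n5 m2 m5
  have hJ : (M (0, 0, 0, 0, 1)).2.2.2.2 * (M (0, 1, 0, 0, 0)).2.1 -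
      (M (0, 0, 0, 0, 1)).2.1 * (M (0, 1, 0, 0, 0)).2.2.2.2 ≠ 0 := by
    intro h
    have e := congrArg₂ (· - ·) (congrArg₂ (· * ·) n2 m5) (congrArg₂ (· * ·) n5 m2)
    have : (1 : ℝ) = 0 := by
      linear_combination -e + (n.2.1 * m.2.2.2.2 - n.2.2.2.2 * m.2.1) * h
    exact one_ne_zero this
  have hkey : ∀ s : ℝ, s ≠ 0 → (M (0, 1, 0, 0, 0)).2.1 + s * (M (0, 0, 0, 0, 1)).2.1 ≠ 0 →
      (M (1, 0, 0, 0, 0)).2.2.1 = 0 ∧ (M (1, 0, 0, 0, 0)).1 =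
        ((M (0, 1, 0, 0, 0)).2.1 + s * (M (0, 0, 0, 0, 1)).2.1) ^ 2 := by
    intro s hs hD
    have h := heq s _ hs (inv_mul_cancel₀ hD)
    generalize hlam : ((M (0, 1, 0, 0, 0)).2.1 + s * (M (0, 0, 0, 0, 1)).2.1)⁻¹ = lam at h
    have hl1 : lam * ((M (0, 1, 0, 0, 0)).2.1 + s * (M (0, 0, 0, 0, 1)).2.1) = 1 := by
      rw [← hlam]; exact inv_mul_cancel₀ hD
    generalize hℓ : lam * ((M (0, 1, 0, 0, 0)).2.2.2.2 + s * (M (0, 0, 0, 0, 1)).2.2.2.2) = ℓx at h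
    generalize hk : (M (0, 0, 0, 0, 1)).2.2.2.2 - ℓx * (M (0, 0, 0, 0, 1)).2.1 = k at h
    have hk0 : k ≠ 0 := by
      intro h0
      apply hJ
      rw [h0, ← hℓ] at hk
      linear_combination ((M (0, 1, 0, 0, 0)).2.1 + s * (M (0, 0, 0, 0, 1)).2.1) * hk +
        (M (0, 0, 0, 0, 1)).2.1 *
        ((M (0, 1, 0, 0, 0)).2.2.2.2 + s * (M (0, 0, 0, 0, 1)).2.2.2.2) * hl1
    have h00 := h 0 0
    have h10 := h 1 0
    have h01 := h 0 1
    have Yt : (M (1, 0, 0, 0, 0)).2.2.1 = 0 := by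
      apply (mul_eq_zero.1 _).resolve_left hk0
      linear_combination h00 - h01
    refine ⟨Yt, ?_⟩
    rw [Yt] at h00 h10 hΔ0
    have hYy : (M (0, 0, 1, 0, 0)).2.2.1 ≠ 0 := by
      intro h; apply hΔ0; rw [h]; ring
    apply mul_left_cancel₀ (mul_ne_zero hk0 hYy)
    linear_combination -(h10 - h00) *
      ((M (0, 1, 0, 0, 0)).2.1 + s * (M (0, 0, 0, 0, 1)).2.1) ^ 2 -
      k * (M (1, 0, 0, 0, 0)).1 * (M (0, 0, 1, 0, 0)).2.2.1 *
      (lam * ((M (0, 1, 0, 0, 0)).2.1 + s * (M (0, 0, 0, 0, 1)).2.1) + 1) * hl1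
  have Xv : (M (0, 0, 0, 0, 1)).2.1 = 0 := by
    by_contra hX
    -- If X_v ≠ 0, then X_x + sX_v takes each nonzero value other than X_x, the one at the forbidden
    -- s = 0. At most one of 1, 2, 3 is lost, and T_t would equal two different squares.
    have hc : ∀ c : ℝ, c ≠ 0 → c ≠ (M (0, 1, 0, 0, 0)).2.1 → (M (1, 0, 0, 0, 0)).1 = c ^ 2 := by
      intro c hc hne
      have e : (M (0, 1, 0, 0, 0)).2.1 +
          (c - (M (0, 1, 0, 0, 0)).2.1) / (M (0, 0, 0, 0, 1)).2.1 * (M (0, 0, 0, 0, 1)).2.1 = c := by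
        field_simp; ring
      have := (hkey ((c - (M (0, 1, 0, 0, 0)).2.1) / (M (0, 0, 0, 0, 1)).2.1)
        (div_ne_zero (sub_ne_zero.2 hne) hX) (by rw [e]; exact hc)).2
      rw [this, e]
    have g1 := hc 1 one_ne_zero
    have g2 := hc 2 two_ne_zero
    have g3 := hc 3 three_ne_zero
    by_cases h1 : (1 : ℝ) = (M (0, 1, 0, 0, 0)).2.1
    · have a := g2 (by rw [← h1]; norm_num)
      have b := g3 (by rw [← h1]; norm_num)
      rw [a] at b; norm_num at b
    · have a := g1 h1
      by_cases h2 : (2 : ℝ) = (M (0, 1, 0, 0, 0)).2.1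
      · have b := g3 (by rw [← h2]; norm_num)
        rw [a] at b; norm_num at b
      · have b := g2 h2
        rw [a] at b; norm_num at b
  have hXx : (M (0, 1, 0, 0, 0)).2.1 ≠ 0 := by
    intro h; apply hJ; rw [h, Xv]; ring
  obtain ⟨Yt, Tt⟩ := hkey 1 one_ne_zero (by rw [Xv]; simpa using hXx)
  refine ⟨hfirst, Xv, Yt, by rw [Tt, Xv]; ring, hXx, ?_, ?_⟩
  · intro h; apply hΔ0; rw [h, Yt]; ring
  · intro h; apply hJ; rw [h, Xv]; ring

end BLP

/-! ### The remaining terms of the second equation and the formula for U. -/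

namespace BLP
open Filter Topology

variable {Φ : OpenPartialHomeomorph BLPSpace BLPSpace}

theorem fderiv_fderiv_eq_zero_of_indep {g : BLPSpace → ℝ} {S : Set BLPSpace} (hS : IsOpen S)
    (hg : ∀ Q ∈ S, ContDiffAt ℝ ∞ g Q) {b : BLPSpace} (h : ∀ Q ∈ S, fderiv ℝ g Q b = 0)
    (a : BLPSpace) : ∀ Q ∈ S, fderiv ℝ (fun R => fderiv ℝ g R a) Q b = 0 := by
  intro Q hQ
  rw [fderiv_apply_comm (hg Q hQ)]
  exact fderiv_eq_zero_of_eqOn hS h hQ a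

/-- The relations between the first and second derivatives of the components of a point symmetry
that follow from the remaining terms of the second equation. -/
theorem IsPointSymmetry.lower_order_relations (hΦ : IsPointSymmetry Φ) {P : BLPSpace}
    (hP : P ∈ Φ.source) {M : BLPSpace →L[ℝ] BLPSpace} (hM : fderiv ℝ Φ P = M) {Vxx Vxv S : ℝ}
    (hVxx : Vxx = (fderiv ℝ (fun R => fderiv ℝ Φ R (0, 1, 0, 0, 0)) P (0, 1, 0, 0, 0)).2.2.2.2)
    (hVxv : Vxv = (fderiv ℝ (fun R => fderiv ℝ Φ R (0, 1, 0, 0, 0)) P (0, 0, 0, 0, 1)).2.2.2.2)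
    (hS : S = (M (1, 0, 0, 0, 0)).2.1 + 2 * (M (0, 1, 0, 0, 0)).2.1 ^ 2 * (Φ P).2.2.2.1) :
    (M (0, 1, 0, 0, 0)).2.1 * ((M (1, 0, 0, 0, 0)).2.2.2.2 - Vxx) =
      S * (M (0, 1, 0, 0, 0)).2.2.2.2 ∧
    S * (M (0, 0, 0, 0, 1)).2.2.2.2 = 2 * (M (0, 1, 0, 0, 0)).2.1 *
      (P.2.2.2.1 * (M (0, 0, 0, 0, 1)).2.2.2.2 - Vxv) ∧
    (fderiv ℝ (fun R => fderiv ℝ Φ R (0, 0, 0, 0, 1)) P (0, 0, 0, 0, 1)).2.2.2.2 = 0 := by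
  have hsec := fun R hR => hΦ.symbolStructure (P := R) hR
  have hd := fun a => (contDiffAt_fderiv_apply (hΦ.contDiffAt hP) a).differentiableAt (by simp)
  set Vvv := (fderiv ℝ (fun R => fderiv ℝ Φ R (0, 0, 0, 0, 1)) P (0, 0, 0, 0, 1)).2.2.2.2 with hVvv
  have hsum : ∀ s : ℝ, (fun R => fderiv ℝ Φ R (0, 1, 0, 0, s)) =
      fun R => fderiv ℝ Φ R (0, 1, 0, 0, 0) + s • fderiv ℝ Φ R (0, 0, 0, 0, 1) := by
    intro s; funext R; rw [map_ex]; simp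
  have hH5 : ∀ s : ℝ, (fderiv ℝ (fun R => fderiv ℝ Φ R (0, 1, 0, 0, s)) P
      (0, 1, 0, 0, s)).2.2.2.2 = Vxx + 2 * s * Vxv + s ^ 2 * Vvv := by
    intro s
    have e : ((0, 1, 0, 0, s) : BLPSpace) = (0, 1, 0, 0, 0) + s • (0, 0, 0, 0, 1) := by simp
    rw [hsum, fderiv_fun_add (hd _) ((hd _).fun_const_smul s), fderiv_fun_const_smul (hd _), e]
    simp only [map_add, map_smul, add_apply, smul_apply]
    rw [fderiv_apply_comm (hΦ.contDiffAt hP) (0, 0, 0, 0, 1) (0, 1, 0, 0, 0)]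
    simp only [Prod.snd_add, Prod.smul_snd, smul_eq_mul]
    rw [hVxx, hVxv, hVvv]
    ring
  -- T_t = X_x² does not change along the direction (0,1,0,0,s), because T_x = T_v = 0; as X_x ≠ 0,
  -- neither does X_x.
  have hH2 : ∀ s : ℝ, (fderiv ℝ (fun R => fderiv ℝ Φ R (0, 1, 0, 0, s)) P
      (0, 1, 0, 0, s)).2.1 = 0 := by
    intro s
    have h1 : prT (fderiv ℝ (fun R => fderiv ℝ Φ R (1, 0, 0, 0, 0)) P (0, 1, 0, 0, s)) = 0 := by
      rw [fderiv_apply_comm (hΦ.contDiffAt hP)]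
      refine hΦ.fderiv_fderiv_zero hP prT _ _ fun R hR => ?_
      rw [map_ex]; simp [prT_apply, (hsec R hR).Tx, (hsec R hR).Tv]
    rw [← clm_fderiv prT (hd _)] at h1
    have hdX : DifferentiableAt ℝ (fun R => prX (fderiv ℝ Φ R (0, 1, 0, 0, s))) P :=
      prX.differentiableAt.comp P (hd _)
    have hev : (fun R => prT (fderiv ℝ Φ R (1, 0, 0, 0, 0))) =ᶠ[𝓝 P]
        fun R => prX (fderiv ℝ Φ R (0, 1, 0, 0, s)) * prX (fderiv ℝ Φ R (0, 1, 0, 0, s)) := by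
      filter_upwards [Φ.open_source.mem_nhds hP] with R hR
      rw [map_ex]
      simp [prT_apply, prX_apply, (hsec R hR).Tt, (hsec R hR).Xv, pow_two]
    rw [hev.fderiv_eq, fderiv_mul_apply hdX hdX, clm_fderiv prX (hd _)] at h1
    have hne : prX (fderiv ℝ Φ P (0, 1, 0, 0, s)) ≠ 0 := by
      rw [map_ex]
      simp [prX_apply, (hsec P hP).Xv, (hsec P hP).Xx_ne]
    have h2 : prX (fderiv ℝ Φ P (0, 1, 0, 0, s)) *
        prX (fderiv ℝ (fun R => fderiv ℝ Φ R (0, 1, 0, 0, s)) P (0, 1, 0, 0, s)) = 0 := by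
      linarith
    exact (mul_eq_zero.1 h2).resolve_left hne
  have hsP := hM ▸ hsec P hP
  obtain ⟨X, hX⟩ : ∃ X, X = (M (0, 1, 0, 0, 0)).2.1 := ⟨_, rfl⟩
  have hX0 : X ≠ 0 := hX ▸ hsP.Xx_ne
  have heq : ∀ s : ℝ, s ≠ 0 → X * (M (1, 0, 0, 0, 0)).2.2.2.2 -
      ((M (0, 1, 0, 0, 0)).2.2.2.2 + s * (M (0, 0, 0, 0, 1)).2.2.2.2) * (M (1, 0, 0, 0, 0)).2.1 =
      X * (Vxx + 2 * s * Vxv + s ^ 2 * Vvv) -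
      2 * P.2.2.2.1 * s * (M (0, 0, 0, 0, 1)).2.2.2.2 * X +
      2 * X ^ 2 * (Φ P).2.2.2.1 *
        ((M (0, 1, 0, 0, 0)).2.2.2.2 + s * (M (0, 0, 0, 0, 1)).2.2.2.2) := by
    intro s hs
    have h := hΦ.second_equation_jet hP hM (s := s) (lam := X⁻¹) hs
      (by rw [hsP.Xv, ← hX]; simpa using inv_mul_cancel₀ hX0) rfl rfl rfl rfl 0 0
    rw [hH2, hH5, hsP.Xv, hsP.Yt, hsP.Tt, ← hX] at h
    apply mul_left_cancel₀ (mul_ne_zero hsP.Yy_ne (pow_ne_zero 2 hX0))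
    field_simp at h
    linear_combination h
  -- A quadratic identity in s is determined by three values, here nonzero ones. The combination
  -- (3·`e1` - `e2`)/2 extrapolates affine functions to s = 2, so its difference from `e3` isolates
  -- the quadratic coefficient.
  have e1 := heq 1 one_ne_zero
  have e2 := heq (-1) (by norm_num)
  have e3 := heq 2 two_ne_zero
  have hvv : X * Vvv = 0 := by linear_combination (-e3 + (3 * e1 - e2) / 2) / 3
  rw [hS, ← hX]
  refine ⟨?_, ?_, (mul_eq_zero.1 hvv).resolve_left hX0⟩
  · linear_combination (e1 + e2) / 2 + hvv
  · linear_combination -(e1 - e2) / 2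

/-- The restrictions on a point symmetry that follow from the second equation of the system. -/
structure JetStructure (M : BLPSpace →L[ℝ] BLPSpace) (P P' : BLPSpace) : Prop
    extends SymbolStructure M where
  Vx : (M (0, 1, 0, 0, 0)).2.2.2.2 = 0
  Vt : (M (1, 0, 0, 0, 0)).2.2.2.2 = 0
  U_eq : P'.2.2.2.1 = P.2.2.2.1 / (M (0, 1, 0, 0, 0)).2.1 -
    (M (1, 0, 0, 0, 0)).2.1 / (2 * (M (0, 1, 0, 0, 0)).2.1 ^ 2)

/-- Eliminating S, which contains the unknown U, from the first two lower-order relations gives (V_t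
- V_xx)V_v = 2(uV_v - V_xv)V_x. Since V does not depend on u, the u-derivative of this identity is 0
= 2V_vV_x. -/
theorem IsPointSymmetry.Vx_eq_zero (hΦ : IsPointSymmetry Φ) {P : BLPSpace}
    (hP : P ∈ Φ.source) : (fderiv ℝ Φ P (0, 1, 0, 0, 0)).2.2.2.2 = 0 := by
  have hsec := fun R hR => hΦ.symbolStructure (P := R) hR
  set V : BLPSpace → ℝ := fun R => prV (Φ R) with hV
  have hVs : ∀ R ∈ Φ.source, ContDiffAt ℝ ∞ V R := fun R hR =>
    prV.contDiff.contDiffAt.comp R (hΦ.contDiffAt hR)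
  have hfV : ∀ R ∈ Φ.source, ∀ a, fderiv ℝ V R a = (fderiv ℝ Φ R a).2.2.2.2 := fun R hR a =>
    clm_fderiv prV ((hΦ.contDiffAt hR).differentiableAt (by simp)) a
  have hffV : ∀ R ∈ Φ.source, ∀ a b, fderiv ℝ (fun Q => fderiv ℝ V Q a) R b =
      (fderiv ℝ (fun Q => fderiv ℝ Φ Q a) R b).2.2.2.2 := by
    intro R hR a b
    have : (fun Q => fderiv ℝ V Q a) =ᶠ[𝓝 R] fun Q => prV (fderiv ℝ Φ Q a) := by
      filter_upwards [Φ.open_source.mem_nhds hR] with Q hQ using hfV Q hQ a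
    rw [this.fderiv_eq, clm_fderiv prV
      ((contDiffAt_fderiv_apply (hΦ.contDiffAt hR) a).differentiableAt (by simp))]
    rfl
  have hVu : ∀ R ∈ Φ.source, fderiv ℝ V R (0, 0, 0, 1, 0) = 0 := fun R hR => by
    rw [hfV R hR, (hsec R hR).Vu]
  have hVa := fun a => fderiv_fderiv_eq_zero_of_indep Φ.open_source hVs hVu a
  have hVas : ∀ a, ∀ R ∈ Φ.source, ContDiffAt ℝ ∞ (fun Q => fderiv ℝ V Q a) R := fun a R hR =>
    contDiffAt_fderiv_apply (hVs R hR) a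
  have hVab := fun a b => fderiv_fderiv_eq_zero_of_indep Φ.open_source (hVas a) (hVa a) b
  have hI : (fun R => (fderiv ℝ V R (1, 0, 0, 0, 0) -
      fderiv ℝ (fun Q => fderiv ℝ V Q (0, 1, 0, 0, 0)) R (0, 1, 0, 0, 0)) *
        fderiv ℝ V R (0, 0, 0, 0, 1)) =ᶠ[𝓝 P]
      fun R => 2 * (prU R * fderiv ℝ V R (0, 0, 0, 0, 1) -
        fderiv ℝ (fun Q => fderiv ℝ V Q (0, 1, 0, 0, 0)) R (0, 0, 0, 0, 1)) *
        fderiv ℝ V R (0, 1, 0, 0, 0) := by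
    filter_upwards [Φ.open_source.mem_nhds hP] with R hR
    obtain ⟨h1, h2, -⟩ := hΦ.lower_order_relations hR rfl rfl rfl rfl
    rw [hffV R hR, hffV R hR, hfV R hR, hfV R hR, hfV R hR, prU_apply]
    apply mul_left_cancel₀ (hsec R hR).Xx_ne
    linear_combination (fderiv ℝ Φ R (0, 0, 0, 0, 1)).2.2.2.2 * h1 +
      (fderiv ℝ Φ R (0, 1, 0, 0, 0)).2.2.2.2 * h2
  have hI' := congrArg (fun A : BLPSpace →L[ℝ] ℝ => A (0, 0, 0, 1, 0)) hI.fderiv_eq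
  have d1 := fun a => (hVas a P hP).differentiableAt (by simp : (∞ : WithTop ℕ∞) ≠ 0)
  have d2 := fun a b => (contDiffAt_fderiv_apply (hVas a P hP) b).differentiableAt
    (by simp : (∞ : WithTop ℕ∞) ≠ 0)
  have dU : DifferentiableAt ℝ (fun R => prU R) P := prU.differentiableAt
  have hUu : fderiv ℝ (fun R => prU R) P (0, 0, 0, 1, 0) = 1 := by
    rw [show (fun R => prU R) = prU from rfl, ContinuousLinearMap.fderiv]; rfl
  have c2 : DifferentiableAt ℝ (fun _ : BLPSpace => (2 : ℝ)) P := differentiableAt_const _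
  have d3 := (dU.fun_mul (d1 (0, 0, 0, 0, 1))).fun_sub (d2 (0, 1, 0, 0, 0) (0, 0, 0, 0, 1))
  rw [fderiv_mul_apply ((d1 _).fun_sub (d2 _ _)) (d1 _), fderiv_sub_apply (d1 _) (d2 _ _),
    fderiv_mul_apply (c2.fun_mul d3) (d1 _), fderiv_mul_apply c2 d3,
    fderiv_sub_apply (dU.fun_mul (d1 _)) (d2 _ _), fderiv_mul_apply dU (d1 _), hUu, hVa _ P hP,
    hVa _ P hP, hVa _ P hP, hVab _ _ P hP, hVab _ _ P hP] at hI'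
  simp [hfV P hP, (hsec P hP).Vv_ne] at hI'
  exact hI'

/-- Once V_x vanishes identically, so do V_xx and V_xv. The first lower-order relation becomes V_t =
0, and the second one becomes X_t + 2X_x²U = 2X_x u. -/
theorem IsPointSymmetry.jetStructure (hΦ : IsPointSymmetry Φ) {P : BLPSpace}
    (hP : P ∈ Φ.source) : JetStructure (fderiv ℝ Φ P) P (Φ P) := by
  have hsec := hΦ.symbolStructure hP
  have hVx := hΦ.Vx_eq_zero hP
  obtain ⟨h1, h2, -⟩ := hΦ.lower_order_relations hP rfl rfl rfl rfl
  have hz : ∀ b, prV (fderiv ℝ (fun R => fderiv ℝ Φ R (0, 1, 0, 0, 0)) P b) = 0 := fun b =>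
    hΦ.fderiv_fderiv_zero hP prV _ b fun R hR => hΦ.Vx_eq_zero hR
  have hVxx := hz (0, 1, 0, 0, 0)
  have hVxv := hz (0, 0, 0, 0, 1)
  rw [prV_apply] at hVxx hVxv
  rw [hVxx, hVx, mul_zero, sub_zero] at h1
  rw [hVxv] at h2
  have hX := hsec.Xx_ne
  refine ⟨hsec, hVx, (mul_eq_zero.1 h1).resolve_left hX, ?_⟩
  field_simp
  apply mul_left_cancel₀ hsec.Vv_ne
  linear_combination h2

end BLP

/-! ### The first equation under a change of the independent variables. -/

namespace BLP
open Filter Topology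

theorem contDiffAt_Dx {f : BLPBase → ℝ} {p : BLPBase} (hf : ContDiffAt ℝ ∞ f p) :
    ContDiffAt ℝ ∞ (Dx f) p := contDiffAt_fderiv_apply hf _

theorem contDiffAt_Dt {f : BLPBase → ℝ} {p : BLPBase} (hf : ContDiffAt ℝ ∞ f p) :
    ContDiffAt ℝ ∞ (Dt f) p := contDiffAt_fderiv_apply hf _

theorem contDiffAt_Dy {f : BLPBase → ℝ} {p : BLPBase} (hf : ContDiffAt ℝ ∞ f p) :
    ContDiffAt ℝ ∞ (Dy f) p := contDiffAt_fderiv_apply hf _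

theorem smooth_differentiableAt {E : Type*} [NormedAddCommGroup E] [NormedSpace ℝ E]
    {F : Type*} [NormedAddCommGroup F] [NormedSpace ℝ F] {f : E → F} {p : E}
    (hf : ContDiffAt ℝ ∞ f p) : DifferentiableAt ℝ f p := hf.differentiableAt (by simp)

theorem fderiv_congr_of_eqOn {f g : BLPBase → ℝ} {S : Set BLPBase} (hS : IsOpen S)
    (h : ∀ q ∈ S, f q = g q) {p : BLPBase} (hp : p ∈ S) : fderiv ℝ f p = fderiv ℝ g p := by
  have : f =ᶠ[𝓝 p] g := by filter_upwards [hS.mem_nhds hp] with q hq using h q hq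
  exact this.fderiv_eq

/-- The differential polynomial whose `y`-derivative appears in the first equation. -/
noncomputable def burgers (u : BLPBase → ℝ) (q : BLPBase) : ℝ :=
  Dt u q - 2 * u q * Dx u q + Dx (Dx u) q

theorem contDiffAt_burgers {u : BLPBase → ℝ} {p : BLPBase} (hu : ContDiffAt ℝ ∞ u p) :
    ContDiffAt ℝ ∞ (burgers u) p :=
  ((contDiffAt_Dt hu).sub ((contDiffAt_const.mul hu).mul (contDiffAt_Dx hu))).add
    (contDiffAt_Dx (contDiffAt_Dx hu))

/-- As (u² - u_x)_x = 2uu_x - u_xx, all the u-terms of the first equation form a single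
y-derivative, whose argument has a simple transformation rule. -/
theorem first_equation_iff {u : BLPBase → ℝ} {p : BLPBase} (hu : ContDiffAt ℝ ∞ u p) (w : ℝ) :
    Dy (Dt u) p = Dy (Dx (fun q => u q ^ 2 - Dx u q)) p + w ↔ Dy (burgers u) p = w := by
  have hev : Dx (fun q => u q ^ 2 - Dx u q) =ᶠ[𝓝 p] fun q => 2 * u q * Dx u q - Dx (Dx u) q := by
    filter_upwards [eventually_differentiableAt hu, eventually_differentiableAt (contDiffAt_Dx hu)]
      with q h1 h2
    simp only [pow_two]
    rw [Dx, fderiv_sub_apply (h1.fun_mul h1) h2, fderiv_mul_apply h1 h1]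
    simp only [Dx]
    ring
  have c1 := smooth_differentiableAt (contDiffAt_Dt hu)
  have c2 := smooth_differentiableAt ((contDiffAt_const (c := (2 : ℝ)).mul hu).mul (contDiffAt_Dx hu))
  have c3 := smooth_differentiableAt (contDiffAt_Dx (contDiffAt_Dx hu))
  have h1 : Dy (Dx (fun q => u q ^ 2 - Dx u q)) p =
      Dy (fun q => 2 * u q * Dx u q) p - Dy (Dx (Dx u)) p := by
    rw [Dy, hev.fderiv_eq, fderiv_sub_apply c2 c3]
    rfl
  have h2 : Dy (burgers u) p =
      Dy (Dt u) p - Dy (fun q => 2 * u q * Dx u q) p + Dy (Dx (Dx u)) p := by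
    show fderiv ℝ (fun q => Dt u q - 2 * u q * Dx u q + Dx (Dx u) q) p _ = _
    rw [fderiv_add_apply (c1.fun_sub c2) c3, fderiv_sub_apply c1 c2]
    rfl
  rw [h1, h2]
  constructor <;> intro h <;> linarith

/-- A change of the independent variables of the form `T = T(t, y)`, `X = X(t, x, y)`, `Y = Y(y)`
with `T_t = X_x²`. -/
structure Change (S S' : Set BLPBase) (τ : BLPBase → BLPBase) : Prop where
  isOpen : IsOpen S
  mapsTo : ∀ q ∈ S, τ q ∈ S'
  smooth : ∀ q ∈ S, ContDiffAt ℝ ∞ τ q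
  Tx : ∀ q ∈ S, Dx (fun q => (τ q).1) q = 0
  Tt : ∀ q ∈ S, Dt (fun q => (τ q).1) q = Dx (fun q => (τ q).2.1) q ^ 2
  Yx : ∀ q ∈ S, Dx (fun q => (τ q).2.2) q = 0
  Yt : ∀ q ∈ S, Dt (fun q => (τ q).2.2) q = 0
  Xx_ne : ∀ q ∈ S, Dx (fun q => (τ q).2.1) q ≠ 0

namespace Change

variable {S S' : Set BLPBase} {τ : BLPBase → BLPBase}

theorem fderiv_comp (h : Change S S' τ) {f : BLPBase → ℝ} (hf : ∀ q ∈ S', ContDiffAt ℝ ∞ f q)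
    {q : BLPBase} (hq : q ∈ S) (w : BLPBase) :
    fderiv ℝ (fun q => f (τ q)) q w = Dt f (τ q) * fderiv ℝ (fun q => (τ q).1) q w +
      Dx f (τ q) * fderiv ℝ (fun q => (τ q).2.1) q w +
      Dy f (τ q) * fderiv ℝ (fun q => (τ q).2.2) q w := by
  have hτ := smooth_differentiableAt (h.smooth q hq)
  rw [fderiv_fun_comp q (smooth_differentiableAt (hf _ (h.mapsTo q hq))) hτ]
  show fderiv ℝ f (τ q) (fderiv ℝ τ q w) = _
  rw [fderiv_apply_eq f]
  have e1 := clm_fderiv (ContinuousLinearMap.fst ℝ ℝ (ℝ × ℝ)) hτ w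
  have e2 := clm_fderiv ((ContinuousLinearMap.fst ℝ ℝ ℝ).comp
    (ContinuousLinearMap.snd ℝ ℝ (ℝ × ℝ))) hτ w
  have e3 := clm_fderiv ((ContinuousLinearMap.snd ℝ ℝ ℝ).comp
    (ContinuousLinearMap.snd ℝ ℝ (ℝ × ℝ))) hτ w
  simp only [ContinuousLinearMap.comp_apply, ContinuousLinearMap.coe_fst',
    ContinuousLinearMap.coe_snd'] at e1 e2 e3
  rw [e1, e2, e3]

theorem Dx_comp (h : Change S S' τ) {f : BLPBase → ℝ} (hf : ∀ q ∈ S', ContDiffAt ℝ ∞ f q)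
    {q : BLPBase} (hq : q ∈ S) :
    Dx (fun q => f (τ q)) q = Dx f (τ q) * Dx (fun q => (τ q).2.1) q := by
  have h1 := h.Tx q hq
  have h2 := h.Yx q hq
  rw [Dx, h.fderiv_comp hf hq]
  unfold Dx at *
  rw [h1, h2]
  ring

theorem Dt_comp (h : Change S S' τ) {f : BLPBase → ℝ} (hf : ∀ q ∈ S', ContDiffAt ℝ ∞ f q)
    {q : BLPBase} (hq : q ∈ S) :
    Dt (fun q => f (τ q)) q = Dt f (τ q) * Dx (fun q => (τ q).2.1) q ^ 2 +
      Dx f (τ q) * Dt (fun q => (τ q).2.1) q := by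
  have h1 := h.Tt q hq
  have h2 := h.Yt q hq
  rw [Dt, h.fderiv_comp hf hq, ← h1]
  unfold Dt at *
  rw [h2]
  ring

theorem Dy_comp (h : Change S S' τ) {f : BLPBase → ℝ} (hf : ∀ q ∈ S', ContDiffAt ℝ ∞ f q)
    {q : BLPBase} (hq : q ∈ S) :
    Dy (fun q => f (τ q)) q = Dt f (τ q) * Dy (fun q => (τ q).1) q +
      Dx f (τ q) * Dy (fun q => (τ q).2.1) q + Dy f (τ q) * Dy (fun q => (τ q).2.2) q :=
  h.fderiv_comp hf hq _

theorem smooth_T (h : Change S S' τ) {q : BLPBase} (hq : q ∈ S) :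
    ContDiffAt ℝ ∞ (fun q => (τ q).1) q := (h.smooth q hq).fst

theorem smooth_X (h : Change S S' τ) {q : BLPBase} (hq : q ∈ S) :
    ContDiffAt ℝ ∞ (fun q => (τ q).2.1) q := (h.smooth q hq).snd.fst

theorem smooth_Y (h : Change S S' τ) {q : BLPBase} (hq : q ∈ S) :
    ContDiffAt ℝ ∞ (fun q => (τ q).2.2) q := (h.smooth q hq).snd.snd

/-- T_x = 0 makes T_t = X_x² independent of x, and X_x ≠ 0: so X is affine in x. -/
theorem Dx_a (h : Change S S' τ) {q : BLPBase} (hq : q ∈ S) :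
    Dx (Dx (fun q => (τ q).2.1)) q = 0 := by
  have h1 : Dx (Dt (fun q => (τ q).1)) q = 0 := by
    have e : Dx (Dt (fun q => (τ q).1)) q = Dt (Dx (fun q => (τ q).1)) q :=
      fderiv_apply_comm (h.smooth_T hq) _ _
    rw [e, Dt, fderiv_congr_of_eqOn h.isOpen h.Tx hq]
    simp
  have h2 : Dx (Dt (fun q => (τ q).1)) q =
      Dx (fun q => Dx (fun q => (τ q).2.1) q * Dx (fun q => (τ q).2.1) q) q := by
    rw [Dx, fderiv_congr_of_eqOn h.isOpen (g := fun q => Dx (fun q => (τ q).2.1) q *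
      Dx (fun q => (τ q).2.1) q) (fun r hr => by rw [h.Tt r hr, pow_two]) hq]
    rfl
  have hd := smooth_differentiableAt (contDiffAt_Dx (h.smooth_X hq))
  have h3 : Dx (fun q => Dx (fun q => (τ q).2.1) q * Dx (fun q => (τ q).2.1) q) q = _ :=
    fderiv_mul_apply hd hd _
  rw [h3] at h2
  rw [h2] at h1
  have h4 : Dx (fun q => (τ q).2.1) q * Dx (Dx (fun q => (τ q).2.1)) q = 0 := by
    have e : fderiv ℝ (Dx (fun q => (τ q).2.1)) q (0, 1, 0) =
      Dx (Dx (fun q => (τ q).2.1)) q := rfl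
    rw [e] at h1
    linarith
  exact (mul_eq_zero.1 h4).resolve_left (h.Xx_ne q hq)

theorem Dx_z (h : Change S S' τ) {q : BLPBase} (hq : q ∈ S) :
    Dx (Dt (fun q => (τ q).2.1)) q = Dt (Dx (fun q => (τ q).2.1)) q :=
  fderiv_apply_comm (h.smooth_X hq) _ _

theorem Dx_Dt_a (h : Change S S' τ) {q : BLPBase} (hq : q ∈ S) :
    Dx (Dt (Dx (fun q => (τ q).2.1))) q = 0 := by
  have e : Dx (Dt (Dx (fun q => (τ q).2.1))) q = Dt (Dx (Dx (fun q => (τ q).2.1))) q :=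
    fderiv_apply_comm (contDiffAt_Dx (h.smooth_X hq)) _ _
  rw [e, Dt, fderiv_congr_of_eqOn h.isOpen (fun r hr => h.Dx_a hr) hq]
  simp

/-- Dividing by functions of `(t, y)` commutes with the `x`-derivative. -/
theorem Dx_div (h : Change S S' τ) {f : BLPBase → ℝ} {q : BLPBase} (hq : q ∈ S)
    (hf : ContDiffAt ℝ ∞ f q) (n : ℕ) :
    Dx (fun q => f q / Dx (fun q => (τ q).2.1) q ^ n) q =
      Dx f q / Dx (fun q => (τ q).2.1) q ^ n := by
  have ha := contDiffAt_Dx (h.smooth_X hq)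
  have hn := pow_ne_zero n (h.Xx_ne q hq)
  have hpow : fderiv ℝ (fun q => Dx (fun q => (τ q).2.1) q ^ n) q ((0, 1, 0) : BLPBase) = 0 := by
    rw [fderiv_fun_pow n (smooth_differentiableAt ha)]
    have : fderiv ℝ (Dx (fun q => (τ q).2.1)) q ((0, 1, 0) : BLPBase) = 0 := h.Dx_a hq
    simp [this]
  show fderiv ℝ (fun q => f q / Dx (fun q => (τ q).2.1) q ^ n) q (0, 1, 0) =
    fderiv ℝ f q (0, 1, 0) / Dx (fun q => (τ q).2.1) q ^ n
  rw [fderiv_div_apply (smooth_differentiableAt hf) (smooth_differentiableAt (ha.pow n)) hn, hpow]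
  field_simp
  ring

/-- The correction term in the transformation of `burgers`. -/
noncomputable def corr (τ : BLPBase → BLPBase) (q : BLPBase) : ℝ :=
  Dt (fun z => Dt (fun q => (τ q).2.1) z / (2 * Dx (fun q => (τ q).2.1) z ^ 2)) q /
    Dx (fun q => (τ q).2.1) q ^ 2

theorem smooth_shift (h : Change S S' τ) {q : BLPBase} (hq : q ∈ S) :
    ContDiffAt ℝ ∞ (fun z => Dt (fun q => (τ q).2.1) z / (2 * Dx (fun q => (τ q).2.1) z ^ 2)) q :=
  (contDiffAt_Dt (h.smooth_X hq)).div
    (contDiffAt_const.mul ((contDiffAt_Dx (h.smooth_X hq)).pow 2))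
    (mul_ne_zero two_ne_zero (pow_ne_zero 2 (h.Xx_ne q hq)))

theorem smooth_corr (h : Change S S' τ) {q : BLPBase} (hq : q ∈ S) :
    ContDiffAt ℝ ∞ (corr τ) q :=
  (contDiffAt_Dt (h.smooth_shift hq)).div ((contDiffAt_Dx (h.smooth_X hq)).pow 2)
    (pow_ne_zero 2 (h.Xx_ne q hq))

theorem Dx_u (h : Change S S' τ) {u u' : BLPBase → ℝ} (hu : ∀ q ∈ S, ContDiffAt ℝ ∞ u q)
    (hu' : ∀ q ∈ S', ContDiffAt ℝ ∞ u' q)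
    (hU : ∀ q ∈ S, u' (τ q) = u q / Dx (fun q => (τ q).2.1) q -
      Dt (fun q => (τ q).2.1) q / (2 * Dx (fun q => (τ q).2.1) q ^ 2)) {q : BLPBase} (hq : q ∈ S) :
    Dx u' (τ q) = Dx u q / Dx (fun q => (τ q).2.1) q ^ 2 -
      Dt (Dx (fun q => (τ q).2.1)) q / (2 * Dx (fun q => (τ q).2.1) q ^ 3) := by
  have h1 := h.Dx_comp hu' hq
  have ha0 := h.Xx_ne q hq
  have hz := (contDiffAt_Dt (h.smooth_X hq)).div_const 2
  have ha := contDiffAt_Dx (h.smooth_X hq)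
  have hdz := smooth_differentiableAt (contDiffAt_Dt (h.smooth_X hq))
  have h2 : Dx (fun q => u' (τ q)) q =
      Dx (fun q => u q / Dx (fun q => (τ q).2.1) q ^ 1) q -
        Dx (fun q => Dt (fun q => (τ q).2.1) q / 2 / Dx (fun q => (τ q).2.1) q ^ 2) q := by
    rw [Dx, fderiv_congr_of_eqOn h.isOpen (g := fun q => u q / Dx (fun q => (τ q).2.1) q ^ 1 -
      Dt (fun q => (τ q).2.1) q / 2 / Dx (fun q => (τ q).2.1) q ^ 2)
      (fun r hr => by rw [hU r hr, pow_one, div_div]) hq]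
    exact fderiv_sub_apply (smooth_differentiableAt ((hu q hq).div (ha.pow 1) (pow_ne_zero 1 ha0)))
      (smooth_differentiableAt (hz.div (ha.pow 2) (pow_ne_zero 2 ha0))) _
  rw [h.Dx_div hq (hu q hq), h.Dx_div hq hz] at h2
  have h3 : Dx (fun q => Dt (fun q => (τ q).2.1) q / 2) q =
      Dx (Dt (fun q => (τ q).2.1)) q / 2 := by
    rw [Dx, fderiv_div_apply hdz (differentiableAt_const _) two_ne_zero]
    simp [Dx]
    ring
  rw [h3, h.Dx_z hq, h1] at h2
  apply mul_right_cancel₀ ha0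
  rw [h2]
  field_simp

theorem Dx_Dx_u (h : Change S S' τ) {u u' : BLPBase → ℝ} (hu : ∀ q ∈ S, ContDiffAt ℝ ∞ u q)
    (hu' : ∀ q ∈ S', ContDiffAt ℝ ∞ u' q)
    (hU : ∀ q ∈ S, u' (τ q) = u q / Dx (fun q => (τ q).2.1) q -
      Dt (fun q => (τ q).2.1) q / (2 * Dx (fun q => (τ q).2.1) q ^ 2)) {q : BLPBase} (hq : q ∈ S) :
    Dx (Dx u') (τ q) = Dx (Dx u) q / Dx (fun q => (τ q).2.1) q ^ 3 := by
  have h1 := h.Dx_comp (fun r hr => contDiffAt_Dx (hu' r hr)) hq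
  have ha0 := h.Xx_ne q hq
  have ha := contDiffAt_Dx (h.smooth_X hq)
  have hz := (contDiffAt_Dt ha).div_const 2
  have h2 : Dx (fun q => Dx u' (τ q)) q =
      Dx (fun q => Dx u q / Dx (fun q => (τ q).2.1) q ^ 2) q -
      Dx (fun q => Dt (Dx (fun q => (τ q).2.1)) q / 2 / Dx (fun q => (τ q).2.1) q ^ 3) q := by
    rw [Dx, fderiv_congr_of_eqOn h.isOpen (g := fun q => Dx u q / Dx (fun q => (τ q).2.1) q ^ 2 -
      Dt (Dx (fun q => (τ q).2.1)) q / 2 / Dx (fun q => (τ q).2.1) q ^ 3)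
      (fun r hr => by rw [h.Dx_u hu hu' hU hr, div_div]) hq]
    exact fderiv_sub_apply
      (smooth_differentiableAt ((contDiffAt_Dx (hu q hq)).div (ha.pow 2) (pow_ne_zero 2 ha0)))
      (smooth_differentiableAt (hz.div (ha.pow 3) (pow_ne_zero 3 ha0))) _
  rw [h.Dx_div hq (contDiffAt_Dx (hu q hq)), h.Dx_div hq hz] at h2
  have h3 : Dx (fun q => Dt (Dx (fun q => (τ q).2.1)) q / 2) q = 0 := by
    rw [Dx, fderiv_div_apply (smooth_differentiableAt (contDiffAt_Dt ha))
      (differentiableAt_const _) two_ne_zero]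
    have : fderiv ℝ (Dt (Dx (fun q => (τ q).2.1))) q (0, 1, 0) = 0 := h.Dx_Dt_a hq
    simp [this]
  rw [h3, h1] at h2
  apply mul_right_cancel₀ ha0
  rw [h2]
  field_simp
  ring

/-- The transformation rule of `burgers`. -/
theorem burgers_comp (h : Change S S' τ) {u u' : BLPBase → ℝ} (hu : ∀ q ∈ S, ContDiffAt ℝ ∞ u q)
    (hu' : ∀ q ∈ S', ContDiffAt ℝ ∞ u' q)
    (hU : ∀ q ∈ S, u' (τ q) = u q / Dx (fun q => (τ q).2.1) q -
      Dt (fun q => (τ q).2.1) q / (2 * Dx (fun q => (τ q).2.1) q ^ 2)) {q : BLPBase} (hq : q ∈ S) :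
    burgers u' (τ q) = burgers u q / Dx (fun q => (τ q).2.1) q ^ 3 - corr τ q := by
  have ha0 := h.Xx_ne q hq
  have ha := contDiffAt_Dx (h.smooth_X hq)
  have h1 := h.Dt_comp hu' hq
  have h2 : Dt (fun q => u' (τ q)) q = (Dt u q * Dx (fun q => (τ q).2.1) q -
      u q * Dt (Dx (fun q => (τ q).2.1)) q) / Dx (fun q => (τ q).2.1) q ^ 2 -
      Dt (fun z => Dt (fun q => (τ q).2.1) z / (2 * Dx (fun q => (τ q).2.1) z ^ 2)) q := by
    rw [Dt, fderiv_congr_of_eqOn h.isOpen hU hq, fderiv_sub_apply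
      (differentiableAt_div (smooth_differentiableAt (hu q hq)) (smooth_differentiableAt ha) ha0)
      (smooth_differentiableAt (h.smooth_shift hq)),
      fderiv_div_apply (smooth_differentiableAt (hu q hq)) (smooth_differentiableAt ha) ha0]
    rfl
  have h3 := h.Dx_u hu hu' hU hq
  have h4 : Dt u' (τ q) = ((Dt u q * Dx (fun q => (τ q).2.1) q -
      u q * Dt (Dx (fun q => (τ q).2.1)) q) / Dx (fun q => (τ q).2.1) q ^ 2 -
      Dt (fun z => Dt (fun q => (τ q).2.1) z / (2 * Dx (fun q => (τ q).2.1) z ^ 2)) q -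
      Dx u' (τ q) * Dt (fun q => (τ q).2.1) q) / Dx (fun q => (τ q).2.1) q ^ 2 := by
    rw [← h2, h1]
    field_simp
    ring
  -- The terms X_t u'_X coming from u'_T and from -2u'u'_X cancel; this is the role of the shift in
  -- u'. The terms with uX_xt cancel too, and what remains beside `burgers` is free of u.
  unfold burgers corr
  rw [h4, h3, hU q hq, h.Dx_Dx_u hu hu' hU hq]
  field_simp
  ring

/-- The transformation rule of the `x`-derivatives of `v`. -/
theorem Dx_v (h : Change S S' τ) {v v' b : BLPBase → ℝ} (hv : ∀ q ∈ S, ContDiffAt ℝ ∞ v q)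
    (hv' : ∀ q ∈ S', ContDiffAt ℝ ∞ v' q) (hb : ∀ q ∈ S, ContDiffAt ℝ ∞ b q)
    (hbx : ∀ q ∈ S, Dx b q = 0)
    (hV : ∀ q ∈ S, Dx (fun q => v' (τ q)) q = b q * Dx v q) {q : BLPBase} (hq : q ∈ S) :
    Dx v' (τ q) = b q * Dx v q / Dx (fun q => (τ q).2.1) q ∧
    Dx (Dx v') (τ q) = b q * Dx (Dx v) q / Dx (fun q => (τ q).2.1) q ^ 2 ∧
    Dx (Dx (Dx v')) (τ q) = b q * Dx (Dx (Dx v)) q / Dx (fun q => (τ q).2.1) q ^ 3 := by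
  -- Each further X-derivative costs one factor 1/X_x, because neither b nor X_x depends on x.
  have step : ∀ (f f' : BLPBase → ℝ) (n : ℕ), (∀ q ∈ S, ContDiffAt ℝ ∞ f q) →
      (∀ q ∈ S', ContDiffAt ℝ ∞ f' q) →
      (∀ q ∈ S, f' (τ q) = b q * f q / Dx (fun q => (τ q).2.1) q ^ n) →
      ∀ q ∈ S, Dx f' (τ q) = b q * Dx f q / Dx (fun q => (τ q).2.1) q ^ (n + 1) := by
    intro f f' n hf hf' hff q hq
    have h1 := h.Dx_comp hf' hq
    have h2 : Dx (fun q => f' (τ q)) q = b q * Dx f q / Dx (fun q => (τ q).2.1) q ^ n := by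
      have e : Dx (fun q => f' (τ q)) q =
          Dx (fun q => b q * f q / Dx (fun q => (τ q).2.1) q ^ n) q := by
        rw [Dx, fderiv_congr_of_eqOn h.isOpen hff hq]; rfl
      have e2 : Dx (fun q => b q * f q) q = Dx b q * f q + b q * Dx f q := by
        rw [show Dx (fun q => b q * f q) q = fderiv ℝ (fun q => b q * f q) q (0, 1, 0) from rfl,
          fderiv_mul_apply (smooth_differentiableAt (hb q hq)) (smooth_differentiableAt (hf q hq))]
        simp only [Dx]
        ring
      rw [e, h.Dx_div hq ((hb q hq).mul (hf q hq)), e2, hbx q hq]; ring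
    have ha0 := h.Xx_ne q hq
    rw [h1] at h2
    apply mul_right_cancel₀ ha0
    rw [h2, pow_succ]
    field_simp
  have s1 : ∀ q ∈ S, Dx v' (τ q) = b q * Dx v q / Dx (fun q => (τ q).2.1) q ^ 1 := by
    intro q hq
    have ha0 := h.Xx_ne q hq
    rw [← hV q hq, h.Dx_comp hv' hq]
    field_simp
  have s2 := step (Dx v) (Dx v') 1 (fun q hq => contDiffAt_Dx (hv q hq))
    (fun q hq => contDiffAt_Dx (hv' q hq)) s1
  have s3 := step (Dx (Dx v)) (Dx (Dx v')) 2 (fun q hq => contDiffAt_Dx (contDiffAt_Dx (hv q hq)))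
    (fun q hq => contDiffAt_Dx (contDiffAt_Dx (hv' q hq))) s2
  exact ⟨by simpa using s1 q hq, s2 q hq, s3 q hq⟩

/-- The `y`-derivative of the correction term vanishes when `T` and `X` do not depend on `y`. -/
theorem Dy_corr (h : Change S S' τ) (hXy : ∀ q ∈ S, Dy (fun q => (τ q).2.1) q = 0) {q : BLPBase}
    (hq : q ∈ S) : Dy (Dx (fun q => (τ q).2.1)) q = 0 ∧ Dy (corr τ) q = 0 := by
  have ha : ∀ q ∈ S, Dy (Dx (fun q => (τ q).2.1)) q = 0 := by
    intro q hq
    have e : Dy (Dx (fun q => (τ q).2.1)) q = Dx (Dy (fun q => (τ q).2.1)) q :=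
      fderiv_apply_comm (h.smooth_X hq) _ _
    rw [e, Dx, fderiv_congr_of_eqOn h.isOpen hXy hq]; simp
  have hz : ∀ q ∈ S, Dy (Dt (fun q => (τ q).2.1)) q = 0 := by
    intro q hq
    have e : Dy (Dt (fun q => (τ q).2.1)) q = Dt (Dy (fun q => (τ q).2.1)) q :=
      fderiv_apply_comm (h.smooth_X hq) _ _
    rw [e, Dt, fderiv_congr_of_eqOn h.isOpen hXy hq]; simp
  have hpow : ∀ q ∈ S, fderiv ℝ (fun q => Dx (fun q => (τ q).2.1) q ^ 2) q
      ((0, 0, 1) : BLPBase) = 0 := by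
    intro q hq
    rw [fderiv_fun_pow 2 (smooth_differentiableAt (contDiffAt_Dx (h.smooth_X hq)))]
    have : fderiv ℝ (Dx (fun q => (τ q).2.1)) q ((0, 0, 1) : BLPBase) = 0 := ha q hq
    simp [this]
  have hshift : ∀ q ∈ S, Dy (fun z => Dt (fun q => (τ q).2.1) z /
      (2 * Dx (fun q => (τ q).2.1) z ^ 2)) q = 0 := by
    intro q hq
    have ha1 := contDiffAt_Dx (h.smooth_X hq)
    rw [Dy, fderiv_div_apply (smooth_differentiableAt (contDiffAt_Dt (h.smooth_X hq)))
      (smooth_differentiableAt (contDiffAt_const.mul (ha1.pow 2)))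
      (mul_ne_zero two_ne_zero (pow_ne_zero 2 (h.Xx_ne q hq))),
      fderiv_mul_apply (differentiableAt_const _) (smooth_differentiableAt (ha1.pow 2)), hpow q hq]
    have : fderiv ℝ (Dt (fun q => (τ q).2.1)) q (0, 0, 1) = 0 := hz q hq
    simp [this]
  refine ⟨ha q hq, ?_⟩
  have e : Dy (Dt (fun z => Dt (fun q => (τ q).2.1) z / (2 * Dx (fun q => (τ q).2.1) z ^ 2))) q =
      Dt (Dy (fun z => Dt (fun q => (τ q).2.1) z / (2 * Dx (fun q => (τ q).2.1) z ^ 2))) q :=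
    fderiv_apply_comm (h.smooth_shift hq) _ _
  have e2 : fderiv ℝ (Dt (fun z => Dt (fun q => (τ q).2.1) z /
      (2 * Dx (fun q => (τ q).2.1) z ^ 2))) q (0, 0, 1) = 0 := by
    refine e.trans ?_
    rw [Dt, fderiv_congr_of_eqOn h.isOpen hshift hq]; simp
  show fderiv ℝ (fun q => Dt (fun z => Dt (fun q => (τ q).2.1) z /
    (2 * Dx (fun q => (τ q).2.1) z ^ 2)) q / Dx (fun q => (τ q).2.1) q ^ 2) q (0, 0, 1) = 0
  rw [fderiv_div_apply (smooth_differentiableAt (contDiffAt_Dt (h.smooth_shift hq)))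
    (smooth_differentiableAt ((contDiffAt_Dx (h.smooth_X hq)).pow 2))
    (pow_ne_zero 2 (h.Xx_ne q hq)), e2, hpow q hq]
  simp

end Change

end BLP

/-! ### The action on graphs of maps with the structure found so far. -/

namespace BLP
open Filter Topology

theorem JetStructure.map {M : BLPSpace →L[ℝ] BLPSpace} {P P' : BLPSpace}
    (h : JetStructure M P P') (z : BLPSpace) :
    (M z).1 = (M (0, 1, 0, 0, 0)).2.1 ^ 2 * z.1 + (M (0, 0, 1, 0, 0)).1 * z.2.2.1 ∧
    (M z).2.1 = (M (1, 0, 0, 0, 0)).2.1 * z.1 + (M (0, 1, 0, 0, 0)).2.1 * z.2.1 +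
      (M (0, 0, 1, 0, 0)).2.1 * z.2.2.1 ∧
    (M z).2.2.1 = (M (0, 0, 1, 0, 0)).2.2.1 * z.2.2.1 ∧
    (M z).2.2.2.2 = (M (0, 0, 1, 0, 0)).2.2.2.2 * z.2.2.1 +
      (M (0, 0, 0, 0, 1)).2.2.2.2 * z.2.2.2.2 := by
  rw [map_space M z]
  simp only [Prod.fst_add, Prod.snd_add, Prod.smul_fst, Prod.smul_snd, smul_eq_mul, h.Tx, h.Tu,
    h.Tv, h.Tt, h.Xu, h.Xv, h.Yt, h.Yx, h.Yu, h.Yv, h.Vx, h.Vt, h.Vu]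
  refine ⟨?_, ?_, ?_, ?_⟩ <;> ring

/-- The transformation of the independent variables induced by `f` on the graph of `(u, v)`. -/
noncomputable def baseChange (f : BLPSpace → BLPSpace) (u v : BLPBase → ℝ) (q : BLPBase) :
    BLPBase := baseProj (f (lift u v q))

/-- Data for the action of a map satisfying the conditions of `JetStructure` on a graph. -/
structure Action (f : BLPSpace → BLPSpace) (u v : BLPBase → ℝ) (S : Set BLPBase) : Prop where
  isOpen : IsOpen S
  smooth_u : ∀ q ∈ S, ContDiffAt ℝ ∞ u q
  smooth_v : ∀ q ∈ S, ContDiffAt ℝ ∞ v q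
  smooth_f : ∀ q ∈ S, ContDiffAt ℝ ∞ f (lift u v q)
  jet : ∀ q ∈ S, JetStructure (fderiv ℝ f (lift u v q)) (lift u v q) (f (lift u v q))

namespace Action

variable {f : BLPSpace → BLPSpace} {u v : BLPBase → ℝ} {S : Set BLPBase}

theorem mono (h : Action f u v S) {S₁ : Set BLPBase} (h₁ : IsOpen S₁) (hS : S₁ ⊆ S) :
    Action f u v S₁ :=
  ⟨h₁, fun q hq => h.smooth_u q (hS hq), fun q hq => h.smooth_v q (hS hq),
    fun q hq => h.smooth_f q (hS hq), fun q hq => h.jet q (hS hq)⟩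

theorem smooth_lift (h : Action f u v S) {q : BLPBase} (hq : q ∈ S) :
    ContDiffAt ℝ ∞ (fun q => f (lift u v q)) q :=
  (h.smooth_f q hq).comp q (contDiffAt_lift (h.smooth_u q hq) (h.smooth_v q hq))

theorem smooth_baseChange (h : Action f u v S) {q : BLPBase} (hq : q ∈ S) :
    ContDiffAt ℝ ∞ (baseChange f u v) q :=
  baseProj.contDiff.contDiffAt.comp q (h.smooth_lift hq)

theorem fderiv_comp_lift (h : Action f u v S) {q : BLPBase} (hq : q ∈ S) (w : BLPBase) :
    fderiv ℝ (fun q => f (lift u v q)) q w =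
      fderiv ℝ f (lift u v q) (w.1, w.2.1, w.2.2, fderiv ℝ u q w, fderiv ℝ v q w) := by
  rw [fderiv_fun_comp q (smooth_differentiableAt (h.smooth_f q hq))
    (smooth_differentiableAt (contDiffAt_lift (h.smooth_u q hq) (h.smooth_v q hq)))]
  show fderiv ℝ f (lift u v q) (fderiv ℝ (lift u v) q w) = _
  rw [hasFDerivAt_lift (smooth_differentiableAt (h.smooth_u q hq))
    (smooth_differentiableAt (h.smooth_v q hq))]

theorem fderiv_components (h : Action f u v S) {q : BLPBase} (hq : q ∈ S) (w : BLPBase)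
    {M : BLPSpace →L[ℝ] BLPSpace} (hM : fderiv ℝ f (lift u v q) = M) :
    fderiv ℝ (fun q => (baseChange f u v q).1) q w =
      (M (0, 1, 0, 0, 0)).2.1 ^ 2 * w.1 + (M (0, 0, 1, 0, 0)).1 * w.2.2 ∧
    fderiv ℝ (fun q => (baseChange f u v q).2.1) q w =
      (M (1, 0, 0, 0, 0)).2.1 * w.1 + (M (0, 1, 0, 0, 0)).2.1 * w.2.1 +
        (M (0, 0, 1, 0, 0)).2.1 * w.2.2 ∧
    fderiv ℝ (fun q => (baseChange f u v q).2.2) q w = (M (0, 0, 1, 0, 0)).2.2.1 * w.2.2 ∧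
    fderiv ℝ (fun q => (f (lift u v q)).2.2.2.2) q w = (M (0, 0, 1, 0, 0)).2.2.2.2 * w.2.2 +
      (M (0, 0, 0, 0, 1)).2.2.2.2 * fderiv ℝ v q w := by
  have hd := smooth_differentiableAt (h.smooth_lift hq)
  have hmap := (h.jet q hq).map (w.1, w.2.1, w.2.2, fderiv ℝ u q w, fderiv ℝ v q w)
  rw [← h.fderiv_comp_lift hq] at hmap
  subst hM
  refine ⟨?_, ?_, ?_, ?_⟩
  · exact (clm_fderiv prT hd w).trans hmap.1
  · exact (clm_fderiv prX hd w).trans hmap.2.1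
  · exact (clm_fderiv prY hd w).trans hmap.2.2.1
  · exact (clm_fderiv prV hd w).trans hmap.2.2.2

theorem Dx_X (h : Action f u v S) {q : BLPBase} (hq : q ∈ S) :
    Dx (fun q => (baseChange f u v q).2.1) q = (fderiv ℝ f (lift u v q) (0, 1, 0, 0, 0)).2.1 :=
  (h.fderiv_components hq (0, 1, 0) rfl).2.1.trans (by simp)

theorem Dt_X (h : Action f u v S) {q : BLPBase} (hq : q ∈ S) :
    Dt (fun q => (baseChange f u v q).2.1) q = (fderiv ℝ f (lift u v q) (1, 0, 0, 0, 0)).2.1 :=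
  (h.fderiv_components hq (1, 0, 0) rfl).2.1.trans (by simp)

theorem Dy_X (h : Action f u v S) {q : BLPBase} (hq : q ∈ S) :
    Dy (fun q => (baseChange f u v q).2.1) q = (fderiv ℝ f (lift u v q) (0, 0, 1, 0, 0)).2.1 :=
  (h.fderiv_components hq (0, 0, 1) rfl).2.1.trans (by simp)

theorem Dy_T (h : Action f u v S) {q : BLPBase} (hq : q ∈ S) :
    Dy (fun q => (baseChange f u v q).1) q = (fderiv ℝ f (lift u v q) (0, 0, 1, 0, 0)).1 :=
  (h.fderiv_components hq (0, 0, 1) rfl).1.trans (by simp)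

theorem Dy_Y (h : Action f u v S) {q : BLPBase} (hq : q ∈ S) :
    Dy (fun q => (baseChange f u v q).2.2) q = (fderiv ℝ f (lift u v q) (0, 0, 1, 0, 0)).2.2.1 :=
  (h.fderiv_components hq (0, 0, 1) rfl).2.2.1.trans (by simp)

theorem change (h : Action f u v S) {S' : Set BLPBase}
    (hmaps : ∀ q ∈ S, baseChange f u v q ∈ S') : Change S S' (baseChange f u v) where
  isOpen := h.isOpen
  mapsTo := hmaps
  smooth := fun q hq => h.smooth_baseChange hq
  Tx := fun q hq => (h.fderiv_components hq (0, 1, 0) rfl).1.trans (by simp)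
  Tt := fun q hq => by
    rw [h.Dx_X hq]
    exact (h.fderiv_components hq (1, 0, 0) rfl).1.trans (by simp)
  Yx := fun q hq => (h.fderiv_components hq (0, 1, 0) rfl).2.2.1.trans (by simp)
  Yt := fun q hq => (h.fderiv_components hq (1, 0, 0) rfl).2.2.1.trans (by simp)
  Xx_ne := fun q hq => by rw [h.Dx_X hq]; exact (h.jet q hq).Xx_ne

theorem u_eq (h : Action f u v S) {u' v' : BLPBase → ℝ}
    (heq : ∀ q ∈ S, f (lift u v q) = lift u' v' (baseChange f u v q)) :
    ∀ q ∈ S, u' (baseChange f u v q) =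
      u q / Dx (fun q => (baseChange f u v q).2.1) q -
        Dt (fun q => (baseChange f u v q).2.1) q /
          (2 * Dx (fun q => (baseChange f u v q).2.1) q ^ 2) := by
  intro q hq
  rw [h.Dx_X hq, h.Dt_X hq]
  have e : (f (lift u v q)).2.2.2.1 = u' (baseChange f u v q) := by rw [heq q hq]; rfl
  rw [← e]
  exact (h.jet q hq).U_eq

theorem fderiv_v_comp (h : Action f u v S) {u' v' : BLPBase → ℝ}
    (heq : ∀ q ∈ S, f (lift u v q) = lift u' v' (baseChange f u v q)) {q : BLPBase} (hq : q ∈ S)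
    (w : BLPBase) (hw : w.2.2 = 0) : fderiv ℝ (fun q => v' (baseChange f u v q)) q w =
      (fderiv ℝ f (lift u v q) (0, 0, 0, 0, 1)).2.2.2.2 * fderiv ℝ v q w := by
  have e : ∀ q ∈ S, v' (baseChange f u v q) = (f (lift u v q)).2.2.2.2 := fun q hq => by
    rw [heq q hq]; rfl
  rw [fderiv_congr_of_eqOn h.isOpen e hq, (h.fderiv_components hq w rfl).2.2.2, hw]
  ring

/-- The Jacobian of the induced base map is triangular in the order y, t, x, with diagonal Y_y,
X_x², X_x. Transversality is therefore automatic at this stage, for every graph. -/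
theorem exists_equiv (h : Action f u v S) {q : BLPBase} (hq : q ∈ S) :
    ∃ B : BLPBase ≃L[ℝ] BLPBase, fderiv ℝ (baseChange f u v) q = B := by
  obtain ⟨B, hB⟩ := exists_equiv_of_injective (fderiv ℝ (baseChange f u v) q) (by
    intro ξ hξ
    have hd := smooth_differentiableAt (h.smooth_baseChange hq)
    obtain ⟨h1, h2, h3, -⟩ := h.fderiv_components hq ξ rfl
    have e1 : fderiv ℝ (fun q => (baseChange f u v q).1) q ξ = 0 := by
      rw [show (fun q => (baseChange f u v q).1) = fun q =>
        ContinuousLinearMap.fst ℝ ℝ (ℝ × ℝ) (baseChange f u v q) from rfl, clm_fderiv _ hd, hξ]; rfl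
    have e2 : fderiv ℝ (fun q => (baseChange f u v q).2.1) q ξ = 0 := by
      rw [show (fun q => (baseChange f u v q).2.1) = fun q =>
        (ContinuousLinearMap.fst ℝ ℝ ℝ).comp (ContinuousLinearMap.snd ℝ ℝ (ℝ × ℝ))
          (baseChange f u v q) from rfl, clm_fderiv _ hd, hξ]; rfl
    have e3 : fderiv ℝ (fun q => (baseChange f u v q).2.2) q ξ = 0 := by
      rw [show (fun q => (baseChange f u v q).2.2) = fun q =>
        (ContinuousLinearMap.snd ℝ ℝ ℝ).comp (ContinuousLinearMap.snd ℝ ℝ (ℝ × ℝ))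
          (baseChange f u v q) from rfl, clm_fderiv _ hd, hξ]; rfl
    have ht := h.jet q hq
    have hX := ht.Xx_ne
    have hy : ξ.2.2 = 0 := (mul_eq_zero.1 (h3.symm.trans e3)).resolve_left ht.Yy_ne
    rw [e1, hy, mul_zero, add_zero] at h1
    have ht0 : ξ.1 = 0 := (mul_eq_zero.1 h1.symm).resolve_left (pow_ne_zero 2 hX)
    rw [e2, hy, ht0, mul_zero, mul_zero, add_zero, zero_add] at h2
    have hx : ξ.2.1 = 0 := (mul_eq_zero.1 h2.symm).resolve_left hX
    exact Prod.ext ht0 (Prod.ext hx hy))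
  exact ⟨B, hB.symm⟩

end Action

end BLP

/-! ### Necessary conditions from the first equation. -/

namespace BLP
open Filter Topology

/-- The infinitesimal form of the point symmetries of the system, at the point `P`. -/
structure SymAt (f : BLPSpace → BLPSpace) (P : BLPSpace) : Prop
    extends JetStructure (fderiv ℝ f P) P (f P) where
  Ty : (fderiv ℝ f P (0, 0, 1, 0, 0)).1 = 0
  Xy : (fderiv ℝ f P (0, 0, 1, 0, 0)).2.1 = 0
  Vv_Yy : (fderiv ℝ f P (0, 0, 0, 0, 1)).2.2.2.2 * (fderiv ℝ f P (0, 0, 1, 0, 0)).2.2.1 = 1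

theorem Action.of_openPartialHomeomorph {Φ : OpenPartialHomeomorph BLPSpace BLPSpace}
    (hΦ : ContDiffOn ℝ ∞ Φ Φ.source)
    (h3 : ∀ P ∈ Φ.source, JetStructure (fderiv ℝ Φ P) P (Φ P))
    {Ω : Set BLPBase} {u v : BLPBase → ℝ} (hΩ : IsOpen Ω) (hu : ContDiffOn ℝ ∞ u Ω)
    (hv : ContDiffOn ℝ ∞ v Ω) : Action Φ u v (Ω ∩ lift u v ⁻¹' Φ.source) := by
  have hu' : ∀ q ∈ Ω, ContDiffAt ℝ ∞ u q := fun q hq => hu.contDiffAt (hΩ.mem_nhds hq)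
  have hv' : ∀ q ∈ Ω, ContDiffAt ℝ ∞ v q := fun q hq => hv.contDiffAt (hΩ.mem_nhds hq)
  have hc : ContinuousOn (lift u v) Ω := fun q hq =>
    (contDiffAt_lift (hu' q hq) (hv' q hq)).continuousAt.continuousWithinAt
  exact ⟨hc.isOpen_inter_preimage hΩ Φ.open_source, fun q hq => hu' q hq.1, fun q hq => hv' q hq.1,
    fun q hq => hΦ.contDiffAt (Φ.open_source.mem_nhds hq.2), fun q hq => h3 _ hq.2⟩

variable {Φ : OpenPartialHomeomorph BLPSpace BLPSpace}

/-- Since transversality is automatic, any solution can serve as a test solution near any of its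
points over the source. The output bundles its image with the data required by the transformation
rules. -/
theorem IsPointSymmetry.exists_action (hΦ : IsPointSymmetry Φ) {Ω : Set BLPBase}
    {u v : BLPBase → ℝ} {p : BLPBase} (hΩ : IsOpen Ω) (hp : p ∈ Ω) (hu : ContDiffOn ℝ ∞ u Ω)
    (hv : ContDiffOn ℝ ∞ v Ω) (hs : Solves Ω u v) (hsrc : lift u v p ∈ Φ.source) :
    ∃ (u' v' : BLPBase → ℝ) (S S' : Set BLPBase), Action Φ u v S ∧ p ∈ S ∧ S ⊆ Ω ∧
      (∀ q ∈ S, lift u v q ∈ Φ.source) ∧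
      Change S S' (baseChange Φ u v) ∧ (∀ q ∈ S', ContDiffAt ℝ ∞ u' q) ∧
      (∀ q ∈ S', ContDiffAt ℝ ∞ v' q) ∧ Solves S' u' v' ∧
      ∀ q ∈ S, Φ (lift u v q) = lift u' v' (baseChange Φ u v q) := by
  have hA := Action.of_openPartialHomeomorph hΦ.1 (fun P hP => hΦ.jetStructure hP) hΩ hu hv
  obtain ⟨B, hB⟩ := hA.exists_equiv ⟨hp, hsrc⟩
  obtain ⟨u', v', Ω', hΩ', hpΩ', hu', hv', hs', hev⟩ :=
    hΦ.exists_image hΩ hp hu hv hs hsrc B hB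
  have hev2 : ∀ᶠ q in 𝓝 p, baseChange Φ u v q ∈ Ω' :=
    (hA.smooth_baseChange ⟨hp, hsrc⟩).continuousAt (hΩ'.mem_nhds hpΩ')
  obtain ⟨S, hS, hSo, hpS⟩ := mem_nhds_iff.1
    ((hev.and hev2).and (hA.isOpen.mem_nhds ⟨hp, hsrc⟩))
  have hA' := hA.mono hSo fun q hq => (hS hq).2
  exact ⟨u', v', S, Ω', hA', hpS, fun q hq => (hS hq).2.1, fun q hq => (hS hq).2.2,
    hA'.change fun q hq => (hS hq).1.2,
    fun q hq => hu'.contDiffAt (hΩ'.mem_nhds hq), fun q hq => hv'.contDiffAt (hΩ'.mem_nhds hq),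
    hs', fun q hq => (hS hq).1.1⟩

/-- The correction is built from derivatives of τ, hence depends on its germ only. This permits
replacing the base map of a test solution by that of a constant u. -/
theorem corr_congr {τ τ' : BLPBase → BLPBase} {p : BLPBase} (h : τ =ᶠ[𝓝 p] τ') :
    Change.corr τ =ᶠ[𝓝 p] Change.corr τ' := by
  have hX : (fun q => (τ q).2.1) =ᶠ[𝓝 p] fun q => (τ' q).2.1 := h.mono fun q hq => by simp [hq]
  have hD : ∀ {f g : BLPBase → ℝ} (w : BLPBase), f =ᶠ[𝓝 p] g →
      (fun q => fderiv ℝ f q w) =ᶠ[𝓝 p] fun q => fderiv ℝ g q w := fun w hfg =>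
    (hfg.fderiv (𝕜 := ℝ)).mono fun q hq => by simp only [hq]
  have h1 := hD (1, 0, 0) hX
  have h2 := hD (0, 1, 0) hX
  have h3 := hD (1, 0, 0) (f := fun z => Dt (fun q => (τ q).2.1) z /
    (2 * Dx (fun q => (τ q).2.1) z ^ 2)) (g := fun z => Dt (fun q => (τ' q).2.1) z /
    (2 * Dx (fun q => (τ' q).2.1) z ^ 2)) (by
      filter_upwards [h1, h2] with q e1 e2
      simp only [Dt, Dx]
      rw [e1, e2])
  filter_upwards [h2, h3] with q e2 e3
  unfold Change.corr
  have e3' : Dt (fun z => Dt (fun q => (τ q).2.1) z / (2 * Dx (fun q => (τ q).2.1) z ^ 2)) q =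
    Dt (fun z => Dt (fun q => (τ' q).2.1) z / (2 * Dx (fun q => (τ' q).2.1) z ^ 2)) q := e3
  have e2' : Dx (fun q => (τ q).2.1) q = Dx (fun q => (τ' q).2.1) q := e2
  rw [e3', e2']

/-- Locally, the transformation of the independent variables does not depend on `u`. -/
theorem base_eventually_indep_u {f : BLPSpace → BLPSpace} {W : Set BLPSpace} (hW : IsOpen W)
    (hf : ∀ P ∈ W, ContDiffAt ℝ ∞ f P)
    (h : ∀ P ∈ W, baseProj (fderiv ℝ f P (0, 0, 0, 1, 0)) = 0) {P : BLPSpace} (hP : P ∈ W) :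
    ∀ᶠ Q in 𝓝 P, baseProj (f Q) =
      baseProj (f (Q.1, Q.2.1, Q.2.2.1, P.2.2.2.1, Q.2.2.2.2)) := by
  obtain ⟨r, hr, hball⟩ := Metric.isOpen_iff.1 hW P hP
  filter_upwards [Metric.ball_mem_nhds P hr] with Q hQ
  have hmem : ∀ s ∈ Metric.ball P.2.2.2.1 r,
      ((Q.1, Q.2.1, Q.2.2.1, s, Q.2.2.2.2) : BLPSpace) ∈ W := by
    intro s hs
    apply hball
    simp only [Metric.mem_ball, Prod.dist_eq, max_lt_iff] at hQ hs ⊢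
    exact ⟨hQ.1, hQ.2.1, hQ.2.2.1, hs, hQ.2.2.2.2⟩
  have hder : ∀ s ∈ Metric.ball P.2.2.2.1 r, HasDerivAt
      (fun s : ℝ => baseProj (f (Q.1, Q.2.1, Q.2.2.1, s, Q.2.2.2.2))) 0 s := by
    intro s hs
    have h1 : HasDerivAt (fun s : ℝ => ((Q.1, Q.2.1, Q.2.2.1, s, Q.2.2.2.2) : BLPSpace))
        (0, 0, 0, 1, 0) s :=
      (hasDerivAt_const s Q.1).prodMk ((hasDerivAt_const s Q.2.1).prodMk
        ((hasDerivAt_const s Q.2.2.1).prodMk ((hasDerivAt_id s).prodMk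
          (hasDerivAt_const s Q.2.2.2.2))))
    have h2 := (smooth_differentiableAt (hf _ (hmem s hs))).hasFDerivAt.comp_hasDerivAt s h1
    have h3 := baseProj.hasFDerivAt.comp_hasDerivAt s h2
    rw [h _ (hmem s hs)] at h3
    exact h3
  have := Metric.isOpen_ball.is_const_of_deriv_eq_zero (x := Q.2.2.2.1) (y := P.2.2.2.1)
    (convex_ball P.2.2.2.1 r).isPreconnected
    (fun s hs => (hder s hs).differentiableAt.differentiableWithinAt)
    (fun s hs => (hder s hs).deriv)
    (by simp only [Metric.mem_ball, Prod.dist_eq, max_lt_iff] at hQ ⊢; exact hQ.2.2.2.1)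
    (Metric.mem_ball_self hr)
  exact this

/-- A function `u` of `(t, x)` which solves the system together with any constant `v`. -/
noncomputable def cubic (t0 x0 u0 α β : ℝ) : BLPBase → ℝ := quartic t0 x0 u0 0 0 0 β α 0 0 0

theorem burgers_cubic (t0 x0 u0 α β : ℝ) (q w : BLPBase) :
    fderiv ℝ (burgers (cubic t0 x0 u0 α β)) q w = 2 * β * w.1 -
      (2 * cubic t0 x0 u0 α β q * (6 * α * (q.2.1 - x0) * w.2.1) +
        2 * fderiv ℝ (cubic t0 x0 u0 α β) q w * (3 * α * (q.2.1 - x0) ^ 2)) +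
      6 * α * w.2.1 := by
  have e1 : Dt (cubic t0 x0 u0 α β) = quartic t0 x0 0 0 (2 * β) 0 0 0 0 0 0 := by
    funext q; rw [Dt, cubic, fderiv_quartic]; simp [quartic]
  have e2 : Dx (cubic t0 x0 u0 α β) = quartic t0 x0 0 0 0 (3 * α) 0 0 0 0 0 := by
    funext q; rw [Dx, cubic, fderiv_quartic]; simp [quartic]
  have e3 : Dx (Dx (cubic t0 x0 u0 α β)) = quartic t0 x0 0 (6 * α) 0 0 0 0 0 0 0 := by
    rw [e2]; funext q; rw [Dx, fderiv_quartic]; simp only [quartic]; ring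
  have hd : ∀ a b c d e f g h i, Differentiable ℝ (quartic t0 x0 a b c d e f g h i) :=
    fun a b c d e f g h i => (contDiff_quartic ..).differentiable (by simp)
  have hu : DifferentiableAt ℝ (cubic t0 x0 u0 α β) q := hd _ _ _ _ _ _ _ _ _ q
  have hb : burgers (cubic t0 x0 u0 α β) = fun q => quartic t0 x0 0 0 (2 * β) 0 0 0 0 0 0 q -
      2 * cubic t0 x0 u0 α β q * quartic t0 x0 0 0 0 (3 * α) 0 0 0 0 0 q +
      quartic t0 x0 0 (6 * α) 0 0 0 0 0 0 0 q := by
    funext q; rw [burgers, e3, e1, e2]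
  have hm : DifferentiableAt ℝ (fun q => 2 * cubic t0 x0 u0 α β q) q := hu.const_mul 2
  rw [hb, fderiv_add_apply ((hd _ _ _ _ _ _ _ _ _ q).fun_sub (hm.fun_mul (hd _ _ _ _ _ _ _ _ _ q)))
    (hd _ _ _ _ _ _ _ _ _ q), fderiv_sub_apply (hd _ _ _ _ _ _ _ _ _ q)
    (hm.fun_mul (hd _ _ _ _ _ _ _ _ _ q)), fderiv_mul_apply hm (hd _ _ _ _ _ _ _ _ _ q),
    fderiv_mul_apply (differentiableAt_const _) hu, fderiv_quartic, fderiv_quartic, fderiv_quartic]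
  simp only [quartic, fderiv_fun_const, Pi.zero_apply, zero_apply]
  ring

/-- Here u does not depend on y and v is constant, so every term of both equations vanishes. -/
theorem solves_cubic (t0 x0 u0 α β v0 : ℝ) :
    Solves Set.univ (cubic t0 x0 u0 α β) (fun _ => v0) := by
  intro p _
  have hz : Dx (fun _ : BLPBase => v0) = fun _ => 0 := by funext q; simp [Dx]
  have hz' : Dx (fun _ : BLPBase => (0 : ℝ)) = fun _ => 0 := by funext q; simp [Dx]
  have ht : Dt (fun _ : BLPBase => v0) p = 0 := by simp [Dt]
  have hs : ContDiff ℝ ∞ (cubic t0 x0 u0 α β) := contDiff_quartic ..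
  refine ⟨(first_equation_iff hs.contDiffAt _).2 ?_, ?_⟩
  · rw [hz, hz', hz', Dy, burgers_cubic]
    have : fderiv ℝ (cubic t0 x0 u0 α β) p (0, 0, 1) = 0 := by
      rw [cubic, fderiv_quartic]; simp
    rw [this]
    simp
  · rw [hz, hz', ht]; simp

/-- The first equation for the images of the solutions `cubic`. -/
theorem IsPointSymmetry.cubic_relations (hΦ : IsPointSymmetry Φ) {t0 x0 y0 u0 v0 : ℝ}
    (hP : ((t0, x0, y0, u0, v0) : BLPSpace) ∈ Φ.source) {M : BLPSpace →L[ℝ] BLPSpace}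
    (hM : fderiv ℝ Φ (t0, x0, y0, u0, v0) = M) :
    ∃ C : BLPBase → ℝ, ∀ α β : ℝ, ∃ bt bx : ℝ,
      6 * α / (M (0, 1, 0, 0, 0)).2.1 ^ 3 - C (0, 1, 0) = bx * (M (0, 1, 0, 0, 0)).2.1 ∧
      2 * β / (M (0, 1, 0, 0, 0)).2.1 ^ 3 - C (1, 0, 0) = bt * (M (0, 1, 0, 0, 0)).2.1 ^ 2 +
        bx * (M (1, 0, 0, 0, 0)).2.1 ∧
      - C (0, 0, 1) = bt * (M (0, 0, 1, 0, 0)).1 + bx * (M (0, 0, 1, 0, 0)).2.1 := by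
  set p : BLPBase := (t0, x0, y0) with hp
  set v : BLPBase → ℝ := fun _ => v0 with hv
  refine ⟨fun w => fderiv ℝ (Change.corr (baseChange Φ (fun _ => u0) v)) p w, fun α β => ?_⟩
  set u := cubic t0 x0 u0 α β with hu
  have hup : u p = u0 := by simp [hu, cubic, quartic, hp]
  have hlift : lift u v p = (t0, x0, y0, u0, v0) := by
    rw [lift, hup]
  have hus : ContDiff ℝ ∞ u := contDiff_quartic ..
  obtain ⟨u', v', S, S', hA, hpS, -, hsrc, hC, hu', hv', hs', heq⟩ := hΦ.exists_action isOpen_univ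
    (Set.mem_univ p) hus.contDiffOn contDiff_const.contDiffOn (solves_cubic t0 x0 u0 α β v0)
    (by rw [hlift]; exact hP)
  -- T, X, Y do not depend on u, so u may be frozen at its value u₀ at the base point. This makes
  -- `C` the same for all α and β.
  have hcorr : fderiv ℝ (Change.corr (baseChange Φ u v)) p =
      fderiv ℝ (Change.corr (baseChange Φ (fun _ => u0) v)) p := by
    refine (corr_congr ?_).fderiv_eq
    have h0 := base_eventually_indep_u Φ.open_source (fun P hP => hΦ.contDiffAt hP)
      (fun P hP => by
        have h := hΦ.jetStructure hP
        rw [baseProj_apply, h.Tu, h.Xu, h.Yu]; rfl) hP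
    have hcont : ContinuousAt (lift u v) p := (contDiffAt_lift hus.contDiffAt
      contDiffAt_const).continuousAt
    rw [← hlift] at h0
    filter_upwards [hcont h0] with q hq
    rw [Set.mem_preimage, Set.mem_ofPred_eq] at hq
    rw [baseChange, baseChange, hq]
    simp [lift, hup]
  have hU := hA.u_eq heq
  -- Thanks to this, differentiating B(u)/X_x³ at the base point produces no derivative of X_x.
  have hbz : burgers u p = 0 := by
    have e1 : Dt u p = 0 := by rw [hu, Dt, cubic, fderiv_quartic]; simp [hp]
    have e2 : Dx u = quartic t0 x0 0 0 0 (3 * α) 0 0 0 0 0 := by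
      funext q; rw [hu, Dx, cubic, fderiv_quartic]; simp [quartic]
    have e3 : Dx (Dx u) p = 0 := by rw [e2, Dx, fderiv_quartic]; simp [hp]
    rw [burgers, e1, e3, e2]; simp [quartic, hp]
  have hder : ∀ w, fderiv ℝ (fun q => burgers u' (baseChange Φ u v q)) p w =
      (2 * β * w.1 + 6 * α * w.2.1) / (M (0, 1, 0, 0, 0)).2.1 ^ 3 -
      fderiv ℝ (Change.corr (baseChange Φ (fun _ => u0) v)) p w := by
    intro w
    have ha := (contDiffAt_Dx (hC.smooth_X hpS)).pow 3
    have ha0 := pow_ne_zero 3 (hC.Xx_ne p hpS)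
    have hb := contDiffAt_burgers (hus.contDiffAt (x := p))
    rw [fderiv_congr_of_eqOn hC.isOpen (fun q hq => hC.burgers_comp hA.smooth_u hu' hU hq) hpS,
      fderiv_sub_apply (differentiableAt_div (smooth_differentiableAt hb)
        (smooth_differentiableAt ha) ha0) (smooth_differentiableAt (hC.smooth_corr hpS)),
      fderiv_div_apply (smooth_differentiableAt hb) (smooth_differentiableAt ha) ha0, hbz, hcorr,
      burgers_cubic]
    rw [hA.Dx_X hpS, hlift, hM] at ha0 ⊢
    have e0 : p.2.1 - x0 = 0 := sub_self x0
    have ha1 : (M (0, 1, 0, 0, 0)).2.1 ≠ 0 := fun h => ha0 (by rw [h]; simp)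
    rw [e0]
    field_simp
    ring
  have hchain := hC.fderiv_comp (f := burgers u') (fun q hq => contDiffAt_burgers (hu' q hq)) hpS
  -- The image has v'_XXX = 0, because v is constant; the factor `b` may be taken zero for the same
  -- reason.
  have hy : Dy (burgers u') (baseChange Φ u v p) = 0 := by
    have h1 := (first_equation_iff (hu' _ (hC.mapsTo p hpS)) _).1 (hs' _ (hC.mapsTo p hpS)).1
    rw [(hC.Dx_v (v := v) (b := fun _ => 0) hA.smooth_v hv' (fun _ _ => contDiffAt_const)
      (fun q _ => by simp [Dx]) (fun q hq => by
        rw [Dx, hA.fderiv_v_comp heq hq _ rfl]; simp [hv]) hpS).2.2] at h1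
    rw [h1]; simp
  refine ⟨Dt (burgers u') (baseChange Φ u v p), Dx (burgers u') (baseChange Φ u v p), ?_, ?_, ?_⟩
  · have h1 := hchain (0, 1, 0)
    obtain ⟨c1, c2, c3, -⟩ := hA.fderiv_components hpS (0, 1, 0) rfl
    rw [hder, c1, c2, c3, hlift, hM, hy] at h1
    simpa using h1
  · have h1 := hchain (1, 0, 0)
    obtain ⟨c1, c2, c3, -⟩ := hA.fderiv_components hpS (1, 0, 0) rfl
    rw [hder, c1, c2, c3, hlift, hM, hy] at h1
    simpa using h1
  · have h1 := hchain (0, 0, 1)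
    obtain ⟨c1, c2, c3, -⟩ := hA.fderiv_components hpS (0, 0, 1) rfl
    rw [hder, c1, c2, c3, hlift, hM, hy] at h1
    simpa using h1

/-- In `cubic_relations` the left side of the y-relation is fixed, whereas α moves the coefficient
bx, and β moves bt with bx unchanged. So T_y vanishes, and then X_y. -/
theorem IsPointSymmetry.Ty_Xy_eq_zero (hΦ : IsPointSymmetry Φ) {P : BLPSpace}
    (hP : P ∈ Φ.source) : (fderiv ℝ Φ P (0, 0, 1, 0, 0)).1 = 0 ∧
      (fderiv ℝ Φ P (0, 0, 1, 0, 0)).2.1 = 0 := by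
  obtain ⟨t0, x0, y0, u0, v0⟩ := P
  have ha := (hΦ.jetStructure hP).Xx_ne
  obtain ⟨C, hC⟩ := hΦ.cubic_relations hP rfl
  obtain ⟨bt0, bx0, h01, h02, h03⟩ := hC 0 0
  obtain ⟨bt1, bx1, h11, h12, h13⟩ := hC 1 0
  obtain ⟨bt2, bx2, h21, h22, h23⟩ := hC 0 1
  set M := fderiv ℝ Φ (t0, x0, y0, u0, v0)
  set a := (M (0, 1, 0, 0, 0)).2.1
  have hx2 : bx2 = bx0 := mul_right_cancel₀ ha (by linarith)
  have hx1 : bx1 ≠ bx0 := by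
    intro h
    rw [h, ← h01] at h11
    have : 6 * 1 / a ^ 3 = 0 := by linear_combination h11
    simp [ha] at this
  have ht2 : bt2 ≠ bt0 := by
    intro h
    rw [h, hx2, ← h02] at h22
    have : 2 * 1 / a ^ 3 = 0 := by linear_combination h22
    simp [ha] at this
  have hT : (M (0, 0, 1, 0, 0)).1 = 0 := by
    have : (bt2 - bt0) * (M (0, 0, 1, 0, 0)).1 = 0 := by
      rw [hx2] at h23
      linear_combination h03 - h23
    exact (mul_eq_zero.1 this).resolve_left (sub_ne_zero.2 ht2)
  refine ⟨hT, ?_⟩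
  have : (bx1 - bx0) * (M (0, 0, 1, 0, 0)).2.1 = 0 := by
    rw [hT] at h03 h13
    linear_combination h03 - h13
  exact (mul_eq_zero.1 this).resolve_left (sub_ne_zero.2 hx1)

/-- The transformation rule of the `y`-derivative of `burgers`. -/
theorem Action.Dy_burgers {f : BLPSpace → BLPSpace} {u v u' v' : BLPBase → ℝ} {S S' : Set BLPBase}
    (hA : Action f u v S) (hC : Change S S' (baseChange f u v))
    (hu' : ∀ q ∈ S', ContDiffAt ℝ ∞ u' q)
    (heq : ∀ q ∈ S, f (lift u v q) = lift u' v' (baseChange f u v q))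
    (hTy : ∀ q ∈ S, (fderiv ℝ f (lift u v q) (0, 0, 1, 0, 0)).1 = 0)
    (hXy : ∀ q ∈ S, (fderiv ℝ f (lift u v q) (0, 0, 1, 0, 0)).2.1 = 0) {p : BLPBase}
    (hpS : p ∈ S) : Dy (burgers u) p / Dx (fun q => (baseChange f u v q).2.1) p ^ 3 =
      Dy (burgers u') (baseChange f u v p) *
        (fderiv ℝ f (lift u v p) (0, 0, 1, 0, 0)).2.2.1 := by
  have hXy' : ∀ q ∈ S, Dy (fun q => (baseChange f u v q).2.1) q = 0 := fun q hq => by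
    rw [hA.Dy_X hq, hXy q hq]
  have hder : Dy (fun q => burgers u' (baseChange f u v q)) p =
      Dy (burgers u) p / Dx (fun q => (baseChange f u v q).2.1) p ^ 3 := by
    have ha := contDiffAt_Dx (hC.smooth_X hpS)
    have ha0 := hC.Xx_ne p hpS
    have hb := smooth_differentiableAt (contDiffAt_burgers (hA.smooth_u p hpS))
    obtain ⟨c1, c2⟩ := hC.Dy_corr hXy' hpS
    have c3 : fderiv ℝ (fun q => Dx (fun q => (baseChange f u v q).2.1) q ^ 3) p
        ((0, 0, 1) : BLPBase) = 0 := by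
      rw [fderiv_fun_pow 3 (smooth_differentiableAt ha)]
      have : fderiv ℝ (Dx (fun q => (baseChange f u v q).2.1)) p ((0, 0, 1) : BLPBase) = 0 := c1
      simp [this]
    have c4 : fderiv ℝ (Change.corr (baseChange f u v)) p (0, 0, 1) = 0 := c2
    have c5 : Dy (burgers u) p = fderiv ℝ (burgers u) p (0, 0, 1) := rfl
    rw [c5, Dy, fderiv_congr_of_eqOn hC.isOpen
      (fun q hq => hC.burgers_comp hA.smooth_u hu' (hA.u_eq heq) hq) hpS,
      fderiv_sub_apply (differentiableAt_div hb (smooth_differentiableAt (ha.pow 3))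
        (pow_ne_zero 3 ha0)) (smooth_differentiableAt (hC.smooth_corr hpS)),
      fderiv_div_apply hb (smooth_differentiableAt (ha.pow 3)) (pow_ne_zero 3 ha0), c3, c4]
    field_simp
    ring
  have hchain := hC.Dy_comp (f := burgers u') (fun q hq => contDiffAt_burgers (hu' q hq)) hpS
  rw [hder, hXy' p hpS, hA.Dy_T hpS, hTy p hpS, hA.Dy_Y hpS] at hchain
  rw [hchain]
  ring

/-- With T_y = X_y = 0 the y-derivative of B is divided by X_x³Y_y, while v_xxx is multiplied by
V_v/X_x³. One solution with v_xxx ≠ 0 at the point therefore yields V_vY_y = 1. -/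
theorem IsPointSymmetry.symAt (hΦ : IsPointSymmetry Φ) {P : BLPSpace} (hP : P ∈ Φ.source) :
    SymAt Φ P := by
  have h3 := hΦ.jetStructure hP
  refine ⟨h3, (hΦ.Ty_Xy_eq_zero hP).1, (hΦ.Ty_Xy_eq_zero hP).2, ?_⟩
  obtain ⟨t0, x0, y0, u0, v0⟩ := P
  -- The choice q = -1/2, s = 1, r = 2u₀ makes the prescribed v_xxx equal to 1.
  obtain ⟨Q, h⟩ := exists_solution_jet t0 x0 y0 u0 v0 0 (-1 / 2) 1 (2 * u0) 0 one_ne_zero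
  obtain ⟨Ω, u, v, hΩ, hp, hu, hv, hs, hlift, -, -, -, hvxxx⟩ := h 0 0 0 0 0
  set p : BLPBase := (t0, x0, y0)
  obtain ⟨u', v', S, S', hA, hpS, hSΩ, hsrc, hC, hu', hv', hs', heq⟩ :=
    hΦ.exists_action hΩ hp hu hv hs (by rw [hlift]; exact hP)
  set b : BLPBase → ℝ := fun q => (fderiv ℝ Φ (lift u v q) (0, 0, 0, 0, 1)).2.2.2.2 with hb
  have hsl : ∀ q ∈ S, ContDiffAt ℝ ∞ (lift u v) q := fun q hq =>
    contDiffAt_lift (hA.smooth_u q hq) (hA.smooth_v q hq)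
  have hbs : ∀ q ∈ S, ContDiffAt ℝ ∞ b q := fun q hq =>
    prV.contDiff.contDiffAt.comp q ((contDiffAt_fderiv_apply (hA.smooth_f q hq) _).comp q (hsl q hq))
  -- Along the graph this is V_vx + u_xV_vu + v_xV_vv, and each summand is zero.
  have hbx : ∀ q ∈ S, Dx b q = 0 := by
    intro q hq
    have hd := smooth_differentiableAt (contDiffAt_fderiv_apply (hA.smooth_f q hq) (0, 0, 0, 0, 1))
    have hΦ2 := fun a b => fderiv_apply_comm (hA.smooth_f q hq) a b
    have hdl := smooth_differentiableAt (hsl q hq)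
    rw [Dx, hb, show (fun q => (fderiv ℝ Φ (lift u v q) (0, 0, 0, 0, 1)).2.2.2.2) = fun q =>
      prV (fderiv ℝ Φ (lift u v q) (0, 0, 0, 0, 1)) from rfl,
      clm_fderiv prV (f := fun q => fderiv ℝ Φ (lift u v q) (0, 0, 0, 0, 1))
        (DifferentiableAt.comp q hd hdl) (0, 1, 0), fderiv_fun_comp q hd hdl]
    show prV (fderiv ℝ (fun R => fderiv ℝ Φ R (0, 0, 0, 0, 1)) (lift u v q)
      (fderiv ℝ (lift u v) q (0, 1, 0))) = 0
    rw [hasFDerivAt_lift (smooth_differentiableAt (hA.smooth_u q hq))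
      (smooth_differentiableAt (hA.smooth_v q hq)), map_space]
    have hvv := (hΦ.lower_order_relations (hsrc q hq) rfl rfl rfl rfl).2.2
    have hvx := hΦ.fderiv_fderiv_zero (hsrc q hq) prV _ (0, 0, 0, 0, 1)
      fun R hR => (hΦ.jetStructure hR).Vx
    have hvu := hΦ.fderiv_fderiv_zero (hsrc q hq) prV _ (0, 0, 0, 0, 1)
      fun R hR => (hΦ.jetStructure hR).Vu
    rw [← prV_apply] at hvv
    rw [fderiv_apply_comm (hA.smooth_f q hq)] at hvx hvu
    simp [hvx, hvu, hvv]
  have hV := hC.Dx_v hA.smooth_v hv' hbs hbx (fun q hq => hA.fderiv_v_comp heq hq _ rfl) hpS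
  have hP' := hC.mapsTo p hpS
  have hy : Dy (burgers u') (baseChange Φ u v p) =
      2 * (b p / Dx (fun q => (baseChange Φ u v q).2.1) p ^ 3) := by
    rw [(first_equation_iff (hu' _ hP') _).1 (hs' _ hP').1, hV.2.2, hvxxx]
    ring
  have hby : Dy (burgers u) p = 2 := by
    rw [(first_equation_iff (hA.smooth_u p hpS) _).1 (hs p hp).1, hvxxx]
    ring
  have hchain := hA.Dy_burgers hC hu' heq
    (fun q hq => (hΦ.Ty_Xy_eq_zero (hsrc q hq)).1) (fun q hq => (hΦ.Ty_Xy_eq_zero (hsrc q hq)).2) hpS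
  rw [hby, hy, hlift] at hchain
  have hbp : b p = (fderiv ℝ Φ (t0, x0, y0, u0, v0) (0, 0, 0, 0, 1)).2.2.2.2 := by rw [hb, ← hlift]
  rw [← hbp]
  have ha0 := hC.Xx_ne p hpS
  field_simp at hchain
  linarith

end BLP

/-! ### Sufficiency of the infinitesimal conditions. -/

namespace BLP
open Filter Topology

/-- Under the substitution the two new equations are the old ones at the corresponding point, up to
nonzero factors: the first is divided by Y_yX_x³, the second by Y_yX_x². The base map carries Ω onto
Ω', so the pointwise equivalence gives both implications. -/
theorem isPointSymmetry_of_symAt {Φ : OpenPartialHomeomorph BLPSpace BLPSpace}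
    (h1 : ContDiffOn ℝ ∞ Φ Φ.source) (h2 : ContDiffOn ℝ ∞ Φ.symm Φ.target)
    (h : ∀ P ∈ Φ.source, SymAt Φ P) : IsPointSymmetry Φ := by
  refine ⟨h1, h2, ?_⟩
  intro Ω Ω' u v u' v' hΩ hΩ' hu hv hu' hv' hsrc himg
  have hsrc' : ∀ q ∈ Ω, lift u v q ∈ Φ.source := fun q hq => hsrc ⟨q, hq, rfl⟩
  have hex : ∀ q ∈ Ω, baseChange Φ u v q ∈ Ω' ∧
      Φ (lift u v q) = lift u' v' (baseChange Φ u v q) := by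
    intro q hq
    have : Φ (lift u v q) ∈ graphOver Ω' u' v' := himg ▸ ⟨_, ⟨q, hq, rfl⟩, rfl⟩
    obtain ⟨r, hr, hrq⟩ := this
    have hbr : baseChange Φ u v q = r := by rw [baseChange, ← hrq]; rfl
    rw [hbr]
    exact ⟨hr, hrq.symm⟩
  have hsurj : ∀ r ∈ Ω', ∃ q ∈ Ω, baseChange Φ u v q = r := by
    intro r hr
    have : lift u' v' r ∈ Φ '' graphOver Ω u v := himg ▸ ⟨r, hr, rfl⟩
    obtain ⟨_, ⟨q, hq, rfl⟩, hqr⟩ := this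
    refine ⟨q, hq, ?_⟩
    have hqr' : Φ (lift u v q) = lift u' v' r := hqr
    rw [baseChange, hqr']; rfl
  have hA : Action Φ u v Ω := (Action.of_openPartialHomeomorph h1
    (fun P hP => (h P hP).toJetStructure) hΩ hu hv).mono hΩ fun q hq => ⟨hq, hsrc' q hq⟩
  have hC := hA.change fun q hq => (hex q hq).1
  have hu'' : ∀ q ∈ Ω', ContDiffAt ℝ ∞ u' q := fun q hq => hu'.contDiffAt (hΩ'.mem_nhds hq)
  have hv'' : ∀ q ∈ Ω', ContDiffAt ℝ ∞ v' q := fun q hq => hv'.contDiffAt (hΩ'.mem_nhds hq)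
  have heq : ∀ q ∈ Ω, Φ (lift u v q) = lift u' v' (baseChange Φ u v q) := fun q hq => (hex q hq).2
  set Y : BLPBase → ℝ := fun q => (baseChange Φ u v q).2.2 with hY
  have hYs : ∀ q ∈ Ω, ContDiffAt ℝ ∞ (Dy Y) q := fun q hq => contDiffAt_Dy (hC.smooth_Y hq)
  have hYne : ∀ q ∈ Ω, Dy Y q ≠ 0 := fun q hq => by
    rw [hY, hA.Dy_Y hq]; exact (h _ (hsrc' q hq)).Yy_ne
  have hVv : ∀ q ∈ Ω, (fderiv ℝ Φ (lift u v q) (0, 0, 0, 0, 1)).2.2.2.2 = 1 / Dy Y q := fun q hq => by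
    rw [eq_div_iff (hYne q hq), hY, hA.Dy_Y hq]; exact (h _ (hsrc' q hq)).Vv_Yy
  have hbx : ∀ q ∈ Ω, Dx (fun q => 1 / Dy Y q) q = 0 := by
    intro q hq
    have e : Dx (Dy Y) q = Dy (Dx Y) q := fderiv_apply_comm (hC.smooth_Y hq) _ _
    have e2 : fderiv ℝ (Dy Y) q (0, 1, 0) = 0 := by
      refine e.trans ?_
      rw [Dy, fderiv_congr_of_eqOn hΩ hC.Yx hq]; simp
    rw [Dx, fderiv_div_apply (differentiableAt_const _) (smooth_differentiableAt (hYs q hq))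
      (hYne q hq), e2]
    simp
  have hcomp : ∀ q ∈ Ω, ∀ w : BLPBase, w.2.2 = 0 →
      fderiv ℝ (fun q => v' (baseChange Φ u v q)) q w = 1 / Dy Y q * fderiv ℝ v q w :=
    fun q hq w hw => by rw [hA.fderiv_v_comp heq hq w hw, hVv q hq]
  have key : ∀ q ∈ Ω,
      ((Dy (Dt u) q = Dy (Dx (fun q => u q ^ 2 - Dx u q)) q + 2 * Dx (Dx (Dx v)) q ∧
        Dt v q = Dx (Dx v) q + 2 * u q * Dx v q) ↔
      (Dy (Dt u') (baseChange Φ u v q) =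
        Dy (Dx (fun q => u' q ^ 2 - Dx u' q)) (baseChange Φ u v q) +
          2 * Dx (Dx (Dx v')) (baseChange Φ u v q) ∧
        Dt v' (baseChange Φ u v q) = Dx (Dx v') (baseChange Φ u v q) +
          2 * u' (baseChange Φ u v q) * Dx v' (baseChange Φ u v q))) := by
    intro q hq
    obtain ⟨k1, k2, k3⟩ := hC.Dx_v (b := fun q => 1 / Dy Y q) hA.smooth_v hv''
      (fun q hq => contDiffAt_const.div (hYs q hq)
      (hYne q hq)) hbx (fun q hq => hcomp q hq _ rfl) hq
    have kt : Dt (fun q => v' (baseChange Φ u v q)) q = 1 / Dy Y q * Dt v q := hcomp q hq _ rfl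
    have kb := hA.Dy_burgers hC hu'' heq (fun q hq => (h _ (hsrc' q hq)).Ty)
      (fun q hq => (h _ (hsrc' q hq)).Xy) hq
    have ku := hA.u_eq heq q hq
    have ha := hC.Xx_ne q hq
    have hY0 := hYne q hq
    rw [hC.Dt_comp hv'' hq, k1] at kt
    rw [← hA.Dy_Y hq] at kb
    change _ = _ * Dy Y q at kb
    rw [first_equation_iff (hA.smooth_u q hq), first_equation_iff (hu'' _ (hex q hq).1), k1, k2, k3,
      ku]
    have kt' : Dt v' (baseChange Φ u v q) = (Dt v q - Dx v q *
        Dt (fun q => (baseChange Φ u v q).2.1) q / Dx (fun q => (baseChange Φ u v q).2.1) q) /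
        (Dy Y q * Dx (fun q => (baseChange Φ u v q).2.1) q ^ 2) := by
      field_simp at kt ⊢
      linear_combination kt
    have kb' : Dy (burgers u') (baseChange Φ u v q) = Dy (burgers u) q /
        (Dy Y q * Dx (fun q => (baseChange Φ u v q).2.1) q ^ 3) := by
      field_simp at kb ⊢
      linear_combination -kb
    rw [kt', kb']
    refine and_congr ?_ ?_
    · field_simp
    · constructor <;> intro hh
      · rw [hh]
        field_simp
        ring
      · field_simp at hh
        apply mul_right_cancel₀ ha
        linear_combination hh
  constructor
  · intro hs r hr
    obtain ⟨q, hq, rfl⟩ := hsurj r hr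
    exact (key q hq).1 (hs q hq)
  · intro hs q hq
    exact (key q hq).2 (hs _ (hex q hq).1)

end BLP

/-! ### The pseudogroup, the group and the two signs. -/

namespace BLP
open Filter Topology

theorem SymAt.fderiv_apply {f : BLPSpace → BLPSpace} {P : BLPSpace} (h : SymAt f P)
    (z : BLPSpace) : (fderiv ℝ f P z).1 = (fderiv ℝ f P (0, 1, 0, 0, 0)).2.1 ^ 2 * z.1 ∧
      (fderiv ℝ f P z).2.1 = (fderiv ℝ f P (1, 0, 0, 0, 0)).2.1 * z.1 +
        (fderiv ℝ f P (0, 1, 0, 0, 0)).2.1 * z.2.1 ∧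
      (fderiv ℝ f P z).2.2.1 = (fderiv ℝ f P (0, 0, 1, 0, 0)).2.2.1 * z.2.2.1 ∧
      (fderiv ℝ f P z).2.2.2.2 = (fderiv ℝ f P (0, 0, 1, 0, 0)).2.2.2.2 * z.2.2.1 +
        z.2.2.2.2 / (fderiv ℝ f P (0, 0, 1, 0, 0)).2.2.1 := by
  obtain ⟨h1, h2, h3, h4⟩ := h.map z
  refine ⟨?_, ?_, h3, ?_⟩
  · rw [h1, h.Ty]; ring
  · rw [h2, h.Xy]; ring
  · rw [h4]
    have := h.Vv_Yy
    have hY := h.Yy_ne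
    field_simp
    linear_combination z.2.2.2.2 * this

/-- Here a, b, c, d are X_x, X_t, Y_y, V_y. In this form the condition is a matrix shape with a rule
for U, which makes stability under composition a computation. -/
theorem symAt_iff {f : BLPSpace → BLPSpace} {P : BLPSpace} : SymAt f P ↔
    ∃ a b c d : ℝ, a ≠ 0 ∧ c ≠ 0 ∧ (∀ z : BLPSpace, (fderiv ℝ f P z).1 = a ^ 2 * z.1 ∧
      (fderiv ℝ f P z).2.1 = b * z.1 + a * z.2.1 ∧ (fderiv ℝ f P z).2.2.1 = c * z.2.2.1 ∧
      (fderiv ℝ f P z).2.2.2.2 = d * z.2.2.1 + z.2.2.2.2 / c) ∧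
      (f P).2.2.2.1 = P.2.2.2.1 / a - b / (2 * a ^ 2) := by
  constructor
  · intro h
    exact ⟨_, _, _, _, h.Xx_ne, h.Yy_ne, h.fderiv_apply, h.U_eq⟩
  · rintro ⟨a, b, c, d, ha, hc, hM, hU⟩
    refine ⟨⟨⟨⟨?_, ?_, ?_, ?_, ?_, ?_, ?_, ?_⟩, ?_, ?_, ?_, ?_, ?_, ?_⟩, ?_, ?_, ?_⟩, ?_, ?_, ?_⟩ <;>
    simp [(hM _).1, (hM _).2.1, (hM _).2.2.1, (hM _).2.2.2, ha, hc, hU]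

theorem symAt_congr {f g : BLPSpace → BLPSpace} {P : BLPSpace} (h : f =ᶠ[𝓝 P] g) :
    SymAt f P ↔ SymAt g P := by
  rw [symAt_iff, symAt_iff, h.fderiv_eq, h.eq_of_nhds]

theorem symAt_id (P : BLPSpace) : SymAt id P :=
  symAt_iff.2 ⟨1, 0, 1, 0, one_ne_zero, one_ne_zero, fun z => by simp, by simp⟩

theorem SymAt.comp {f g : BLPSpace → BLPSpace} {P : BLPSpace} (hg : SymAt g (f P))
    (hf : SymAt f P) (hdg : DifferentiableAt ℝ g (f P)) (hdf : DifferentiableAt ℝ f P) :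
    SymAt (g ∘ f) P := by
  obtain ⟨a, b, c, d, ha, hc, hM, hU⟩ := symAt_iff.1 hf
  obtain ⟨a', b', c', d', ha', hc', hM', hU'⟩ := symAt_iff.1 hg
  refine symAt_iff.2 ⟨a' * a, b' * a ^ 2 + a' * b, c' * c, d' * c + d / c', mul_ne_zero ha' ha,
    mul_ne_zero hc' hc, fun z => ?_, ?_⟩
  · rw [fderiv_comp P hdg hdf]
    show (fderiv ℝ g (f P) (fderiv ℝ f P z)).1 = _ ∧
      (fderiv ℝ g (f P) (fderiv ℝ f P z)).2.1 = _ ∧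
      (fderiv ℝ g (f P) (fderiv ℝ f P z)).2.2.1 = _ ∧
      (fderiv ℝ g (f P) (fderiv ℝ f P z)).2.2.2.2 = _
    obtain ⟨h1, h2, h3, h4⟩ := hM' (fderiv ℝ f P z)
    obtain ⟨k1, k2, k3, k4⟩ := hM z
    rw [h1, h2, h3, h4, k1, k2, k3, k4]
    refine ⟨by ring, by ring, by ring, ?_⟩
    field_simp
    ring
  · rw [Function.comp_apply, hU', hU]
    field_simp
    ring

/-- X_x and Y_y are diagonal entries of a triangular derivative, hence multiplicative; the signs
inherit this. -/
theorem SymAt.comp_Xx {f g : BLPSpace → BLPSpace} {P : BLPSpace} (hg : SymAt g (f P))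
    (hf : SymAt f P) (hdg : DifferentiableAt ℝ g (f P)) (hdf : DifferentiableAt ℝ f P) :
    (fderiv ℝ (g ∘ f) P (0, 1, 0, 0, 0)).2.1 =
      (fderiv ℝ g (f P) (0, 1, 0, 0, 0)).2.1 * (fderiv ℝ f P (0, 1, 0, 0, 0)).2.1 ∧
    (fderiv ℝ (g ∘ f) P (0, 0, 1, 0, 0)).2.2.1 =
      (fderiv ℝ g (f P) (0, 0, 1, 0, 0)).2.2.1 * (fderiv ℝ f P (0, 0, 1, 0, 0)).2.2.1 := by
  obtain ⟨a, b, c, d, ha, hc, hM, hU⟩ := symAt_iff.1 hf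
  obtain ⟨a', b', c', d', ha', hc', hM', hU'⟩ := symAt_iff.1 hg
  rw [fderiv_comp P hdg hdf]
  simp only [ContinuousLinearMap.comp_apply]
  simp [(hM _).1, (hM _).2.1, (hM _).2.2.1, (hM' _).2.1, (hM' _).2.2.1]

theorem image_graphOver_symm {Φ : OpenPartialHomeomorph BLPSpace BLPSpace} {A B : Set BLPSpace}
    (hA : A ⊆ Φ.source) (h : Φ '' A = B) : B ⊆ Φ.target ∧ Φ.symm '' B = A := by
  subst h
  refine ⟨?_, ?_⟩
  · rintro _ ⟨a, ha, rfl⟩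
    exact Φ.map_source (hA ha)
  · exact Φ.symm_image_image_of_subset_source hA

/-- The definition is symmetric in the two graphs, so no structural information is needed. -/
theorem IsPointSymmetry.symm {Φ : OpenPartialHomeomorph BLPSpace BLPSpace}
    (h : IsPointSymmetry Φ) : IsPointSymmetry Φ.symm := by
  refine ⟨h.2.1, h.1, ?_⟩
  intro Ω Ω' u v u' v' hΩ hΩ' hu hv hu' hv' hsrc himg
  obtain ⟨h1, h2⟩ := image_graphOver_symm hsrc himg
  exact (h.2.2 Ω' Ω u' v' u v hΩ' hΩ hu' hv' hu hv h1 h2).symm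

/-- The definition does not compose directly, since the intermediate image of a graph need not a
priori be a graph. The pointwise characterisation avoids the question. -/
theorem IsPointSymmetry.trans {Φ Ψ : OpenPartialHomeomorph BLPSpace BLPSpace}
    (hΦ : IsPointSymmetry Φ) (hΨ : IsPointSymmetry Ψ) : IsPointSymmetry (Φ.trans Ψ) := by
  refine isPointSymmetry_of_symAt ?_ ?_ ?_
  · rw [Φ.trans_source]
    exact hΨ.1.comp (hΦ.1.mono Set.inter_subset_left) fun x hx => hx.2
  · rw [Φ.trans_target]
    exact hΦ.2.1.comp (hΨ.2.1.mono Set.inter_subset_left) fun x hx => hx.2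
  · intro P hP
    rw [Φ.trans_source] at hP
    exact (hΨ.symAt hP.2).comp (hΦ.symAt hP.1) (smooth_differentiableAt (hΨ.contDiffAt hP.2))
      (smooth_differentiableAt (hΦ.contDiffAt hP.1))

theorem isPointSymmetry_refl : IsPointSymmetry (OpenPartialHomeomorph.refl BLPSpace) :=
  isPointSymmetry_of_symAt contDiffOn_id contDiffOn_id fun P _ => symAt_id P

/-- The pseudogroup of the local point symmetries. -/
def symmetryPseudogroup : StructureGroupoid BLPSpace where
  members := {Φ | IsPointSymmetry Φ}
  trans' := fun _ _ h h' => h.trans h'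
  symm' := fun _ h => h.symm
  id_mem' := isPointSymmetry_refl
  -- Smoothness and `SymAt` are conditions at single points, so they pass from restrictions to the
  -- whole map.
  locality' := by
    intro e h
    refine isPointSymmetry_of_symAt ?_ ?_ ?_
    · intro x hx
      obtain ⟨s, hs, hxs, he⟩ := h x hx
      have hx' : x ∈ (e.restr s).source := by
        rw [e.restr_source, hs.interior_eq]; exact ⟨hx, hxs⟩
      exact (IsPointSymmetry.contDiffAt he hx').contDiffWithinAt
    · intro y hy
      obtain ⟨s, hs, hxs, he⟩ := h _ (e.map_target hy)
      have hx' : e.symm y ∈ (e.restr s).source := by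
        rw [e.restr_source, hs.interior_eq]; exact ⟨e.map_target hy, hxs⟩
      have hy' : y ∈ (e.restr s).symm.source := by
        have := (e.restr s).map_source hx'
        rw [e.restr_apply, e.right_inv hy] at this
        exact this
      exact (IsPointSymmetry.contDiffAt (IsPointSymmetry.symm he) hy').contDiffWithinAt
    · intro P hP
      obtain ⟨s, hs, hxs, he⟩ := h P hP
      have hx' : P ∈ (e.restr s).source := by
        rw [e.restr_source, hs.interior_eq]; exact ⟨hP, hxs⟩
      exact IsPointSymmetry.symAt he hx'
  mem_of_eqOnSource' := by
    intro e e' he hee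
    refine isPointSymmetry_of_symAt ?_ ?_ ?_
    · rw [hee.1]
      exact he.1.congr fun x hx => hee.2 (by rw [hee.1]; exact hx)
    · have h2 := OpenPartialHomeomorph.EqOnSource.symm' hee
      rw [hee.target_eq]
      exact he.2.1.congr fun x hx => h2.2 (by rw [h2.1]; exact hx)
    · intro P hP
      have hev : (e' : BLPSpace → BLPSpace) =ᶠ[𝓝 P] e := by
        filter_upwards [e'.open_source.mem_nhds hP] with Q hQ using hee.2 hQ
      rw [symAt_congr hev]
      exact he.symAt (hee.1 ▸ hP)

theorem Diffeo.isPointSymmetry_iff (Φ : Diffeo) :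
    IsPointSymmetry (Φ : BLPSpace ≃ₜ BLPSpace).toOpenPartialHomeomorph ↔
      ∀ P, SymAt (Φ : BLPSpace ≃ₜ BLPSpace) P :=
  ⟨fun h P => h.symAt (Set.mem_univ P), fun h =>
    isPointSymmetry_of_symAt Φ.2.1.contDiffOn Φ.2.2.contDiffOn fun P _ => h P⟩

/-- The group of the point symmetries that are diffeomorphisms of the whole space. -/
def symmetryGroup : Subgroup Diffeo where
  carrier := {Φ | IsPointSymmetry (Φ : BLPSpace ≃ₜ BLPSpace).toOpenPartialHomeomorph}
  one_mem' := (Diffeo.isPointSymmetry_iff 1).2 symAt_id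
  mul_mem' := by
    intro Φ Ψ hΦ hΨ
    rw [Set.mem_ofPred_eq, Diffeo.isPointSymmetry_iff] at *
    intro P
    exact (hΦ _).comp (hΨ P) (Φ.2.1.differentiable (by simp) _) (Ψ.2.1.differentiable (by simp) _)
  inv_mem' := fun h => IsPointSymmetry.symm h

theorem mem_symmetryGroup {Φ : Diffeo} :
    Φ ∈ symmetryGroup ↔ ∀ P, SymAt (Φ : BLPSpace ≃ₜ BLPSpace) P := Diffeo.isPointSymmetry_iff Φ

/-- The sign of a nonzero real number as an element of the group with two elements. -/
noncomputable def signClass (x : ℝ) : Multiplicative (ZMod 2) :=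
  if 0 < x then 1 else Multiplicative.ofAdd 1

theorem signClass_eq_one {x : ℝ} : signClass x = 1 ↔ 0 < x := by
  unfold signClass
  split_ifs with h
  · simp [h]
  · simp only [h, iff_false]; decide

theorem signClass_mul {x y : ℝ} (hx : x ≠ 0) (hy : y ≠ 0) :
    signClass (x * y) = signClass x * signClass y := by
  unfold signClass
  rcases lt_or_gt_of_ne hx with h1 | h1 <;> rcases lt_or_gt_of_ne hy with h2 | h2
  · rw [if_pos (mul_pos_of_neg_of_neg h1 h2), if_neg h1.not_gt, if_neg h2.not_gt]; decide
  · rw [if_neg (mul_neg_of_neg_of_pos h1 h2).not_gt, if_neg h1.not_gt, if_pos h2, mul_one]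
  · rw [if_neg (mul_neg_of_pos_of_neg h1 h2).not_gt, if_pos h1, if_neg h2.not_gt, one_mul]
  · rw [if_pos (mul_pos h1 h2), if_pos h1, if_pos h2, mul_one]

theorem exists_signClass (a : Multiplicative (ZMod 2)) : ∃ ε : ℝ, (ε = 1 ∨ ε = -1) ∧
    signClass ε = a := by
  by_cases h : a = 1
  · exact ⟨1, Or.inl rfl, by rw [h, signClass_eq_one]; exact one_pos⟩
  · refine ⟨-1, Or.inr rfl, ?_⟩
    rw [signClass, if_neg (by norm_num)]
    revert h; revert a; decide

/-- The pair of the signs of `X_x` and `Y_y`. -/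
noncomputable def signs (f : BLPSpace → BLPSpace) (P : BLPSpace) :
    Multiplicative (ZMod 2) × Multiplicative (ZMod 2) :=
  (signClass (fderiv ℝ f P (0, 1, 0, 0, 0)).2.1, signClass (fderiv ℝ f P (0, 0, 1, 0, 0)).2.2.1)

theorem signs_comp {f g : BLPSpace → BLPSpace} {P : BLPSpace} (hg : SymAt g (f P))
    (hf : SymAt f P) (hdg : DifferentiableAt ℝ g (f P)) (hdf : DifferentiableAt ℝ f P) :
    signs (g ∘ f) P = signs g (f P) * signs f P := by
  obtain ⟨h1, h2⟩ := hg.comp_Xx hf hdg hdf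
  unfold signs
  rw [h1, h2, signClass_mul hg.Xx_ne hf.Xx_ne, signClass_mul hg.Yy_ne hf.Yy_ne]
  rfl

theorem signs_eq_one {f : BLPSpace → BLPSpace} {P : BLPSpace} : signs f P = 1 ↔
    0 < (fderiv ℝ f P (0, 1, 0, 0, 0)).2.1 ∧ 0 < (fderiv ℝ f P (0, 0, 1, 0, 0)).2.2.1 := by
  rw [← signClass_eq_one, ← signClass_eq_one, signs, Prod.mk_eq_one]

end BLP

/-! ### Explicit symmetries of the whole space and their deformation to the identity. -/

namespace BLP
open Filter Topology

/-- A strictly increasing smooth function on the line without horizontal asymptotes. -/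
theorem exists_homeomorph_of_deriv_pos {f f' : ℝ → ℝ} (hf : ∀ x, HasDerivAt f (f' x) x)
    (hpos : ∀ x, 0 < f' x) (htop : Tendsto f atTop atTop) (hbot : Tendsto f atBot atBot) :
    ∃ e : ℝ ≃ₜ ℝ, ⇑e = f := by
  have hmono : StrictMono f := strictMono_of_deriv_pos fun x => by rw [(hf x).deriv]; exact hpos x
  have hcont : Continuous f := continuous_iff_continuousAt.2 fun x => (hf x).continuousAt
  exact ⟨(hmono.orderIsoOfSurjective f (hcont.surjective htop hbot)).toHomeomorph, rfl⟩

/-- An increasing homeomorphism of the line is an order isomorphism, hence unbounded in both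
directions. This property survives convex combination with the identity. -/
theorem tendsto_of_deriv_pos {e : ℝ ≃ₜ ℝ} {f' : ℝ → ℝ} (hf : ∀ x, HasDerivAt e (f' x) x)
    (hpos : ∀ x, 0 < f' x) : Tendsto e atTop atTop ∧ Tendsto e atBot atBot := by
  have hmono : StrictMono e := strictMono_of_deriv_pos fun x => by rw [(hf x).deriv]; exact hpos x
  set o := hmono.orderIsoOfSurjective e e.surjective
  exact ⟨o.tendsto_atTop, o.tendsto_atBot⟩

/-- The parameters of a symmetry transformation of the whole space. -/
structure Parameters where
  T : ℝ ≃ₜ ℝ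
  Y : ℝ ≃ₜ ℝ
  a : ℝ → ℝ
  a' : ℝ → ℝ
  b : ℝ → ℝ
  b' : ℝ → ℝ
  c : ℝ → ℝ
  d : ℝ → ℝ
  hT : ∀ t, HasDerivAt T (a t ^ 2) t
  ha : ∀ t, HasDerivAt a (a' t) t
  hb : ∀ t, HasDerivAt b (b' t) t
  hY : ∀ y, HasDerivAt Y (c y) y
  smooth_a : ContDiff ℝ ∞ a
  smooth_b : ContDiff ℝ ∞ b
  smooth_c : ContDiff ℝ ∞ c
  smooth_d : ContDiff ℝ ∞ d
  a_ne : ∀ t, a t ≠ 0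
  c_ne : ∀ y, c y ≠ 0

theorem contDiff_of_hasDerivAt {f f' : ℝ → ℝ} (h : ∀ x, HasDerivAt f (f' x) x)
    (hf' : ContDiff ℝ ∞ f') : ContDiff ℝ ∞ f :=
  contDiff_infty_iff_deriv.2 ⟨fun x => (h x).differentiableAt, by
    rwa [show deriv f = f' from funext fun x => (h x).deriv]⟩

theorem contDiff_hasDerivAt {f f' : ℝ → ℝ} (h : ∀ x, HasDerivAt f (f' x) x)
    (hf : ContDiff ℝ ∞ f) : ContDiff ℝ ∞ f' := by
  rw [← show deriv f = f' from funext fun x => (h x).deriv]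
  exact (contDiff_infty_iff_deriv.1 hf).2

/-- The explicit form of the symmetry transformations. -/
noncomputable def symmetryMap (T Y a a' b b' c d : ℝ → ℝ) (P : BLPSpace) : BLPSpace :=
  (T P.1, a P.1 * P.2.1 + b P.1, Y P.2.2.1,
    P.2.2.2.1 / a P.1 - (a' P.1 * P.2.1 + b' P.1) / (2 * a P.1 ^ 2),
    P.2.2.2.2 / c P.2.2.1 + d P.2.2.1)

namespace Parameters

variable (D : Parameters)

theorem smooth_T : ContDiff ℝ ∞ D.T := contDiff_of_hasDerivAt D.hT (D.smooth_a.pow 2)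

theorem smooth_Y : ContDiff ℝ ∞ D.Y := contDiff_of_hasDerivAt D.hY D.smooth_c

theorem smooth_a' : ContDiff ℝ ∞ D.a' := contDiff_hasDerivAt D.ha D.smooth_a

theorem smooth_b' : ContDiff ℝ ∞ D.b' := contDiff_hasDerivAt D.hb D.smooth_b

/-- The transformation with the given parameters. -/
noncomputable def map : BLPSpace → BLPSpace := symmetryMap D.T D.Y D.a D.a' D.b D.b' D.c D.d

/-- The inverse of the transformation with the given parameters. -/
noncomputable def inv (P : BLPSpace) : BLPSpace :=
  (D.T.symm P.1, (P.2.1 - D.b (D.T.symm P.1)) / D.a (D.T.symm P.1), D.Y.symm P.2.2.1,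
    D.a (D.T.symm P.1) * (P.2.2.2.1 + (D.a' (D.T.symm P.1) *
      ((P.2.1 - D.b (D.T.symm P.1)) / D.a (D.T.symm P.1)) + D.b' (D.T.symm P.1)) /
        (2 * D.a (D.T.symm P.1) ^ 2)),
    D.c (D.Y.symm P.2.2.1) * (P.2.2.2.2 - D.d (D.Y.symm P.2.2.1)))

theorem smooth_map : ContDiff ℝ ∞ D.map := by
  have h1 := D.smooth_T
  have h2 := D.smooth_Y
  have h3 := D.smooth_a
  have h4 := D.smooth_a'
  have h5 := D.smooth_b
  have h6 := D.smooth_b'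
  have h7 := D.smooth_c
  have h8 := D.smooth_d
  have h9 := D.a_ne
  have h10 := D.c_ne
  unfold map symmetryMap
  refine ContDiff.prodMk (by fun_prop) (ContDiff.prodMk (by fun_prop) (ContDiff.prodMk (by fun_prop)
    (ContDiff.prodMk ?_ ?_)))
  · exact ContDiff.sub (ContDiff.div (by fun_prop) (by fun_prop) fun x => h9 _)
      (ContDiff.div (by fun_prop) (by fun_prop)
        fun x => mul_ne_zero two_ne_zero (pow_ne_zero 2 (h9 _)))
  · exact ContDiff.add (ContDiff.div (by fun_prop) (by fun_prop) fun x => h10 _) (by fun_prop)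

theorem smooth_inv : ContDiff ℝ ∞ D.inv := by
  have h1 := D.T.contDiff_symm_deriv (fun t => pow_ne_zero 2 (D.a_ne t)) D.hT D.smooth_T
  have h2 := D.Y.contDiff_symm_deriv D.c_ne D.hY D.smooth_Y
  have h3 := D.smooth_a
  have h4 := D.smooth_a'
  have h5 := D.smooth_b
  have h6 := D.smooth_b'
  have h7 := D.smooth_c
  have h8 := D.smooth_d
  have h9 := D.a_ne
  have hx : ContDiff ℝ ∞ fun P : BLPSpace =>
      (P.2.1 - D.b (D.T.symm P.1)) / D.a (D.T.symm P.1) :=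
    ContDiff.div (by fun_prop) (by fun_prop) fun x => h9 _
  unfold inv
  refine ContDiff.prodMk (by fun_prop) (ContDiff.prodMk hx (ContDiff.prodMk (by fun_prop)
    (ContDiff.prodMk ?_ (by fun_prop))))
  exact ContDiff.mul (by fun_prop) (ContDiff.add (by fun_prop)
    (ContDiff.div (by fun_prop) (by fun_prop)
      fun x => mul_ne_zero two_ne_zero (pow_ne_zero 2 (h9 _))))

theorem inv_map (P : BLPSpace) : D.inv (D.map P) = P := by
  have ha := D.a_ne P.1
  have hc := D.c_ne P.2.2.1
  unfold inv map symmetryMap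
  simp only [Homeomorph.symm_apply_apply]
  ext
  · rfl
  · simp only; field_simp; ring
  · rfl
  · simp only; field_simp; ring
  · simp only; field_simp; ring

theorem map_inv (P : BLPSpace) : D.map (D.inv P) = P := by
  have ha := D.a_ne (D.T.symm P.1)
  have hc := D.c_ne (D.Y.symm P.2.2.1)
  unfold inv map symmetryMap
  simp only [Homeomorph.apply_symm_apply]
  ext
  · rfl
  · simp only; field_simp; ring
  · rfl
  · simp only; field_simp; ring
  · simp only; field_simp; ring

/-- The transformation with the given parameters as a diffeomorphism of the whole space. -/
noncomputable def toDiffeo : Diffeo :=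
  ⟨{ toFun := D.map
     invFun := D.inv
     left_inv := D.inv_map
     right_inv := D.map_inv
     continuous_toFun := D.smooth_map.continuous
     continuous_invFun := D.smooth_inv.continuous }, D.smooth_map, D.smooth_inv⟩

end Parameters

/-- The derivatives of the components of `symmetryMap`. -/
theorem fderiv_symmetryMap {T Y a a' b b' c d : ℝ → ℝ} {P : BLPSpace} {c1 d1 : ℝ}
    (hs : DifferentiableAt ℝ (symmetryMap T Y a a' b b' c d) P)
    (hT : HasDerivAt T (a P.1 ^ 2) P.1) (ha : HasDerivAt a (a' P.1) P.1)
    (hb : HasDerivAt b (b' P.1) P.1) (hY : HasDerivAt Y (c P.2.2.1) P.2.2.1)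
    (hc : HasDerivAt c c1 P.2.2.1) (hd : HasDerivAt d d1 P.2.2.1)
    (hc0 : c P.2.2.1 ≠ 0) (z : BLPSpace) :
    (fderiv ℝ (symmetryMap T Y a a' b b' c d) P z).1 = a P.1 ^ 2 * z.1 ∧
    (fderiv ℝ (symmetryMap T Y a a' b b' c d) P z).2.1 =
      (a' P.1 * P.2.1 + b' P.1) * z.1 + a P.1 * z.2.1 ∧
    (fderiv ℝ (symmetryMap T Y a a' b b' c d) P z).2.2.1 = c P.2.2.1 * z.2.2.1 ∧
    (fderiv ℝ (symmetryMap T Y a a' b b' c d) P z).2.2.2.2 =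
      (d1 - P.2.2.2.2 * c1 / c P.2.2.1 ^ 2) * z.2.2.1 + z.2.2.2.2 / c P.2.2.1 := by
  have k : ∀ {g : ℝ → ℝ} {g' : ℝ} (A : BLPSpace →L[ℝ] ℝ), HasDerivAt g g' (A P) →
      DifferentiableAt ℝ (fun Q : BLPSpace => g (A Q)) P ∧
      fderiv ℝ (fun Q : BLPSpace => g (A Q)) P z = g' * A z := by
    intro g g' A hg
    have := hg.comp_hasFDerivAt P A.hasFDerivAt
    exact ⟨this.differentiableAt, by
      rw [show (fun Q : BLPSpace => g (A Q)) = g ∘ A from rfl, this.fderiv]; simp⟩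
  obtain ⟨-, eT⟩ := k prT hT
  obtain ⟨da, ea⟩ := k prT ha
  obtain ⟨db, eb⟩ := k prT hb
  obtain ⟨-, eY⟩ := k prY hY
  obtain ⟨dc, ec⟩ := k prY hc
  obtain ⟨dd, ed⟩ := k prY hd
  obtain ⟨dx, ex⟩ := k prX (hasDerivAt_id _)
  obtain ⟨dv, ev⟩ := k prV (hasDerivAt_id _)
  simp only [id, one_mul] at dx ex dv ev
  refine ⟨?_, ?_, ?_, ?_⟩
  · exact (clm_fderiv prT hs z).symm.trans eT
  · refine (clm_fderiv prX hs z).symm.trans ?_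
    show fderiv ℝ (fun Q => a (prT Q) * prX Q + b (prT Q)) P z = _
    rw [fderiv_add_apply (da.fun_mul dx) db, fderiv_mul_apply da dx, ea, eb, ex]
    simp only [prT_apply, prX_apply]
    ring
  · exact (clm_fderiv prY hs z).symm.trans eY
  · refine (clm_fderiv prV hs z).symm.trans ?_
    show fderiv ℝ (fun Q => prV Q / c (prY Q) + d (prY Q)) P z = _
    rw [fderiv_add_apply (differentiableAt_div dv dc hc0) dd, fderiv_div_apply dv dc hc0, ec, ed, ev]
    simp only [prY_apply, prV_apply]
    field_simp
    ring

namespace Parameters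

variable (D : Parameters)

theorem fderiv_map (P z : BLPSpace) :
    (fderiv ℝ D.map P z).1 = D.a P.1 ^ 2 * z.1 ∧
    (fderiv ℝ D.map P z).2.1 = (D.a' P.1 * P.2.1 + D.b' P.1) * z.1 + D.a P.1 * z.2.1 ∧
    (fderiv ℝ D.map P z).2.2.1 = D.c P.2.2.1 * z.2.2.1 ∧
    (fderiv ℝ D.map P z).2.2.2.2 = (deriv D.d P.2.2.1 - P.2.2.2.2 * deriv D.c P.2.2.1 /
      D.c P.2.2.1 ^ 2) * z.2.2.1 + z.2.2.2.2 / D.c P.2.2.1 :=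
  fderiv_symmetryMap (D.smooth_map.differentiable (by simp) P) (D.hT _) (D.ha _) (D.hb _) (D.hY _)
    (D.smooth_c.differentiable (by simp) _).hasDerivAt
    (D.smooth_d.differentiable (by simp) _).hasDerivAt (D.c_ne _) z

theorem symAt (P : BLPSpace) : SymAt D.map P :=
  symAt_iff.2 ⟨_, _, _, _, D.a_ne _, D.c_ne _, D.fderiv_map P, rfl⟩

theorem toDiffeo_mem : D.toDiffeo ∈ symmetryGroup := mem_symmetryGroup.2 D.symAt

theorem signs_map (P : BLPSpace) :
    signs D.map P = (signClass (D.a P.1), signClass (D.c P.2.2.1)) := by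
  unfold signs
  rw [(D.fderiv_map P _).2.1, (D.fderiv_map P _).2.2.1]
  simp

/-- A smooth path from the identity to the transformation with given positive parameters. -/
theorem exists_path (ha : ∀ t, 0 < D.a t) (hc : ∀ y, 0 < D.c y) :
    ∃ E : ℝ → Parameters, (∀ P, (E 0).map P = P) ∧ (E 1).map = D.map ∧
      ContDiff ℝ ∞ fun p : ℝ × BLPSpace => (E p.1).map p.2 := by
  obtain ⟨hT1, hT2⟩ := tendsto_of_deriv_pos D.hT fun t => pow_pos (ha t) 2
  obtain ⟨hY1, hY2⟩ := tendsto_of_deriv_pos D.hY hc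
  -- The smooth transition keeps the weights in [0,1] for every real s, so the path is a smooth
  -- family over the whole line.
  have hθ0 := Real.smoothTransition.nonneg
  have hθ1 := Real.smoothTransition.le_one
  have hpos : ∀ s r : ℝ, 0 < r →
      0 < 1 - Real.smoothTransition s + Real.smoothTransition s * r := by
    intro s r hr
    rcases (hθ0 s).eq_or_lt with h | h
    · rw [← h]; norm_num
    · have := mul_pos h hr
      linarith [hθ1 s]
  have htend : ∀ (s : ℝ) {l : Filter ℝ} {f : ℝ → ℝ}, (l = atTop ∨ l = atBot) → Tendsto f l l →
      Tendsto (fun t => (1 - Real.smoothTransition s) * t + Real.smoothTransition s * f t) l l := by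
    intro s l f hl hf
    rcases (hθ0 s).eq_or_lt with h | h
    · simp only [← h, sub_zero, one_mul, zero_mul, add_zero]; exact tendsto_id
    rcases (hθ1 s).eq_or_lt with h1 | h1
    · simpa [h1] using hf
    have h1' : 0 < 1 - Real.smoothTransition s := by linarith
    rcases hl with rfl | rfl
    · exact (tendsto_id.const_mul_atTop h1').atTop_add_atTop (hf.const_mul_atTop h)
    · exact (tendsto_id.const_mul_atBot h1').atBot_add_atBot (hf.const_mul_atBot h)
  have hlin : ∀ (s : ℝ) {f : ℝ → ℝ} {f' t : ℝ}, HasDerivAt f f' t →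
      HasDerivAt (fun t => (1 - Real.smoothTransition s) * t + Real.smoothTransition s * f t)
        (1 - Real.smoothTransition s + Real.smoothTransition s * f') t := by
    intro s f f' t hf
    have h := ((hasDerivAt_id t).const_mul (1 - Real.smoothTransition s)).fun_add
      (hf.const_mul (Real.smoothTransition s))
    rwa [mul_one] at h
  have hsq : ∀ s t, 0 < 1 - Real.smoothTransition s + Real.smoothTransition s * D.a t ^ 2 :=
    fun s t => hpos s _ (pow_pos (ha t) 2)
  choose T hTs using fun s => exists_homeomorph_of_deriv_pos (fun t => hlin s (D.hT t)) (hsq s)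
    (htend s (Or.inl rfl) hT1) (htend s (Or.inr rfl) hT2)
  choose Y hYs using fun s => exists_homeomorph_of_deriv_pos (fun t => hlin s (D.hY t))
    (fun y => hpos s _ (hc y)) (htend s (Or.inl rfl) hY1) (htend s (Or.inr rfl) hY2)
  have s3 := D.smooth_a
  have s5 := D.smooth_b
  have s7 := D.smooth_c
  have s8 := D.smooth_d
  -- T and Y are interpolated linearly with the identity. The relation T' = a² then forces a to be
  -- the square root of the interpolated derivative; it returns to the given a at s = 1 because a >
  -- 0.
  let E : ℝ → Parameters := fun s =>
    { T := T s
      Y := Y s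
      a := fun t => √(1 - Real.smoothTransition s + Real.smoothTransition s * D.a t ^ 2)
      a' := fun t => Real.smoothTransition s * D.a t * D.a' t /
        √(1 - Real.smoothTransition s + Real.smoothTransition s * D.a t ^ 2)
      b := fun t => Real.smoothTransition s * D.b t
      b' := fun t => Real.smoothTransition s * D.b' t
      c := fun y => 1 - Real.smoothTransition s + Real.smoothTransition s * D.c y
      d := fun y => Real.smoothTransition s * D.d y
      hT := fun t => by
        rw [hTs, Real.sq_sqrt (hsq s t).le]
        exact hlin s (D.hT t)
      ha := fun t => by
        have h1 := ((((D.ha t).fun_pow 2).const_mul (Real.smoothTransition s)).const_add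
          (1 - Real.smoothTransition s)).sqrt (hsq s t).ne'
        convert h1 using 1
        have := (Real.sqrt_pos.2 (hsq s t)).ne'
        push_cast
        field_simp
      hb := fun t => (D.hb t).const_mul _
      hY := fun y => by rw [hYs]; exact hlin s (D.hY y)
      smooth_a := ContDiff.sqrt (by fun_prop) fun t => (hsq s t).ne'
      smooth_b := by fun_prop
      smooth_c := by fun_prop
      smooth_d := by fun_prop
      a_ne := fun t => (Real.sqrt_pos.2 (hsq s t)).ne'
      c_ne := fun y => (hpos s _ (hc y)).ne' }
  refine ⟨E, fun P => ?_, ?_, ?_⟩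
  · simp [map, symmetryMap, E, hTs, hYs]
  · funext P
    have h := Real.sqrt_sq (ha P.1).le
    have h0 := D.a_ne P.1
    simp only [map, symmetryMap, E, hTs, hYs, Real.smoothTransition.one, sub_self, zero_mul, one_mul,
      zero_add, h]
    congr 4
    field_simp
  · have hθ : ContDiff ℝ ∞ Real.smoothTransition := Real.smoothTransition.contDiff
    have s1 := D.smooth_T
    have s2 := D.smooth_Y
    have s4 := D.smooth_a'
    have s6 := D.smooth_b'
    have hsqrt : ContDiff ℝ ∞ fun p : ℝ × BLPSpace =>
        √(1 - Real.smoothTransition p.1 + Real.smoothTransition p.1 * D.a p.2.1 ^ 2) :=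
      ContDiff.sqrt (by fun_prop) fun p => (hsq p.1 p.2.1).ne'
    have hsne : ∀ p : ℝ × BLPSpace,
        √(1 - Real.smoothTransition p.1 + Real.smoothTransition p.1 * D.a p.2.1 ^ 2) ≠ 0 :=
      fun p => (Real.sqrt_pos.2 (hsq p.1 p.2.1)).ne'
    simp only [map, symmetryMap, E, hTs, hYs]
    refine ContDiff.prodMk (by fun_prop) (ContDiff.prodMk ?_ (ContDiff.prodMk (by fun_prop)
      (ContDiff.prodMk ?_ ?_)))
    · exact ContDiff.add (ContDiff.mul hsqrt (by fun_prop)) (by fun_prop)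
    · refine ContDiff.sub (ContDiff.div (by fun_prop) hsqrt hsne) (ContDiff.div (ContDiff.add
        (ContDiff.mul (ContDiff.div (by fun_prop) hsqrt hsne) (by fun_prop)) (by fun_prop))
        (contDiff_const.mul (hsqrt.pow 2)) fun p => mul_ne_zero two_ne_zero (pow_ne_zero 2 (hsne p)))
    · exact ContDiff.add (ContDiff.div (by fun_prop) (by fun_prop)
        fun p => (hpos _ _ (hc _)).ne') (by fun_prop)

end Parameters

end BLP

/-! ### Integration of the infinitesimal conditions. -/

namespace BLP
open Filter Topology

/-- Mean value theorem on the segment: only the derivative in the direction Q - P matters. It shows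
that a component depends on a single coordinate. -/
theorem eq_of_fderiv_sub_eq_zero {g : BLPSpace → ℝ} {S : Set BLPSpace} (hconv : Convex ℝ S)
    (hg : ∀ R ∈ S, DifferentiableAt ℝ g R) {P Q : BLPSpace} (hP : P ∈ S) (hQ : Q ∈ S)
    (h : ∀ R ∈ S, fderiv ℝ g R (Q - P) = 0) : g P = g Q := by
  obtain ⟨z, hz, hzz⟩ := domain_mvt (fun R hR => (hg R hR).hasFDerivAt.hasFDerivWithinAt) hconv hP hQ
  rw [h z (hconv.segment_subset hP hQ hz)] at hzz
  linarith

/-- A continuous function without zeros keeps its sign on a connected set, so its square determines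
it. -/
theorem eq_of_sq_eq_of_ne_zero {g : BLPSpace → ℝ} {S : Set BLPSpace} (hS : IsPreconnected S)
    (hg : ContinuousOn g S) (h0 : ∀ R ∈ S, g R ≠ 0) {P Q : BLPSpace} (hP : P ∈ S) (hQ : Q ∈ S)
    (h : g P ^ 2 = g Q ^ 2) : g P = g Q := by
  rcases sq_eq_sq_iff_eq_or_eq_neg.1 h with h | h
  · exact h
  · exfalso
    rcases le_total (g P) 0 with h1 | h1
    · obtain ⟨R, hR, hR0⟩ := hS.intermediate_value hP hQ hg ⟨h1, by linarith⟩
      exact h0 R hR hR0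
    · obtain ⟨R, hR, hR0⟩ := hS.intermediate_value hQ hP hg ⟨by linarith, h1⟩
      exact h0 R hR hR0

/-- A map satisfying the infinitesimal conditions on a convex open set has the explicit form
`symmetryMap` there. -/
theorem exists_symmetryMap {f : BLPSpace → BLPSpace} {S : Set BLPSpace} (hS : IsOpen S)
    (hconv : Convex ℝ S) (hf : ∀ P ∈ S, ContDiffAt ℝ ∞ f P) (hsym : ∀ P ∈ S, SymAt f P)
    (t0 x0 y0 u0 v0 : ℝ) (hpr1 : ∀ P ∈ S, ((P.1, x0, y0, u0, v0) : BLPSpace) ∈ S)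
    (hpr2 : ∀ P ∈ S, ((t0, x0, P.2.2.1, u0, v0) : BLPSpace) ∈ S) :
    ∃ T Y a a' b b' c d : ℝ → ℝ, (∀ P ∈ S, f P = symmetryMap T Y a a' b b' c d P) ∧
      (∀ P ∈ S, ContDiffAt ℝ ∞ a P.1 ∧ ContDiffAt ℝ ∞ b P.1 ∧ ContDiffAt ℝ ∞ c P.2.2.1 ∧
        ContDiffAt ℝ ∞ d P.2.2.1) ∧
      (∀ P ∈ S, HasDerivAt T (a P.1 ^ 2) P.1 ∧ HasDerivAt a (a' P.1) P.1 ∧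
        HasDerivAt b (b' P.1) P.1 ∧ HasDerivAt Y (c P.2.2.1) P.2.2.1) ∧
      ∀ P ∈ S, a P.1 = (fderiv ℝ f P (0, 1, 0, 0, 0)).2.1 ∧
        c P.2.2.1 = (fderiv ℝ f P (0, 0, 1, 0, 0)).2.2.1 := by
  -- The functions of one variable are read off along the t-line and the y-line through the base
  -- point; `hpr1` and `hpr2` keep these projections inside `S`.
  set l1 : ℝ → BLPSpace := fun t => (t, x0, y0, u0, v0) with hl1
  set l2 : ℝ → BLPSpace := fun y => (t0, x0, y, u0, v0) with hl2
  have hl1d : ∀ t, HasDerivAt l1 (1, 0, 0, 0, 0) t := fun t =>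
    (hasDerivAt_id t).prodMk ((hasDerivAt_const t x0).prodMk ((hasDerivAt_const t y0).prodMk
      ((hasDerivAt_const t u0).prodMk (hasDerivAt_const t v0))))
  have hl2d : ∀ t, HasDerivAt l2 (0, 0, 1, 0, 0) t := fun t =>
    (hasDerivAt_const t t0).prodMk ((hasDerivAt_const t x0).prodMk ((hasDerivAt_id t).prodMk
      ((hasDerivAt_const t u0).prodMk (hasDerivAt_const t v0))))
  have hl1s : ContDiff ℝ ∞ l1 := by rw [hl1]; fun_prop
  have hl2s : ContDiff ℝ ∞ l2 := by rw [hl2]; fun_prop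
  set a : ℝ → ℝ := fun t => prX (fderiv ℝ f (l1 t) (0, 1, 0, 0, 0)) with ha
  set c : ℝ → ℝ := fun y => prY (fderiv ℝ f (l2 y) (0, 0, 1, 0, 0)) with hc
  set b : ℝ → ℝ := fun t => prX (f (l1 t)) - a t * x0 with hb
  set d : ℝ → ℝ := fun y => prV (f (l2 y)) - v0 / c y with hd
  have hA : ∀ (pr : BLPSpace →L[ℝ] ℝ), ∀ R ∈ S, ContDiffAt ℝ ∞ (fun P => pr (f P)) R := fun pr R hR =>
    pr.contDiff.contDiffAt.comp R (hf R hR)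
  have hfd : ∀ (pr : BLPSpace →L[ℝ] ℝ), ∀ R ∈ S, ∀ w,
      fderiv ℝ (fun P => pr (f P)) R w = pr (fderiv ℝ f R w) := fun pr R hR w =>
    clm_fderiv pr (smooth_differentiableAt (hf R hR)) w
  have hasm : ∀ P ∈ S, ContDiffAt ℝ ∞ a P.1 := fun P hP =>
    prX.contDiff.contDiffAt.comp P.1
      (ContDiffAt.comp (g := fun R => fderiv ℝ f R (0, 1, 0, 0, 0)) P.1
        (contDiffAt_fderiv_apply (hf _ (hpr1 P hP)) _) hl1s.contDiffAt)
  have hcsm : ∀ P ∈ S, ContDiffAt ℝ ∞ c P.2.2.1 := fun P hP =>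
    prY.contDiff.contDiffAt.comp P.2.2.1
      (ContDiffAt.comp (g := fun R => fderiv ℝ f R (0, 0, 1, 0, 0)) P.2.2.1
        (contDiffAt_fderiv_apply (hf _ (hpr2 P hP)) _) hl2s.contDiffAt)
  have hcne : ∀ P ∈ S, c P.2.2.1 ≠ 0 := fun P hP => (hsym _ (hpr2 P hP)).Yy_ne
  have hbsm : ∀ P ∈ S, ContDiffAt ℝ ∞ b P.1 := fun P hP =>
    (prX.contDiff.contDiffAt.comp P.1 ((hf _ (hpr1 P hP)).comp P.1 hl1s.contDiffAt)).sub
      ((hasm P hP).mul contDiffAt_const)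
  have hdsm : ∀ P ∈ S, ContDiffAt ℝ ∞ d P.2.2.1 := fun P hP =>
    (prV.contDiff.contDiffAt.comp P.2.2.1 ((hf _ (hpr2 P hP)).comp P.2.2.1 hl2s.contDiffAt)).sub
      (contDiffAt_const.div (hcsm P hP) (hcne P hP))
  have hlift1 : ∀ {g : ℝ → ℝ} {P z : BLPSpace}, DifferentiableAt ℝ g P.1 →
      DifferentiableAt ℝ (fun Q : BLPSpace => g Q.1) P ∧
      fderiv ℝ (fun Q : BLPSpace => g Q.1) P z = deriv g P.1 * z.1 := by
    intro g P z hg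
    have h := hg.hasDerivAt.comp_hasFDerivAt P prT.hasFDerivAt
    exact ⟨h.differentiableAt, congrArg (fun A : BLPSpace →L[ℝ] ℝ => A z) h.fderiv⟩
  have hlift3 : ∀ {g : ℝ → ℝ} {P z : BLPSpace}, DifferentiableAt ℝ g P.2.2.1 →
      DifferentiableAt ℝ (fun Q : BLPSpace => g Q.2.2.1) P ∧
      fderiv ℝ (fun Q : BLPSpace => g Q.2.2.1) P z = deriv g P.2.2.1 * z.2.2.1 := by
    intro g P z hg
    have h := hg.hasDerivAt.comp_hasFDerivAt P prY.hasFDerivAt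
    exact ⟨h.differentiableAt, congrArg (fun A : BLPSpace →L[ℝ] ℝ => A z) h.fderiv⟩
  have hx : ∀ (P z : BLPSpace), fderiv ℝ (fun Q : BLPSpace => Q.2.1) P z = z.2.1 := fun P z =>
    congrArg (fun A : BLPSpace →L[ℝ] ℝ => A z) (prX.hasFDerivAt (x := P)).fderiv
  have hv : ∀ (P z : BLPSpace), fderiv ℝ (fun Q : BLPSpace => Q.2.2.2.2) P z = z.2.2.2.2 := fun P z =>
    congrArg (fun A : BLPSpace →L[ℝ] ℝ => A z) (prV.hasFDerivAt (x := P)).fderiv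
  have hTz : ∀ R ∈ S, ∀ w : BLPSpace, w.1 = 0 → fderiv ℝ (fun P => prT (f P)) R w = 0 := by
    intro R hR w hw
    rw [hfd prT R hR, prT_apply, ((hsym R hR).fderiv_apply w).1, hw, mul_zero]
  have hYz : ∀ R ∈ S, ∀ w : BLPSpace, w.2.2.1 = 0 → fderiv ℝ (fun P => prY (f P)) R w = 0 := by
    intro R hR w hw
    rw [hfd prY R hR, prY_apply, ((hsym R hR).fderiv_apply w).2.2.1, hw, mul_zero]
  have hT : ∀ P ∈ S, prT (f P) = prT (f (l1 P.1)) := fun P hP =>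
    eq_of_fderiv_sub_eq_zero hconv (fun R hR => smooth_differentiableAt (hA prT R hR)) hP (hpr1 P hP)
      fun R hR => hTz R hR _ (sub_self _)
  have hY : ∀ P ∈ S, prY (f P) = prY (f (l2 P.2.2.1)) := fun P hP =>
    eq_of_fderiv_sub_eq_zero hconv (fun R hR => smooth_differentiableAt (hA prY R hR)) hP (hpr2 P hP)
      fun R hR => hYz R hR _ (sub_self _)
  have hsq : ∀ P ∈ S, prX (fderiv ℝ f P (0, 1, 0, 0, 0)) ^ 2 =
      fderiv ℝ (fun P => prT (f P)) P (1, 0, 0, 0, 0) := by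
    intro P hP
    rw [hfd prT P hP, prT_apply, ((hsym P hP).fderiv_apply _).1]
    simp [prX_apply]
  -- T_t = X_x² depends on t alone; connectedness of `S` transfers this from the square to X_x
  -- itself.
  have ha_eq : ∀ P ∈ S, a P.1 = (fderiv ℝ f P (0, 1, 0, 0, 0)).2.1 := by
    intro P hP
    refine eq_of_sq_eq_of_ne_zero (g := fun R => prX (fderiv ℝ f R (0, 1, 0, 0, 0)))
      hconv.isPreconnected (fun R hR => ((prX.contDiff.contDiffAt.comp R
        (contDiffAt_fderiv_apply (hf R hR) _)).continuousAt).continuousWithinAt)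
      (fun R hR => (hsym R hR).Xx_ne) (hpr1 P hP) hP ?_
    rw [hsq _ hP, hsq _ (hpr1 P hP)]
    exact (eq_of_fderiv_sub_eq_zero (g := fun R => fderiv ℝ (fun P => prT (f P)) R (1, 0, 0, 0, 0))
      hconv (fun R hR => smooth_differentiableAt (contDiffAt_fderiv_apply (hA prT R hR) _))
      hP (hpr1 P hP) fun R hR => fderiv_fderiv_eq_zero_of_indep hS (hA prT)
        (fun Q hQ => hTz Q hQ _ (sub_self _)) _ R hR).symm
  have hc_eq : ∀ P ∈ S, c P.2.2.1 = (fderiv ℝ f P (0, 0, 1, 0, 0)).2.2.1 := by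
    intro P hP
    have h := (eq_of_fderiv_sub_eq_zero
      (g := fun R => fderiv ℝ (fun P => prY (f P)) R (0, 0, 1, 0, 0))
      hconv (fun R hR => smooth_differentiableAt (contDiffAt_fderiv_apply (hA prY R hR) _))
      hP (hpr2 P hP) fun R hR => fderiv_fderiv_eq_zero_of_indep hS (hA prY)
        (fun Q hQ => hYz Q hQ _ (sub_self _)) _ R hR).symm
    rw [hfd prY P hP, hfd prY _ (hpr2 P hP)] at h
    exact h
  have hX : ∀ P ∈ S, prX (f P) = a P.1 * P.2.1 + b P.1 := by
    intro P hP
    have h := eq_of_fderiv_sub_eq_zero (g := fun R => prX (f R) - a R.1 * R.2.1) hconv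
      (fun R hR => (smooth_differentiableAt (hA prX R hR)).fun_sub
        ((hlift1 (z := 0) (smooth_differentiableAt (hasm R hR))).1.fun_mul (by fun_prop)))
      hP (hpr1 P hP) (fun R hR => by
        obtain ⟨e1, e2⟩ := hlift1 (z := (P.1, x0, y0, u0, v0) - P)
          (smooth_differentiableAt (hasm R hR))
        have dx : DifferentiableAt ℝ (fun Q : BLPSpace => Q.2.1) R := by fun_prop
        rw [fderiv_sub_apply (smooth_differentiableAt (hA prX R hR)) (e1.fun_mul dx),
          fderiv_mul_apply e1 dx, e2, hx, hfd prX R hR, prX_apply, ((hsym R hR).fderiv_apply _).2.1,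
          ha_eq R hR]
        simp)
    simp only at h
    rw [hb]
    simp only [hl1]
    linarith
  have hV : ∀ P ∈ S, prV (f P) = P.2.2.2.2 / c P.2.2.1 + d P.2.2.1 := by
    intro P hP
    have h := eq_of_fderiv_sub_eq_zero (g := fun R => prV (f R) - R.2.2.2.2 / c R.2.2.1) hconv
      (fun R hR => (smooth_differentiableAt (hA prV R hR)).fun_sub
        (differentiableAt_div (by fun_prop)
          (hlift3 (z := 0) (smooth_differentiableAt (hcsm R hR))).1 (hcne R hR)))
      hP (hpr2 P hP) (fun R hR => by
        obtain ⟨e1, e2⟩ := hlift3 (z := (t0, x0, P.2.2.1, u0, v0) - P)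
          (smooth_differentiableAt (hcsm R hR))
        have dx : DifferentiableAt ℝ (fun Q : BLPSpace => Q.2.2.2.2) R := by fun_prop
        rw [fderiv_sub_apply (smooth_differentiableAt (hA prV R hR))
          (differentiableAt_div dx e1 (hcne R hR)),
          fderiv_div_apply dx e1 (hcne R hR), e2, hv, hfd prV R hR, prV_apply,
          ((hsym R hR).fderiv_apply _).2.2.2, ← hc_eq R hR]
        have := hcne R hR
        simp
        field_simp
        ring)
    simp only at h
    rw [hd]
    simp only [hl2]
    linarith
  have hUt : ∀ P ∈ S, (fderiv ℝ f P (1, 0, 0, 0, 0)).2.1 = deriv a P.1 * P.2.1 + deriv b P.1 := by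
    intro P hP
    obtain ⟨e1, e2⟩ := hlift1 (z := (1, 0, 0, 0, 0)) (smooth_differentiableAt (hasm P hP))
    obtain ⟨e3, e4⟩ := hlift1 (z := (1, 0, 0, 0, 0)) (smooth_differentiableAt (hbsm P hP))
    have dx : DifferentiableAt ℝ (fun Q : BLPSpace => Q.2.1) P := by fun_prop
    have hev : (fun P => prX (f P)) =ᶠ[𝓝 P] fun P => a P.1 * P.2.1 + b P.1 := by
      filter_upwards [hS.mem_nhds hP] with Q hQ using hX Q hQ
    have h := hfd prX P hP (1, 0, 0, 0, 0)
    rw [hev.fderiv_eq, fderiv_add_apply (e1.fun_mul dx) e3, fderiv_mul_apply e1 dx, e2, e4, hx,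
      prX_apply] at h
    rw [← h]
    simp
  refine ⟨fun t => prT (f (l1 t)), fun y => prY (f (l2 y)), a, deriv a, b, deriv b, c, d, ?_,
    fun P hP => ⟨hasm P hP, hbsm P hP, hcsm P hP, hdsm P hP⟩, ?_,
    fun P hP => ⟨ha_eq P hP, hc_eq P hP⟩⟩
  · intro P hP
    refine Prod.ext (hT P hP) (Prod.ext (hX P hP) (Prod.ext (hY P hP) (Prod.ext ?_ (hV P hP))))
    show (f P).2.2.2.1 = P.2.2.2.1 / a P.1 - (deriv a P.1 * P.2.1 + deriv b P.1) / (2 * a P.1 ^ 2)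
    rw [(hsym P hP).U_eq, hUt P hP, ha_eq P hP]
  · intro P hP
    refine ⟨?_, (smooth_differentiableAt (hasm P hP)).hasDerivAt,
      (smooth_differentiableAt (hbsm P hP)).hasDerivAt, ?_⟩
    · have h := prT.hasFDerivAt.comp_hasDerivAt P.1
        ((smooth_differentiableAt (hf _ (hpr1 P hP))).hasFDerivAt.comp_hasDerivAt P.1 (hl1d P.1))
      rw [prT_apply, ((hsym _ (hpr1 P hP)).fderiv_apply _).1, mul_one] at h
      exact h
    · exact prY.hasFDerivAt.comp_hasDerivAt P.2.2.1
        ((smooth_differentiableAt (hf _ (hpr2 P hP))).hasFDerivAt.comp_hasDerivAt P.2.2.1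
          (hl2d P.2.2.1))

end BLP

/-! ### Global form of symmetries with positive signs and extension of germs. -/

namespace BLP
open Filter Topology

theorem pos_iff_pos_of_isPreconnected {α : Type*} [TopologicalSpace α] {g : α → ℝ} {S : Set α}
    (hS : IsPreconnected S) (hg : ContinuousOn g S) (h0 : ∀ R ∈ S, g R ≠ 0) {P Q : α} (hP : P ∈ S)
    (hQ : Q ∈ S) : 0 < g P ↔ 0 < g Q := by
  have key : ∀ P ∈ S, ∀ Q ∈ S, 0 < g P → 0 < g Q := by
    intro P hP Q hQ h
    by_contra hn
    obtain ⟨R, hR, hR0⟩ := hS.intermediate_value hQ hP hg ⟨not_lt.1 hn, h.le⟩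
    exact h0 R hR hR0
  exact ⟨key P hP Q hQ, key Q hQ P hP⟩

theorem signs_pos_of_isPreconnected {f : BLPSpace → BLPSpace} {S : Set BLPSpace}
    (hS : IsPreconnected S) (hf : ∀ P ∈ S, ContDiffAt ℝ ∞ f P) (hsym : ∀ P ∈ S, SymAt f P)
    {P Q : BLPSpace} (hP : P ∈ S) (hQ : Q ∈ S) :
    (0 < (fderiv ℝ f P (0, 1, 0, 0, 0)).2.1 ↔ 0 < (fderiv ℝ f Q (0, 1, 0, 0, 0)).2.1) ∧
    (0 < (fderiv ℝ f P (0, 0, 1, 0, 0)).2.2.1 ↔ 0 < (fderiv ℝ f Q (0, 0, 1, 0, 0)).2.2.1) := by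
  have hc : ∀ (pr : BLPSpace →L[ℝ] ℝ) (w : BLPSpace),
      ContinuousOn (fun R => pr (fderiv ℝ f R w)) S := fun pr w R hR =>
    (pr.contDiff.contDiffAt.comp R
      (contDiffAt_fderiv_apply (hf R hR) w)).continuousAt.continuousWithinAt
  exact ⟨pos_iff_pos_of_isPreconnected hS (hc prX (0, 1, 0, 0, 0)) (fun R hR => (hsym R hR).Xx_ne)
    hP hQ, pos_iff_pos_of_isPreconnected hS (hc prY (0, 0, 1, 0, 0))
    (fun R hR => (hsym R hR).Yy_ne) hP hQ⟩

theorem signs_eq_of_isPreconnected {f : BLPSpace → BLPSpace} {S : Set BLPSpace}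
    (hS : IsPreconnected S) (hf : ∀ P ∈ S, ContDiffAt ℝ ∞ f P) (hsym : ∀ P ∈ S, SymAt f P)
    {P Q : BLPSpace} (hP : P ∈ S) (hQ : Q ∈ S) : signs f P = signs f Q := by
  obtain ⟨h1, h2⟩ := signs_pos_of_isPreconnected hS hf hsym hP hQ
  simp only [signs, signClass, h1, h2]

/-- The explicit form of the orientation preserving elements of the symmetry group. -/
theorem exists_parameters_of_mem {Φ : Diffeo} (h : Φ ∈ symmetryGroup)
    (hs : signs (Φ : BLPSpace ≃ₜ BLPSpace) 0 = 1) :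
    ∃ D : Parameters, (∀ t, 0 < D.a t) ∧ (∀ y, 0 < D.c y) ∧
      D.map = (Φ : BLPSpace ≃ₜ BLPSpace) := by
  set f : BLPSpace → BLPSpace := ⇑(Φ : BLPSpace ≃ₜ BLPSpace) with hf
  have hsm : ∀ P ∈ Set.univ, ContDiffAt ℝ ∞ f P := fun P _ => Φ.2.1.contDiffAt
  have hsym : ∀ P ∈ Set.univ, SymAt f P := fun P _ => mem_symmetryGroup.1 h P
  obtain ⟨T, Y, a, a', b, b', c, d, hmap, hsmooth, hder, hac⟩ := exists_symmetryMap isOpen_univ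
    convex_univ hsm hsym 0 0 0 0 0 (fun _ _ => Set.mem_univ _) (fun _ _ => Set.mem_univ _)
  rw [signs_eq_one] at hs
  have hpos : ∀ P : BLPSpace, 0 < a P.1 ∧ 0 < c P.2.2.1 := by
    intro P
    obtain ⟨h1, h2⟩ := signs_pos_of_isPreconnected isPreconnected_univ hsm hsym (Set.mem_univ P)
      (Set.mem_univ 0)
    rw [(hac P trivial).1, (hac P trivial).2]
    exact ⟨h1.2 hs.1, h2.2 hs.2⟩
  have ha : ∀ t, 0 < a t := fun t => (hpos (t, 0, 0, 0, 0)).1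
  have hc : ∀ y, 0 < c y := fun y => (hpos (0, 0, y, 0, 0)).2
  have hT : ∀ t, HasDerivAt T (a t ^ 2) t := fun t => (hder (t, 0, 0, 0, 0) trivial).1
  have hY : ∀ y, HasDerivAt Y (c y) y := fun y => (hder (0, 0, y, 0, 0) trivial).2.2.2
  have hTm : StrictMono T := strictMono_of_deriv_pos fun t => by
    rw [(hT t).deriv]; exact pow_pos (ha t) 2
  have hYm : StrictMono Y := strictMono_of_deriv_pos fun y => by rw [(hY y).deriv]; exact hc y
  -- Surjectivity of Φ passes to T and Y, which promotes these increasing functions to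
  -- homeomorphisms.
  have hTsurj : Function.Surjective T := fun t => by
    obtain ⟨P, hP⟩ := (Φ : BLPSpace ≃ₜ BLPSpace).surjective (t, 0, 0, 0, 0)
    exact ⟨P.1, by have := hmap P trivial; rw [hf, hP] at this; exact (congrArg (·.1) this).symm⟩
  have hYsurj : Function.Surjective Y := fun y => by
    obtain ⟨P, hP⟩ := (Φ : BLPSpace ≃ₜ BLPSpace).surjective (0, 0, y, 0, 0)
    exact ⟨P.2.2.1, by
      have := hmap P trivial; rw [hf, hP] at this; exact (congrArg (·.2.2.1) this).symm⟩
  refine ⟨{ T := (hTm.orderIsoOfSurjective T hTsurj).toHomeomorph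
            Y := (hYm.orderIsoOfSurjective Y hYsurj).toHomeomorph
            a := a, a' := a', b := b, b' := b', c := c, d := d
            hT := hT
            ha := fun t => (hder (t, 0, 0, 0, 0) trivial).2.1
            hb := fun t => (hder (t, 0, 0, 0, 0) trivial).2.2.1
            hY := hY
            smooth_a := contDiff_iff_contDiffAt.2 fun t => (hsmooth (t, 0, 0, 0, 0) trivial).1
            smooth_b := contDiff_iff_contDiffAt.2 fun t => (hsmooth (t, 0, 0, 0, 0) trivial).2.1
            smooth_c := contDiff_iff_contDiffAt.2 fun y => (hsmooth (0, 0, y, 0, 0) trivial).2.2.1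
            smooth_d := contDiff_iff_contDiffAt.2 fun y => (hsmooth (0, 0, y, 0, 0) trivial).2.2.2
            a_ne := fun t => (ha t).ne'
            c_ne := fun y => (hc y).ne' }, ha, hc, ?_⟩
  funext P
  exact (hmap P trivial).symm

/-- There is a smooth map of the line into a given neighbourhood of a point that is the identity
near this point. -/
theorem exists_smooth_retraction (t0 : ℝ) {r : ℝ} (hr : 0 < r) :
    ∃ ρ : ℝ → ℝ, ContDiff ℝ ∞ ρ ∧ (∀ t, ρ t ∈ Metric.closedBall t0 (r / 2)) ∧
      ∀ᶠ t in 𝓝 t0, ρ t = t := by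
  let χ : ContDiffBump t0 := ⟨r / 4, r / 2, by positivity, by linarith⟩
  have hχ : ContDiff ℝ ∞ χ := χ.contDiff
  refine ⟨fun t => t0 + χ t * (t - t0), by fun_prop, fun t => ?_, ?_⟩
  · rw [Metric.mem_closedBall, Real.dist_eq, add_sub_cancel_left, abs_mul, abs_of_nonneg χ.nonneg]
    by_cases ht : r / 2 ≤ dist t t0
    · rw [χ.zero_of_le_dist ht, zero_mul]
      positivity
    · have h1 : |t - t0| < r / 2 := by rw [← Real.dist_eq]; exact not_le.1 ht
      calc χ t * |t - t0| ≤ 1 * |t - t0| := by gcongr; exact χ.le_one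
        _ ≤ r / 2 := by linarith
  · filter_upwards [χ.eventuallyEq_one] with t ht
    rw [ht]
    simp

/-- The values of ρ stay in a compact ball on which g is defined. So g ∘ ρ is smooth on the line,
and a positive g acquires a positive lower bound. -/
theorem exists_pos_le_comp {g ρ : ℝ → ℝ} {t0 r : ℝ} (hr : 0 < r)
    (hg : ∀ t ∈ Metric.ball t0 r, ContDiffAt ℝ ∞ g t) (hρ : ContDiff ℝ ∞ ρ)
    (hρr : ∀ t, ρ t ∈ Metric.closedBall t0 (r / 2)) :
    ContDiff ℝ ∞ (fun t => g (ρ t)) ∧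
      ((∀ t ∈ Metric.ball t0 r, 0 < g t) → ∃ m : ℝ, 0 < m ∧ ∀ t, m ≤ g (ρ t)) := by
  have hsub : Metric.closedBall t0 (r / 2) ⊆ Metric.ball t0 r :=
    Metric.closedBall_subset_ball (by linarith)
  refine ⟨contDiff_iff_contDiffAt.2 fun t => (hg _ (hsub (hρr t))).comp t hρ.contDiffAt, ?_⟩
  intro hpos
  obtain ⟨x, hx, hmin⟩ := (isCompact_closedBall t0 (r / 2)).exists_isMinOn
    ⟨t0, Metric.mem_closedBall_self (by positivity)⟩
    (fun t ht => (hg t (hsub ht)).continuousAt.continuousWithinAt)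
  exact ⟨g x, hpos x (hsub hx), fun t => hmin (hρr t)⟩

/-- The uniform lower bound makes the primitive grow at least linearly at both ends, so it is a
homeomorphism of the line. -/
theorem exists_antiderivative {g : ℝ → ℝ} (hg : Continuous g) {m : ℝ} (hm : 0 < m)
    (h : ∀ t, m ≤ g t) (t0 v : ℝ) : ∃ e : ℝ ≃ₜ ℝ, e t0 = v ∧ ∀ t, HasDerivAt e (g t) t := by
  have hd : ∀ t, HasDerivAt (fun t => v + ∫ x in t0..t, g x) (g t) t := fun t =>
    (intervalIntegral.integral_hasDerivAt_right (hg.intervalIntegrable _ _)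
      (hg.stronglyMeasurableAtFilter _ _) hg.continuousAt).const_add v
  have hmono : Monotone fun t => (v + ∫ x in t0..t, g x) - m * t := by
    have hd' : ∀ t, HasDerivAt (fun t => (v + ∫ x in t0..t, g x) - m * t) (g t - m) t := fun t => by
      simpa using (hd t).fun_sub ((hasDerivAt_id t).const_mul m)
    exact monotone_of_deriv_nonneg (fun t => (hd' t).differentiableAt) fun t => by
      rw [(hd' t).deriv]; linarith [h t]
  have htop : Tendsto (fun t => v + ∫ x in t0..t, g x) atTop atTop := by
    have h1 : Tendsto (fun t => m * t + (v - m * t0)) atTop atTop :=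
      tendsto_atTop_add_const_right _ _ (tendsto_id.const_mul_atTop hm)
    refine tendsto_atTop_mono' _ ?_ h1
    filter_upwards [eventually_ge_atTop t0] with t ht
    have := hmono ht
    simp only [intervalIntegral.integral_same, add_zero] at this
    linarith
  have hbot : Tendsto (fun t => v + ∫ x in t0..t, g x) atBot atBot := by
    have h1 : Tendsto (fun t => m * t + (v - m * t0)) atBot atBot :=
      tendsto_atBot_add_const_right _ _ (tendsto_id.const_mul_atBot hm)
    refine tendsto_atBot_mono' _ ?_ h1
    filter_upwards [eventually_le_atBot t0] with t ht
    have := hmono ht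
    simp only [intervalIntegral.integral_same, add_zero] at this
    linarith
  obtain ⟨e, he⟩ := exists_homeomorph_of_deriv_pos hd (fun t => hm.trans_le (h t)) htop hbot
  exact ⟨e, by rw [he]; simp, fun t => by rw [he]; exact hd t⟩

theorem eventuallyEq_of_hasDerivAt {f g f' g' : ℝ → ℝ} {t0 : ℝ}
    (hf : ∀ᶠ t in 𝓝 t0, HasDerivAt f (f' t) t) (hg : ∀ᶠ t in 𝓝 t0, HasDerivAt g (g' t) t)
    (h : f' =ᶠ[𝓝 t0] g') (h0 : f t0 = g t0) : f =ᶠ[𝓝 t0] g := by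
  obtain ⟨r, hr, hball⟩ := Metric.mem_nhds_iff.1 (hf.and (hg.and h))
  filter_upwards [Metric.ball_mem_nhds t0 hr] with t ht
  have hd : ∀ s ∈ Metric.ball t0 r, HasDerivAt (fun s => f s - g s) 0 s := fun s hs => by
    obtain ⟨h1, h2, h3⟩ := hball hs
    have h4 := h1.fun_sub h2
    rwa [h3, sub_self] at h4
  have := Metric.isOpen_ball.is_const_of_deriv_eq_zero (x := t) (y := t0)
    (convex_ball t0 r).isPreconnected
    (fun s hs => (hd s hs).differentiableAt.differentiableWithinAt)
    (fun s hs => (hd s hs).deriv) ht (Metric.mem_ball_self hr)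
  simp only [h0, sub_self] at this
  linarith

/-- Locally, an orientation preserving symmetry coincides with a symmetry of the whole space. -/
theorem exists_parameters_eventuallyEq {f : BLPSpace → BLPSpace} {W : Set BLPSpace}
    (hW : IsOpen W) (hf : ∀ P ∈ W, ContDiffAt ℝ ∞ f P) (hsym : ∀ P ∈ W, SymAt f P) {p : BLPSpace}
    (hp : p ∈ W) (hs : signs f p = 1) :
    ∃ D : Parameters, (∀ t, 0 < D.a t) ∧ (∀ y, 0 < D.c y) ∧ f =ᶠ[𝓝 p] D.map := by
  obtain ⟨t0, x0, y0, u0, v0⟩ := p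
  obtain ⟨r, hr, hball⟩ := Metric.isOpen_iff.1 hW _ hp
  set S := Metric.ball ((t0, x0, y0, u0, v0) : BLPSpace) r with hS
  have hmem : ∀ P : BLPSpace, P ∈ S ↔ dist P.1 t0 < r ∧ dist P.2.1 x0 < r ∧ dist P.2.2.1 y0 < r ∧
      dist P.2.2.2.1 u0 < r ∧ dist P.2.2.2.2 v0 < r := by
    intro P
    simp only [hS, Metric.mem_ball, Prod.dist_eq, max_lt_iff]
  have hpS : ((t0, x0, y0, u0, v0) : BLPSpace) ∈ S := Metric.mem_ball_self hr
  have hm1 : ∀ t ∈ Metric.ball t0 r, ((t, x0, y0, u0, v0) : BLPSpace) ∈ S := fun t ht =>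
    (hmem _).2 ⟨ht, by simpa using hr, by simpa using hr, by simpa using hr, by simpa using hr⟩
  have hm2 : ∀ y ∈ Metric.ball y0 r, ((t0, x0, y, u0, v0) : BLPSpace) ∈ S := fun y hy =>
    (hmem _).2 ⟨by simpa using hr, by simpa using hr, hy, by simpa using hr, by simpa using hr⟩
  have hfS : ∀ P ∈ S, ContDiffAt ℝ ∞ f P := fun P hP => hf P (hball hP)
  have hsymS : ∀ P ∈ S, SymAt f P := fun P hP => hsym P (hball hP)
  obtain ⟨T, Y, a, a', b, b', c, d, hmap, hsmooth, hder, hac⟩ := exists_symmetryMap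
    Metric.isOpen_ball (convex_ball _ r) hfS hsymS t0 x0 y0 u0 v0
    (fun P hP => hm1 _ ((hmem P).1 hP).1) (fun P hP => hm2 _ ((hmem P).1 hP).2.2.1)
  rw [signs_eq_one] at hs
  have hpos : ∀ P ∈ S, 0 < a P.1 ∧ 0 < c P.2.2.1 := by
    intro P hP
    obtain ⟨h1, h2⟩ := signs_pos_of_isPreconnected (convex_ball _ r).isPreconnected hfS hsymS hP hpS
    rw [(hac P hP).1, (hac P hP).2]
    exact ⟨h1.2 hs.1, h2.2 hs.2⟩
  obtain ⟨ρ, hρ, hρr, hρe⟩ := exists_smooth_retraction t0 hr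
  obtain ⟨η, hη, hηr, hηe⟩ := exists_smooth_retraction y0 hr
  obtain ⟨sa, pa⟩ := exists_pos_le_comp hr (fun t ht => (hsmooth _ (hm1 t ht)).1) hρ hρr
  obtain ⟨sb, -⟩ := exists_pos_le_comp hr (fun t ht => (hsmooth _ (hm1 t ht)).2.1) hρ hρr
  obtain ⟨sc, pc⟩ := exists_pos_le_comp hr (fun t ht => (hsmooth _ (hm2 t ht)).2.2.1) hη hηr
  obtain ⟨sd, -⟩ := exists_pos_le_comp hr (fun t ht => (hsmooth _ (hm2 t ht)).2.2.2) hη hηr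
  obtain ⟨ma, hma, hma'⟩ := pa fun t ht => (hpos _ (hm1 t ht)).1
  obtain ⟨mc, hmc, hmc'⟩ := pc fun t ht => (hpos _ (hm2 t ht)).2
  -- T is rebuilt by integrating (a ∘ ρ)² instead of being composed with ρ, because T' = a² has to
  -- hold on the whole line. Near the base point nothing changes.
  obtain ⟨T₁, hT₁, hT₁'⟩ := exists_antiderivative (g := fun t => a (ρ t) ^ 2)
    (sa.continuous.pow 2) (pow_pos hma 2) (fun t => pow_le_pow_left₀ hma.le (hma' t) 2) t0 (T t0)
  obtain ⟨Y₁, hY₁, hY₁'⟩ := exists_antiderivative (g := fun y => c (η y))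
    sc.continuous hmc hmc' y0 (Y y0)
  have nt : ∀ᶠ t in 𝓝 t0, t ∈ Metric.ball t0 r := Metric.ball_mem_nhds t0 hr
  have ny : ∀ᶠ y in 𝓝 y0, y ∈ Metric.ball y0 r := Metric.ball_mem_nhds y0 hr
  have eT : T =ᶠ[𝓝 t0] T₁ := eventuallyEq_of_hasDerivAt
    (nt.mono fun t ht => (hder _ (hm1 t ht)).1) (Eventually.of_forall hT₁')
    (hρe.mono fun t ht => by simp only [ht]) hT₁.symm
  have eY : Y =ᶠ[𝓝 y0] Y₁ := eventuallyEq_of_hasDerivAt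
    (ny.mono fun y hy => (hder _ (hm2 y hy)).2.2.2) (Eventually.of_forall hY₁')
    (hηe.mono fun t ht => by simp only [ht]) hY₁.symm
  have ea : (fun t => a (ρ t)) =ᶠ[𝓝 t0] a := hρe.mono fun t ht => by simp only [ht]
  have eb : (fun t => b (ρ t)) =ᶠ[𝓝 t0] b := hρe.mono fun t ht => by simp only [ht]
  have ea' : deriv (fun t => a (ρ t)) =ᶠ[𝓝 t0] a' := by
    filter_upwards [ea.deriv, nt] with t h1 h2
    rw [h1, ((hder _ (hm1 t h2)).2.1).deriv]
  have eb' : deriv (fun t => b (ρ t)) =ᶠ[𝓝 t0] b' := by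
    filter_upwards [eb.deriv, nt] with t h1 h2
    rw [h1, ((hder _ (hm1 t h2)).2.2.1).deriv]
  refine ⟨{ T := T₁
            Y := Y₁
            a := fun t => a (ρ t), a' := deriv fun t => a (ρ t)
            b := fun t => b (ρ t), b' := deriv fun t => b (ρ t)
            c := fun y => c (η y), d := fun y => d (η y)
            hT := hT₁'
            ha := fun t => (sa.differentiable (by simp) t).hasDerivAt
            hb := fun t => (sb.differentiable (by simp) t).hasDerivAt
            hY := hY₁'
            smooth_a := sa, smooth_b := sb, smooth_c := sc, smooth_d := sd
            a_ne := fun t => (hma.trans_le (hma' t)).ne'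
            c_ne := fun y => (hmc.trans_le (hmc' y)).ne' },
    fun t => hma.trans_le (hma' t), fun y => hmc.trans_le (hmc' y), ?_⟩
  have ct : Tendsto (fun P : BLPSpace => P.1) (𝓝 (t0, x0, y0, u0, v0)) (𝓝 t0) :=
    continuous_fst.continuousAt
  have cy : Tendsto (fun P : BLPSpace => P.2.2.1) (𝓝 (t0, x0, y0, u0, v0)) (𝓝 y0) :=
    (continuous_fst.comp (continuous_snd.comp continuous_snd)).continuousAt
  filter_upwards [Metric.ball_mem_nhds _ hr, ct.eventually hρe, cy.eventually hηe, ct.eventually eT,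
    cy.eventually eY, ct.eventually ea', ct.eventually eb'] with P h1 h2 h3 h4 h5 h6 h7
  rw [hmap P h1]
  simp only [Parameters.map, symmetryMap, h2, h3, h4, h5, h6, h7]

end BLP

/-! ### The identity component of the pseudogroup. -/

namespace BLP
open Filter Topology

/-- The germ extends to a symmetry of the whole space with positive parameters, and the explicit
path for that symmetry restricts to a neighbourhood of the point. -/
theorem inIdentityComponentAt_of_signs {Φ : OpenPartialHomeomorph BLPSpace BLPSpace}
    (hΦ : IsPointSymmetry Φ) {p : BLPSpace} (hp : p ∈ Φ.source) (hs : signs Φ p = 1) :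
    InIdentityComponentAt symmetryPseudogroup Φ p := by
  obtain ⟨D, ha, hc, hD⟩ := exists_parameters_eventuallyEq Φ.open_source
    (fun P hP => hΦ.contDiffAt hP) (fun P hP => hΦ.symAt hP) hp hs
  obtain ⟨E, hE0, hE1, hE⟩ := D.exists_path ha hc
  obtain ⟨U, hU, hUo, hpU⟩ := mem_nhds_iff.1 (inter_mem hD (Φ.open_source.mem_nhds hp))
  refine ⟨U, fun z => (E z.1).map z.2, hUo, hpU, fun q hq => (hU hq).2, hE.contDiffOn,
    fun q _ => hE0 q, fun q hq => ?_, fun s _ => ?_⟩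
  · simp only [hE1]
    exact (hU hq).1.symm
  · exact ⟨((E s).toDiffeo : BLPSpace ≃ₜ BLPSpace).toOpenPartialHomeomorph, (E s).toDiffeo_mem,
      Set.subset_univ _, fun q _ => rfl⟩

/-- Along the family X_x and Y_y at the point are continuous in s, nonzero because every member is a
symmetry, and equal to 1 at s = 0. -/
theorem signs_of_inIdentityComponentAt {Φ : OpenPartialHomeomorph BLPSpace BLPSpace}
    {p : BLPSpace} (h : InIdentityComponentAt symmetryPseudogroup Φ p) : signs Φ p = 1 := by
  obtain ⟨U, F, hU, hp, hsrc, hF, h0, h1, hs⟩ := h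
  have hmem : ∀ s ∈ Set.Icc (0 : ℝ) 1, ((s, p) : ℝ × BLPSpace) ∈ Set.Icc (0 : ℝ) 1 ×ˢ U :=
    fun s hs => ⟨hs, hp⟩
  have hUD : UniqueDiffOn ℝ (Set.Icc (0 : ℝ) 1 ×ˢ U) :=
    (uniqueDiffOn_Icc zero_lt_one).prod hU.uniqueDiffOn
  -- F is smooth only within the closed interval times `U`, so continuity in s is obtained from the
  -- derivative within this set.
  have hder : ∀ s ∈ Set.Icc (0 : ℝ) 1, ∀ w : BLPSpace,
      fderiv ℝ (fun q => F (s, q)) p w =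
        fderivWithin ℝ F (Set.Icc (0 : ℝ) 1 ×ˢ U) (s, p) (0, w) := by
    intro s hs w
    have h1 := ((hF (s, p) (hmem s hs)).differentiableWithinAt (by simp)).hasFDerivWithinAt
    have h2 : HasFDerivWithinAt (fun q : BLPSpace => (s, q)) (ContinuousLinearMap.inr ℝ ℝ BLPSpace)
        U p := (hasFDerivAt_prodMk_right s p).hasFDerivWithinAt
    have h3 := h1.comp p h2 fun q hq => ⟨hs, hq⟩
    exact congrArg (fun A : BLPSpace →L[ℝ] BLPSpace => A w) (h3.hasFDerivAt (hU.mem_nhds hp)).fderiv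
  have hcont : ∀ (pr : BLPSpace →L[ℝ] ℝ) (w : BLPSpace), ContinuousOn
      (fun s => pr (fderiv ℝ (fun q => F (s, q)) p w)) (Set.Icc (0 : ℝ) 1) := by
    intro pr w
    have hc := (hF.continuousOn_fderivWithin hUD (by simp)).comp
      (Continuous.continuousOn (by fun_prop) : ContinuousOn (fun s : ℝ => ((s, p) : ℝ × BLPSpace))
        (Set.Icc (0 : ℝ) 1)) hmem
    refine ContinuousOn.congr (pr.continuous.comp_continuousOn (hc.clm_apply (continuousOn_const (c := ((0 : ℝ), w)))))
      fun s hs => ?_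
    rw [hder s hs w]
    rfl
  have hsym : ∀ s ∈ Set.Icc (0 : ℝ) 1, SymAt (fun q => F (s, q)) p := by
    intro s hs'
    obtain ⟨Ψ, hΨ, hUΨ, hEq⟩ := hs s hs'
    have hev : (fun q => F (s, q)) =ᶠ[𝓝 p] Ψ := by
      filter_upwards [hU.mem_nhds hp] with q hq using hEq q hq
    exact (symAt_congr hev).2 (IsPointSymmetry.symAt hΨ (hUΨ hp))
  have e0 : (fun q => F (0, q)) =ᶠ[𝓝 p] id := by
    filter_upwards [hU.mem_nhds hp] with q hq using h0 q hq
  have e1 : (fun q => F (1, q)) =ᶠ[𝓝 p] Φ := by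
    filter_upwards [hU.mem_nhds hp] with q hq using h1 q hq
  have hX := pos_iff_pos_of_isPreconnected isPreconnected_Icc (hcont prX (0, 1, 0, 0, 0))
    (fun s hs => (hsym s hs).Xx_ne) (Set.left_mem_Icc.2 zero_le_one)
    (Set.right_mem_Icc.2 zero_le_one)
  have hY := pos_iff_pos_of_isPreconnected isPreconnected_Icc (hcont prY (0, 0, 1, 0, 0))
    (fun s hs => (hsym s hs).Yy_ne) (Set.left_mem_Icc.2 zero_le_one)
    (Set.right_mem_Icc.2 zero_le_one)
  rw [e0.fderiv_eq, e1.fderiv_eq, fderiv_id] at hX hY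
  exact signs_eq_one.2 ⟨hX.1 (by simp [prX_apply]), hY.1 (by simp [prY_apply])⟩

theorem exists_parameters_signs (a : Multiplicative (ZMod 2) × Multiplicative (ZMod 2))
    (p q : BLPSpace) : ∃ D : Parameters, D.map p = q ∧ ∀ P, signs D.map P = a := by
  obtain ⟨ε, hε, hεa⟩ := exists_signClass a.1
  obtain ⟨δ, hδ, hδa⟩ := exists_signClass a.2
  have hε2 : ε ^ 2 = 1 := by rcases hε with rfl | rfl <;> norm_num
  have hδ2 : δ * δ = 1 := by rcases hδ with rfl | rfl <;> norm_num
  have hε0 : ε ≠ 0 := by rintro rfl; norm_num at hε2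
  have hδ0 : δ ≠ 0 := by rintro rfl; norm_num at hδ2
  -- The u-coordinate can be moved only through b', which enters U as -b'/(2a²) with a² = ε² = 1;
  -- this slope sends the u-coordinate of `p` to that of `q`.
  set b1 := 2 * (p.2.2.2.1 / ε - q.2.2.2.1) with hb1
  let D : Parameters :=
    { T := Homeomorph.addRight (q.1 - p.1)
      Y := { toFun := fun y => δ * (y - p.2.2.1) + q.2.2.1
             invFun := fun y => δ * (y - q.2.2.1) + p.2.2.1
             left_inv := fun y => by
               show δ * (δ * (y - p.2.2.1) + q.2.2.1 - q.2.2.1) + p.2.2.1 = y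
               linear_combination (y - p.2.2.1) * hδ2
             right_inv := fun y => by
               show δ * (δ * (y - q.2.2.1) + p.2.2.1 - p.2.2.1) + q.2.2.1 = y
               linear_combination (y - q.2.2.1) * hδ2
             continuous_toFun := by fun_prop
             continuous_invFun := by fun_prop }
      a := fun _ => ε
      a' := fun _ => 0
      b := fun t => b1 * (t - p.1) + (q.2.1 - ε * p.2.1)
      b' := fun _ => b1
      c := fun _ => δ
      d := fun _ => q.2.2.2.2 - p.2.2.2.2 / δ
      hT := fun t => by
        simp only [hε2]
        exact (hasDerivAt_id t).add_const (q.1 - p.1)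
      ha := fun t => hasDerivAt_const t ε
      hb := fun t => by
        simpa using (((hasDerivAt_id t).sub_const p.1).const_mul b1).add_const (q.2.1 - ε * p.2.1)
      hY := fun y => by
        have h := (((hasDerivAt_id y).sub_const p.2.2.1).const_mul δ).add_const q.2.2.1
        rw [mul_one] at h
        exact h
      smooth_a := contDiff_const
      smooth_b := by fun_prop
      smooth_c := contDiff_const
      smooth_d := contDiff_const
      a_ne := fun _ => hε0
      c_ne := fun _ => hδ0 }
  refine ⟨D, ?_, fun P => ?_⟩
  · have e1 : p.1 + (q.1 - p.1) = q.1 := by ring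
    have e2 : ε * p.2.1 + (b1 * (p.1 - p.1) + (q.2.1 - ε * p.2.1)) = q.2.1 := by ring
    have e3 : δ * (p.2.2.1 - p.2.2.1) + q.2.2.1 = q.2.2.1 := by ring
    have e4 : p.2.2.2.1 / ε - (0 * p.2.1 + b1) / (2 * ε ^ 2) = q.2.2.2.1 := by
      rw [hε2, hb1]; ring
    have e5 : p.2.2.2.2 / δ + (q.2.2.2.2 - p.2.2.2.2 / δ) = q.2.2.2.2 := by ring
    exact Prod.ext e1 (Prod.ext e2 (Prod.ext e3 (Prod.ext e4 e5)))
  · rw [D.signs_map]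
    exact Prod.ext hεa hδa

theorem factorByIdentityComponent : FactorByIdentityComponent symmetryPseudogroup
    (Multiplicative (ZMod 2) × Multiplicative (ZMod 2)) := by
  refine ⟨fun Φ p => signs Φ p, ?_, ?_, ?_⟩
  · intro Φ hΦ Ψ hΨ p hp
    rw [Φ.trans_source] at hp
    exact signs_comp (IsPointSymmetry.symAt hΨ hp.2) (IsPointSymmetry.symAt hΦ hp.1)
      (smooth_differentiableAt (IsPointSymmetry.contDiffAt hΨ hp.2))
      (smooth_differentiableAt (IsPointSymmetry.contDiffAt hΦ hp.1))
  · intro Φ hΦ p hp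
    exact ⟨inIdentityComponentAt_of_signs hΦ hp, signs_of_inIdentityComponentAt⟩
  · intro a p q
    obtain ⟨D, hD, hs⟩ := exists_parameters_signs a p q
    exact ⟨(D.toDiffeo : BLPSpace ≃ₜ BLPSpace).toOpenPartialHomeomorph, D.toDiffeo_mem,
      Set.mem_univ p, hD, hs p⟩

end BLP

/-! ### The C^∞ topology and the identity component of the group. -/

namespace BLP
open Filter Topology

/-- Uniform convergence of first derivatives on the compact set {P} is already enough. This makes
the sign conditions open, and closed, in the group. -/
theorem Diffeo.continuous_fderiv_apply (P w : BLPSpace) :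
    Continuous fun Φ : Diffeo => fderiv ℝ (Φ : BLPSpace ≃ₜ BLPSpace) P w := by
  have h1 : Continuous fun Φ : Diffeo => UniformOnFun.ofFun {K : Set BLPSpace | IsCompact K}
      (iteratedFDeriv ℝ 1 (Φ : BLPSpace ≃ₜ BLPSpace)) :=
    continuous_iInf_dom (i := 1) continuous_induced_dom
  have h2 := (UniformOnFun.uniformContinuous_eval_of_mem
    (BLPSpace [×1]→L[ℝ] BLPSpace) {K : Set BLPSpace | IsCompact K} (x := P) (s := {P})
    (Set.mem_singleton P) isCompact_singleton).continuous.comp h1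
  have h3 := (continuous_eval_const (F := BLPSpace [×1]→L[ℝ] BLPSpace) (fun _ => w)).comp h2
  refine h3.congr fun Φ => ?_
  exact iteratedFDeriv_one_apply _

/-- A slice is the joint map composed with an affine inclusion, so its derivatives inherit joint
continuity in (s, P). -/
theorem iteratedFDeriv_slice {G : ℝ × BLPSpace → BLPSpace} (hG : ContDiff ℝ ∞ G) (k : ℕ) (s : ℝ)
    (P : BLPSpace) : iteratedFDeriv ℝ k (fun Q => G (s, Q)) P =
      (iteratedFDeriv ℝ k G (s, P)).compContinuousLinearMap
        fun _ => ContinuousLinearMap.inr ℝ ℝ BLPSpace := by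
  have h1 : (fun Q => G (s, Q)) =
      (fun z => G ((s, 0) + z)) ∘ ContinuousLinearMap.inr ℝ ℝ BLPSpace := by
    funext Q; simp
  have hG' : ContDiff ℝ ∞ fun z => G ((s, 0) + z) := hG.comp (contDiff_const.add contDiff_id)
  rw [h1, (ContinuousLinearMap.inr ℝ ℝ BLPSpace).iteratedFDeriv_comp_right hG' P
    (natCast_le_infty k), iteratedFDeriv_comp_add_left]
  simp

/-- Smooth families of diffeomorphisms are continuous in the `C^∞` compact-open topology. -/
theorem Diffeo.continuous_of_smooth {Γ : ℝ → Diffeo}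
    (h : ContDiff ℝ ∞ fun z : ℝ × BLPSpace => (Γ z.1 : BLPSpace ≃ₜ BLPSpace) z.2) :
    Continuous Γ := by
  refine continuous_iInf_rng.2 fun k => continuous_induced_rng.2 ?_
  have hjoint : Continuous fun z : ℝ × BLPSpace =>
      iteratedFDeriv ℝ k (Γ z.1 : BLPSpace ≃ₜ BLPSpace) z.2 := by
    have h1 : Continuous (iteratedFDeriv ℝ k fun z : ℝ × BLPSpace =>
        (Γ z.1 : BLPSpace ≃ₜ BLPSpace) z.2) := h.continuous_iteratedFDeriv (natCast_le_infty k)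
    have h2 := (ContinuousMultilinearMap.compContinuousLinearMapL (F := BLPSpace)
      fun _ : Fin k => ContinuousLinearMap.inr ℝ ℝ BLPSpace).continuous.comp h1
    exact h2.congr fun z => (iteratedFDeriv_slice h k z.1 z.2).symm
  refine continuous_iff_continuousAt.2 fun s => ?_
  refine UniformOnFun.tendsto_iff_tendstoUniformlyOn.2 fun K hK => ?_
  intro V hV
  -- Joint continuity together with compactness of `K` gives convergence uniform on `K`.
  obtain ⟨v, hv, hvV⟩ := IsCompact.mem_uniformity_of_prod (s := Set.univ) (k := K)
    (f := fun (s : ℝ) (P : BLPSpace) => iteratedFDeriv ℝ k (Γ s : BLPSpace ≃ₜ BLPSpace) P) hK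
    hjoint.continuousOn (Set.mem_univ s) (symm_le_uniformity hV)
  rw [nhdsWithin_univ] at hv
  filter_upwards [hv] with s' hs' P hP using hvV s' hs' P hP

/-- The homomorphism from the symmetry group to its group of connected components. -/
noncomputable def signsHom :
    symmetryGroup →* Multiplicative (ZMod 2) × Multiplicative (ZMod 2) :=
  MonoidHom.mk' (fun Φ => signs ((Φ : Diffeo) : BLPSpace ≃ₜ BLPSpace) 0) (by
    intro Φ Ψ
    have hd : ∀ Φ : Diffeo, ∀ P, DifferentiableAt ℝ (Φ : BLPSpace ≃ₜ BLPSpace) P := fun Φ P =>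
      smooth_differentiableAt Φ.2.1.contDiffAt
    have h := signs_comp (f := ((Ψ : Diffeo) : BLPSpace ≃ₜ BLPSpace))
      (g := ((Φ : Diffeo) : BLPSpace ≃ₜ BLPSpace)) (P := 0) (mem_symmetryGroup.1 Φ.2 _)
      (mem_symmetryGroup.1 Ψ.2 _) (hd _ _) (hd _ _)
    -- Composition produces the signs of Φ at Ψ(0); they are constant on the connected space, so the
    -- base point can be moved back to 0.
    rw [signs_eq_of_isPreconnected isPreconnected_univ (Q := 0)
      (fun P _ => (Φ : Diffeo).2.1.contDiffAt) (fun P _ => mem_symmetryGroup.1 Φ.2 P)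
      (Set.mem_univ _) (Set.mem_univ _)] at h
    exact h)

theorem signsHom_surjective : Function.Surjective signsHom := by
  intro a
  obtain ⟨D, -, hD⟩ := exists_parameters_signs a 0 0
  exact ⟨⟨D.toDiffeo, D.toDiffeo_mem⟩, hD 0⟩

theorem mem_ker_signsHom {Φ : symmetryGroup} : Φ ∈ signsHom.ker ↔
    0 < (fderiv ℝ ((Φ : Diffeo) : BLPSpace ≃ₜ BLPSpace) 0 (0, 1, 0, 0, 0)).2.1 ∧
    0 < (fderiv ℝ ((Φ : Diffeo) : BLPSpace ≃ₜ BLPSpace) 0 (0, 0, 1, 0, 0)).2.2.1 :=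
  signs_eq_one

/-- Elements with positive signs are joined to the identity by the explicit path, which is
continuous in the C^∞ topology. Conversely the kernel is clopen: since X_x and Y_y never vanish, the
strict and the weak inequalities define the same set. -/
theorem ker_signsHom_eq_connectedComponent :
    (signsHom.ker : Set symmetryGroup) = connectedComponent (1 : symmetryGroup) := by
  apply Set.Subset.antisymm
  · intro Φ hΦ
    obtain ⟨D, ha, hc, hD⟩ := exists_parameters_of_mem Φ.2 hΦ
    obtain ⟨E, hE0, hE1, hE⟩ := D.exists_path ha hc
    have hcont : Continuous fun s => (⟨(E s).toDiffeo, (E s).toDiffeo_mem⟩ : symmetryGroup) :=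
      (Diffeo.continuous_of_smooth (Γ := fun s => (E s).toDiffeo) hE).subtype_mk _
    have h0 : (⟨(E 0).toDiffeo, (E 0).toDiffeo_mem⟩ : symmetryGroup) = 1 :=
      Subtype.ext (Subtype.ext (Homeomorph.ext hE0))
    have h1 : (⟨(E 1).toDiffeo, (E 1).toDiffeo_mem⟩ : symmetryGroup) = Φ :=
      Subtype.ext (Subtype.ext (Homeomorph.ext fun P => congrFun (hE1.trans hD) P))
    have hpre := isPreconnected_univ.image _ hcont.continuousOn
    exact hpre.subset_connectedComponent ⟨0, Set.mem_univ _, h0⟩ ⟨1, Set.mem_univ _, h1⟩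
  · refine IsClopen.connectedComponent_subset ?_ (one_mem _)
    have hc : ∀ (pr : BLPSpace →L[ℝ] ℝ) (w : BLPSpace), Continuous fun Φ : symmetryGroup =>
        pr (fderiv ℝ ((Φ : Diffeo) : BLPSpace ≃ₜ BLPSpace) 0 w) := fun pr w =>
      pr.continuous.comp ((Diffeo.continuous_fderiv_apply 0 w).comp continuous_subtype_val)
    have hX := hc prX (0, 1, 0, 0, 0)
    have hY := hc prY (0, 0, 1, 0, 0)
    constructor
    · have : (signsHom.ker : Set symmetryGroup) =
          {Φ : symmetryGroup | 0 ≤ prX (fderiv ℝ ((Φ : Diffeo) : BLPSpace ≃ₜ BLPSpace) 0 (0, 1, 0, 0, 0))} ∩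
          {Φ : symmetryGroup | 0 ≤ prY (fderiv ℝ ((Φ : Diffeo) : BLPSpace ≃ₜ BLPSpace) 0 (0, 0, 1, 0, 0))} := by
        ext Φ
        have hs := mem_symmetryGroup.1 Φ.2 0
        exact mem_ker_signsHom.trans ⟨fun h => ⟨h.1.le, h.2.le⟩, fun h =>
          ⟨lt_of_le_of_ne h.1 hs.Xx_ne.symm, lt_of_le_of_ne h.2 hs.Yy_ne.symm⟩⟩
      rw [this]
      exact (isClosed_le continuous_const hX).inter (isClosed_le continuous_const hY)
    · have : (signsHom.ker : Set symmetryGroup) =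
          {Φ : symmetryGroup | 0 < prX (fderiv ℝ ((Φ : Diffeo) : BLPSpace ≃ₜ BLPSpace) 0 (0, 1, 0, 0, 0))} ∩
          {Φ : symmetryGroup | 0 < prY (fderiv ℝ ((Φ : Diffeo) : BLPSpace ≃ₜ BLPSpace) 0 (0, 0, 1, 0, 0))} := by
        ext Φ
        exact mem_ker_signsHom
      rw [this]
      exact (isOpen_lt continuous_const hX).inter (isOpen_lt continuous_const hY)

end BLP

theorem mainTheorem3 :
    (∃ G : Subgroup BLP.Diffeo,
      (∀ Φ : BLP.Diffeo, Φ ∈ G ↔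
        BLP.IsPointSymmetry (Φ : BLPSpace ≃ₜ BLPSpace).toOpenPartialHomeomorph) ∧
      ∃ (N : Subgroup G) (_ : N.Normal),
        (N : Set G) = connectedComponent (1 : G) ∧
        Nonempty (G ⧸ N ≃* Multiplicative (ZMod 2) × Multiplicative (ZMod 2))) ∧
    (∃ 𝒢 : StructureGroupoid BLPSpace,
      (∀ Φ : OpenPartialHomeomorph BLPSpace BLPSpace, Φ ∈ 𝒢 ↔ BLP.IsPointSymmetry Φ) ∧
      BLP.FactorByIdentityComponent 𝒢
        (Multiplicative (ZMod 2) × Multiplicative (ZMod 2))) :=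
  ⟨⟨BLP.symmetryGroup, fun _ => Iff.rfl, BLP.signsHom.ker, inferInstance,
    BLP.ker_signsHom_eq_connectedComponent,
    ⟨QuotientGroup.quotientKerEquivOfSurjective _ BLP.signsHom_surjective⟩⟩,
    ⟨BLP.symmetryPseudogroup, fun _ => Iff.rfl, BLP.factorByIdentityComponent⟩⟩
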